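/- Let $n\ge 0$, $r\ge 1$ be integers, let $q\in\mathbb{C}\setminus\{0,\pm1\}$ and $Q_0,\dots,Q_{r-1}\in\mathbb{C}^\times$, let $\mathbf m=(m_1,\dots,m_r)$ be positive integers and $m=m_1+\dots+m_r$. For $1\le k\le r$, $1\le i\le m_k$ put $\xi(i,k)=m_1+\dots+m_{k-1}+i$, so that $\xi$ is a bijection onto $\{1,\dots,m\}$. **Algebras.** $\hat{\mathcal H}_n$ is the affine Hecke algebra of type $GL_n$: generators $T_i$ $(1\le i\le n-1)$, $X_j^{\pm1}$ $(1\le j\le n)$; relations $(T_i-q)(T_i+q^{-1})=0$, the braid relations, $X_jX_k=X_kX_j$, $T_iX_iT_i=X_{i+1}$, $T_iX_j=X_jT_i$ for $j\ne i,i+1$. $\mathcal H_{n,r}$ is the Ariki–Koike algebra: generators $T_0,\dots,T_{n-1}$; relations $\prod_{l=0}^{r-1}(T_0-Q_l)=0$, $(T_i-q)(T_i+q^{-1})=0$ for $i\ge1$, and the type $B$ braid relations. With $L_j=T_{j-1}\cdots T_1T_0T_1\cdots T_{j-1}$ there is a homomorphism $\hat{\mathcal H}_n\to\mathcal H_{n,r}$,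 $T_i\mapsto T_i$, $X_j\mapsto L_j$. For $1\le j\le n$, $1\le k\le r$ put $$L_j^{\langle k\rangle}=T_{j-1}\cdots T_1\,(T_0-Q_0)(T_0-Q_1)\cdots(T_0-Q_{k-1})\,T_1\cdots T_{j-1}.$$ $U_q(\widehat{\mathfrak{sl}}_m)$ is the quantum affine algebra in its Drinfeld–Jimbo presentation: Chevalley generators $e_i,f_i,k_i^{\pm}$ $(0\le i\le m-1)$ with the usual relations for the Cartan matrix $(a_{ij})$ of type $A^{(1)}_{m-1}$ ($k_i^+k_i^-=k_i^-k_i^+=1$, $k_i^+k_j^+=k_j^+k_i^+$, $k_i^+e_jk_i^-=q^{a_{ij}}e_j$, $k_i^+f_jk_i^-=q^{-a_{ij}}f_j$, $e_if_j-f_je_i=\delta_{i,j}(k_i^+-k_i^-)/(q-q^{-1})$ and the $q$-Serre relations), and coproduct $\Delta(e_i)=e_i\otimes k_i^++1\otimes e_i$, $\Delta(f_i)=f_i\otimes1+k_i^-\otimes f_i$, $\Delta(k_i^\pm)=k_i^\pm\otimes k_i^\pm$. **The bimodule.** Let $V$ have basis $v_1,\dots,v_m$ and let $\hat V=V\otimes\mathbb{C}[x^{\pm1}]$,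 on which $U_q(\widehat{\mathfrak{sl}}_m)$ acts, for $1\le i\le m-1$, by $e_i(v_j\otimes x^k)=\delta_{j,i+1}v_{j-1}\otimes x^k$, $f_i(v_j\otimes x^k)=\delta_{j,i}v_{j+1}\otimes x^k$, $k_i^\pm(v_j\otimes x^k)=q^{\pm(\delta_{j,i}-\delta_{j,i+1})}v_j\otimes x^k$, and by $e_0(v_j\otimes x^k)=\delta_{j,1}v_m\otimes x^{k+1}$, $f_0(v_j\otimes x^k)=\delta_{j,m}v_1\otimes x^{k-1}$, $k_0^\pm(v_j\otimes x^k)=q^{\pm(\delta_{j,m}-\delta_{j,1})}v_j\otimes x^k$. It acts on $\hat V^{\otimes n}=V^{\otimes n}\otimes\mathbb{C}[x_1^{\pm1},\dots,x_n^{\pm1}]$ through $\Delta$. The algebra $\hat{\mathcal H}_n$ acts on $\hat V^{\otimes n}$ from the right: $X_j$ is multiplication by $x_j$, and $T_i$ acts on the factors $i,i+1$ by $$(v_a\otimes v_b)\otimes x_1^{k}x_2^{l}\mapsto \mathcal T(v_a\otimes v_b)\otimes x_1^{l}x_2^{k}+(q-q^{-1})(v_a\otimes v_b)\otimes\frac{x_1^{l}x_2^{k}-x_1^{k}x_2^{l}}{x_1x_2^{-1}-1},$$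 where $\mathcal T(v_a\otimes v_b)$ is $q\,v_a\otimes v_b$ if $a=b$, $v_b\otimes v_a$ if $a<b$, and $v_b\otimes v_a+(q-q^{-1})v_a\otimes v_b$ if $a>b$. The two actions commute, and $\tilde V_{n,r}=\hat V^{\otimes n}\otimes_{\hat{\mathcal H}_n}\mathcal H_{n,r}$ is a $(U_q(\widehat{\mathfrak{sl}}_m),\mathcal H_{n,r})$-bimodule. **The submodule.** Let $\Lambda_n(m)$ be the set of $\mu\in\mathbb{Z}_{\ge0}^m$ with $\sum_i\mu_i=n$. For $\mu\in\Lambda_n(m)$ put $N_i^\mu=\mu_1+\dots+\mu_i$, put $a_k^\mu=\sum_{l=1}^{k}\sum_{i=1}^{m_l}\mu_{\xi(i,l)}$ for $0\le k\le r$, let $c_j^\mu=k$ if $a_{k-1}^\mu<j\le a_k^\mu$ $(1\le j\le n)$, and let $\tilde v_\mu=(v_1^{\otimes\mu_1}\otimes\dots\otimes v_m^{\otimes\mu_m})\otimes1\in\tilde V_{n,r}$. Let $\mathcal I_{\tilde V_{n,r}}$ be the $\mathcal H_{n,r}$-submodule of $\tilde V_{n,r}$ generated by all $\tilde v_\mu\cdot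 L_j^{\langle c_j^\mu\rangle}$ with $\mu\in\Lambda_n(m)$, $1\le j\le n$. **Claim.** (1) Let $1\le i\le m-1$ and $\mu\in\Lambda_n(m)$. If $\xi^{-1}(i)=(m_k,k)$ for some $k$ and $\mu_i\neq0$, then $$f_i\cdot\bigl(\tilde v_\mu\cdot L_{N_i^\mu}^{\langle c\rangle}\bigr)\notin\mathcal I_{\tilde V_{n,r}},\qquad c=c^{\mu}_{N_i^\mu}.$$ (2) Consequently, if $n\ge1$ and $r\ge2$, the action of $U_q(\widehat{\mathfrak{sl}}_m)$ on $\tilde V_{n,r}$ does not preserve the subspace $\mathcal I_{\tilde V_{n,r}}$. -/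

import Mathlib

open scoped TensorProduct

set_option linter.unusedSimpArgs false
set_option linter.unusedVariables false

noncomputable section

namespace SchurWeyl

/-! ### The quantum affine algebra `U_q(ŝl_m)` -/

/-- The Cartan matrix of type `A_{m-1}^{(1)}`, rows and columns indexed by `Fin m = {0, …, m-1}`;
`finRotate m` is the cyclic successor `i ↦ i + 1 (mod m)`.  (For `m = 2` the off-diagonal entries
are `-2`.) -/
def cartan (m : ℕ) (i j : Fin m) : ℤ :=
  2 * (if i = j then 1 else 0) - (if j = finRotate m i then 1 else 0)
    - (if i = finRotate m j then 1 else 0)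

/-- The generators `e_i, f_i, k_i^+, k_i^-` (`0 ≤ i ≤ m-1`). -/
inductive UqGen (m : ℕ) : Type
  | e (i : Fin m) : UqGen m
  | f (i : Fin m) : UqGen m
  | k (i : Fin m) : UqGen m
  | kInv (i : Fin m) : UqGen m

/-- The left-hand side of the quantum Serre relation for a pair `x = e_i`, `y = e_j` (or `f_i`,
`f_j`) with Cartan integer `a = a_{ij} ∈ {0, -1, -2}`; `[2] = q + q⁻¹`, `[3] = q² + 1 + q⁻²`. -/
def serre (q : ℂ) (a : ℤ) {A : Type*} [Ring A] [Algebra ℂ A] (x y : A) : A :=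
  if a = 0 then x * y - y * x
  else if a = -1 then y * x * x - (q + q⁻¹) • (x * y * x) + x * x * y
  else if a = -2 then
    y * x * x * x - (q ^ 2 + 1 + q⁻¹ ^ 2) • (x * y * x * x)
      + (q ^ 2 + 1 + q⁻¹ ^ 2) • (x * x * y * x) - x * x * x * y
  else 0

/-- The defining relations of `U_q(ŝl_m)`.  The relation
`e_i f_j - f_j e_i = δ_{ij} (k_i^+ - k_i^-) / (q - q⁻¹)` is written with the invertible number
`q - q⁻¹` on the left. -/
inductive UqRel (q : ℂˣ) (m : ℕ) :
    FreeAlgebra ℂ (UqGen m) → FreeAlgebra ℂ (UqGen m) → Prop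
  | k_kInv (i : Fin m) :
      UqRel q m (FreeAlgebra.ι ℂ (.k i) * FreeAlgebra.ι ℂ (.kInv i)) 1
  | kInv_k (i : Fin m) :
      UqRel q m (FreeAlgebra.ι ℂ (.kInv i) * FreeAlgebra.ι ℂ (.k i)) 1
  | k_k (i j : Fin m) :
      UqRel q m (FreeAlgebra.ι ℂ (.k i) * FreeAlgebra.ι ℂ (.k j))
        (FreeAlgebra.ι ℂ (.k j) * FreeAlgebra.ι ℂ (.k i))
  | k_e (i j : Fin m) :
      UqRel q m (FreeAlgebra.ι ℂ (.k i) * FreeAlgebra.ι ℂ (.e j) * FreeAlgebra.ι ℂ (.kInv i))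
        ((q : ℂ) ^ (cartan m i j) • FreeAlgebra.ι ℂ (.e j))
  | k_f (i j : Fin m) :
      UqRel q m (FreeAlgebra.ι ℂ (.k i) * FreeAlgebra.ι ℂ (.f j) * FreeAlgebra.ι ℂ (.kInv i))
        ((q : ℂ) ^ (-cartan m i j) • FreeAlgebra.ι ℂ (.f j))
  | e_f (i j : Fin m) :
      UqRel q m
        (((q : ℂ) - (q : ℂ)⁻¹) • (FreeAlgebra.ι ℂ (.e i) * FreeAlgebra.ι ℂ (.f j)
          - FreeAlgebra.ι ℂ (.f j) * FreeAlgebra.ι ℂ (.e i)))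
        (if i = j then FreeAlgebra.ι ℂ (.k i) - FreeAlgebra.ι ℂ (.kInv i) else 0)
  | serre_e (i j : Fin m) (h : i ≠ j) :
      UqRel q m (serre q (cartan m i j) (FreeAlgebra.ι ℂ (.e i)) (FreeAlgebra.ι ℂ (.e j))) 0
  | serre_f (i j : Fin m) (h : i ≠ j) :
      UqRel q m (serre q (cartan m i j) (FreeAlgebra.ι ℂ (.f i)) (FreeAlgebra.ι ℂ (.f j))) 0

/-- The quantum affine algebra `U_q(ŝl_m)`. -/
def Uq (q : ℂˣ) (m : ℕ) : Type := RingQuot (UqRel q m)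

instance (q : ℂˣ) (m : ℕ) : Ring (Uq q m) := inferInstanceAs (Ring (RingQuot (UqRel q m)))

instance (q : ℂˣ) (m : ℕ) : Algebra ℂ (Uq q m) :=
  inferInstanceAs (Algebra ℂ (RingQuot (UqRel q m)))

/-- The image of a generator in `U_q(ŝl_m)`. -/
def Uq.gen (q : ℂˣ) (m : ℕ) (x : UqGen m) : Uq q m :=
  RingQuot.mkAlgHom ℂ (UqRel q m) (FreeAlgebra.ι ℂ x)

/-- A family of elements of an algebra indexed by the generators satisfies the defining relations
of `U_q(ŝl_m)`. -/
structure UqSystem (q : ℂˣ) (m : ℕ) {A : Type*} [Ring A] [Algebra ℂ A] (φ : UqGen m → A) :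
    Prop where
  k_kInv : ∀ i, φ (.k i) * φ (.kInv i) = 1
  kInv_k : ∀ i, φ (.kInv i) * φ (.k i) = 1
  k_k : ∀ i j, φ (.k i) * φ (.k j) = φ (.k j) * φ (.k i)
  k_e : ∀ i j, φ (.k i) * φ (.e j) = (q : ℂ) ^ (cartan m i j) • (φ (.e j) * φ (.k i))
  k_f : ∀ i j, φ (.k i) * φ (.f j) = (q : ℂ) ^ (-cartan m i j) • (φ (.f j) * φ (.k i))
  e_f : ∀ i j, ((q : ℂ) - (q : ℂ)⁻¹) • (φ (.e i) * φ (.f j) - φ (.f j) * φ (.e i))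
    = if i = j then φ (.k i) - φ (.kInv i) else 0
  serre_e : ∀ i j, i ≠ j → serre (q : ℂ) (cartan m i j) (φ (.e i)) (φ (.e j)) = 0
  serre_f : ∀ i j, i ≠ j → serre (q : ℂ) (cartan m i j) (φ (.f i)) (φ (.f j)) = 0

lemma map_serre {A B : Type*} [Ring A] [Algebra ℂ A] [Ring B] [Algebra ℂ B] (g : A →ₐ[ℂ] B)
    (q : ℂ) (a : ℤ) (x y : A) : g (serre q a x y) = serre q a (g x) (g y) := by
  unfold serre
  split_ifs <;> simp

lemma UqSystem.lift_rel {q : ℂˣ} {m : ℕ} {A : Type*} [Ring A] [Algebra ℂ A] {φ : UqGen m → A}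
    (h : UqSystem q m φ) ⦃x y : FreeAlgebra ℂ (UqGen m)⦄ (hxy : UqRel q m x y) :
    FreeAlgebra.lift ℂ φ x = FreeAlgebra.lift ℂ φ y := by
  induction hxy with
  | k_kInv i => simpa using h.k_kInv i
  | kInv_k i => simpa using h.kInv_k i
  | k_k i j => simpa using h.k_k i j
  | k_e i j =>
    simp only [map_mul, FreeAlgebra.lift_ι_apply, map_smul, h.k_e, smul_mul_assoc]
    rw [mul_assoc, h.k_kInv, mul_one]
  | k_f i j =>
    simp only [map_mul, FreeAlgebra.lift_ι_apply, map_smul, h.k_f, smul_mul_assoc]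
    rw [mul_assoc, h.k_kInv, mul_one]
  | e_f i j =>
    have := h.e_f i j
    split_ifs at this ⊢ <;> simpa using this
  | serre_e i j hij => simpa [map_serre] using h.serre_e i j hij
  | serre_f i j hij => simpa [map_serre] using h.serre_f i j hij

/-- The algebra homomorphism from `U_q(ŝl_m)` given by a family satisfying the relations. -/
def Uq.lift {q : ℂˣ} {m : ℕ} {A : Type*} [Ring A] [Algebra ℂ A] (φ : UqGen m → A)
    (h : UqSystem q m φ) : Uq q m →ₐ[ℂ] A :=
  RingQuot.liftAlgHom ℂ ⟨FreeAlgebra.lift ℂ φ, h.lift_rel⟩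

lemma Uq.lift_gen {q : ℂˣ} {m : ℕ} {A : Type*} [Ring A] [Algebra ℂ A] (φ : UqGen m → A)
    (h : UqSystem q m φ) (x : UqGen m) : Uq.lift φ h (Uq.gen q m x) = φ x :=
  (RingQuot.liftAlgHom_mkAlgHom_apply (S := ℂ) (FreeAlgebra.lift ℂ φ)
    (s := UqRel q m) h.lift_rel (FreeAlgebra.ι ℂ x)).trans (FreeAlgebra.lift_ι_apply _ _)

lemma UqSystem.map {q : ℂˣ} {m : ℕ} {A B : Type*} [Ring A] [Algebra ℂ A] [Ring B] [Algebra ℂ B]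
    {φ : UqGen m → A} (h : UqSystem q m φ) (g : A →ₐ[ℂ] B) : UqSystem q m (fun x => g (φ x)) := by
  refine ⟨fun i => ?_, fun i => ?_, fun i j => ?_, fun i j => ?_, fun i j => ?_,
    fun i j => ?_, fun i j hij => ?_, fun i j hij => ?_⟩
  · rw [← map_mul, h.k_kInv, map_one]
  · rw [← map_mul, h.kInv_k, map_one]
  · rw [← map_mul, h.k_k, map_mul]
  · rw [← map_mul, h.k_e, map_smul, map_mul]
  · rw [← map_mul, h.k_f, map_smul, map_mul]
  · rw [← map_mul, ← map_mul, ← map_sub, ← map_smul, h.e_f, apply_ite g, map_sub, map_zero]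
  · rw [← map_serre, h.serre_e i j hij, map_zero]
  · rw [← map_serre, h.serre_f i j hij, map_zero]

/-- An induction principle: an element commuting with the images of all generators commutes with
the image of `U_q(ŝl_m)`. -/
lemma Uq.commute_of_gen {q : ℂˣ} {m : ℕ} {A : Type*} [Ring A] [Algebra ℂ A]
    (g : Uq q m →ₐ[ℂ] A) (b : A) (h : ∀ x, Commute b (g (Uq.gen q m x))) (u : Uq q m) :
    Commute b (g u) := by
  obtain ⟨w, rfl⟩ := RingQuot.mkAlgHom_surjective ℂ (UqRel q m) u
  let G : FreeAlgebra ℂ (UqGen m) →ₐ[ℂ] A := AlgHom.comp g (RingQuot.mkAlgHom ℂ (UqRel q m))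
  change Commute b (G w)
  induction w using FreeAlgebra.induction with
  | grade0 r =>
    rw [AlgHom.commutes]
    exact (Algebra.commutes r b).symm
  | grade1 x => exact h x
  | mul x y hx hy => rw [map_mul]; exact hx.mul_right hy
  | add x y hx hy => rw [map_add]; exact hx.add_right hy

lemma cartan_symm (m : ℕ) (i j : Fin m) : cartan m i j = cartan m j i := by
  unfold cartan
  simp only [eq_comm (a := i) (b := j)]
  ring

lemma ne_finRotate {m : ℕ} {i j : Fin m} (h : i ≠ j) (l : Fin m) : l ≠ finRotate m l := by
  rcases m with _ | _ | m
  · exact i.elim0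
  · exact absurd (Subsingleton.elim (α := Fin 1) i j) h
  · intro h'
    rw [finRotate_apply] at h'
    have : (1 : Fin (m + 2)) = 0 := by simpa using h'.symm
    exact absurd this (by simp)

lemma cartan_self {m : ℕ} {i j : Fin m} (h : i ≠ j) : cartan m i i = 2 := by
  unfold cartan
  rw [if_neg (ne_finRotate h i), if_pos rfl]
  ring

lemma Uq.gen_system (q : ℂˣ) (m : ℕ) : UqSystem q m (Uq.gen q m) := by
  have key : ∀ x y, UqRel q m x y →
      RingQuot.mkAlgHom ℂ (UqRel q m) x = RingQuot.mkAlgHom ℂ (UqRel q m) y :=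
    fun x y h => RingQuot.mkAlgHom_rel ℂ h
  have h1 : ∀ i, Uq.gen q m (.kInv i) * Uq.gen q m (.k i) = 1 := fun i => by
    have := key _ _ (.kInv_k i)
    rw [map_mul, map_one] at this; exact this
  refine ⟨fun i => ?_, h1, fun i j => ?_, fun i j => ?_, fun i j => ?_,
    fun i j => ?_, fun i j h => ?_, fun i j h => ?_⟩
  · have := key _ _ (.k_kInv i)
    rw [map_mul, map_one] at this; exact this
  · have := key _ _ (.k_k i j)
    rw [map_mul, map_mul] at this; exact this
  · have := key _ _ (.k_e i j)
    rw [map_mul, map_mul, map_smul] at this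
    replace this : Uq.gen q m (.k i) * Uq.gen q m (.e j) * Uq.gen q m (.kInv i) =
      (q : ℂ) ^ (cartan m i j) • Uq.gen q m (.e j) := this
    rw [← smul_mul_assoc, ← this, mul_assoc _ _ (Uq.gen q m (.k i)), h1, mul_one]
  · have := key _ _ (.k_f i j)
    rw [map_mul, map_mul, map_smul] at this
    replace this : Uq.gen q m (.k i) * Uq.gen q m (.f j) * Uq.gen q m (.kInv i) =
      (q : ℂ) ^ (-cartan m i j) • Uq.gen q m (.f j) := this
    rw [← smul_mul_assoc, ← this, mul_assoc _ _ (Uq.gen q m (.k i)), h1, mul_one]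
  · have := key _ _ (.e_f i j)
    rw [map_smul, map_sub, map_mul, map_mul, apply_ite (RingQuot.mkAlgHom ℂ (UqRel q m)),
      map_sub, map_zero] at this
    exact this
  · have := key _ _ (.serre_e i j h)
    rw [map_serre, map_zero] at this; exact this
  · have := key _ _ (.serre_f i j h)
    rw [map_serre, map_zero] at this; exact this

lemma serre_add {A : Type*} [Ring A] [Algebra ℂ A] (q : ℂ) (hq : q ≠ 0) (a : ℤ) {x x' y y' : A}
    (h1 : x * x' = q ^ 2 • (x' * x)) (h2 : x * y' = q ^ a • (y' * x))
    (h3 : y * x' = q ^ a • (x' * y))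
    (hx : serre q a x y = 0) (hx' : serre q a x' y' = 0) : serre q a (x + x') (y + y') = 0 := by
  have r1 : ∀ z, x * (x' * z) = q ^ 2 • (x' * (x * z)) := fun z => by
    rw [← mul_assoc, h1, smul_mul_assoc, mul_assoc]
  have r2 : ∀ z, x * (y' * z) = q ^ a • (y' * (x * z)) := fun z => by
    rw [← mul_assoc, h2, smul_mul_assoc, mul_assoc]
  have r3 : ∀ z, y * (x' * z) = q ^ a • (x' * (y * z)) := fun z => by
    rw [← mul_assoc, h3, smul_mul_assoc, mul_assoc]
  unfold serre at *
  split_ifs at * with c0 c1 c2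
  · subst c0
    simp only [zpow_zero, one_smul] at h2 h3
    have : (x + x') * (y + y') - (y + y') * (x + x') =
      (x * y - y * x) + (x' * y' - y' * x') := by
      simp only [mul_add, add_mul, h2, h3]; abel
    rw [this, hx, hx', add_zero]
  · subst c1
    have : (y + y') * (x + x') * (x + x') - (q + q⁻¹) • ((x + x') * (y + y') * (x + x'))
        + (x + x') * (x + x') * (y + y') =
      (y * x * x - (q + q⁻¹) • (x * y * x) + x * x * y) +
      (y' * x' * x' - (q + q⁻¹) • (x' * y' * x') + x' * x' * y') := by
      simp only [mul_add, add_mul, mul_assoc, h1, h2, h3, r1, r2, r3, smul_smul, smul_add,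
        mul_smul_comm, smul_mul_assoc]
      match_scalars <;> simp <;> (try field_simp) <;> (try ring)
    rw [this, hx, hx', add_zero]
  · subst c2
    have : (y + y') * (x + x') * (x + x') * (x + x')
        - (q ^ 2 + 1 + q⁻¹ ^ 2) • ((x + x') * (y + y') * (x + x') * (x + x'))
        + (q ^ 2 + 1 + q⁻¹ ^ 2) • ((x + x') * (x + x') * (y + y') * (x + x'))
        - (x + x') * (x + x') * (x + x') * (y + y') =
      (y * x * x * x - (q ^ 2 + 1 + q⁻¹ ^ 2) • (x * y * x * x)
      + (q ^ 2 + 1 + q⁻¹ ^ 2) • (x * x * y * x) - x * x * x * y) +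
      (y' * x' * x' * x' - (q ^ 2 + 1 + q⁻¹ ^ 2) • (x' * y' * x' * x')
      + (q ^ 2 + 1 + q⁻¹ ^ 2) • (x' * x' * y' * x') - x' * x' * x' * y') := by
      simp only [mul_add, add_mul, mul_assoc, h1, h2, h3, r1, r2, r3, smul_smul, smul_add,
        mul_smul_comm, smul_mul_assoc]
      match_scalars <;> simp <;> (try field_simp) <;> (try ring)
    rw [this, hx, hx', add_zero]
  · rfl

lemma serre_mul {A : Type*} [Ring A] [Algebra ℂ A] (q : ℂ) (a : ℤ) {x y u v : A}
    (h1 : Commute u x) (h2 : Commute u y) (h3 : Commute v x)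
    (h5 : Commute u v) (h : serre q a x y = 0) : serre q a (x * u) (y * v) = 0 := by
  have r1 : ∀ z, u * (x * z) = x * (u * z) := fun z => by rw [← mul_assoc, h1.eq, mul_assoc]
  have r2 : ∀ z, u * (y * z) = y * (u * z) := fun z => by rw [← mul_assoc, h2.eq, mul_assoc]
  have r3 : ∀ z, v * (x * z) = x * (v * z) := fun z => by rw [← mul_assoc, h3.eq, mul_assoc]
  have r5 : ∀ z, v * (u * z) = u * (v * z) := fun z => by rw [← mul_assoc, ← h5.eq, mul_assoc]
  have r5' : v * u = u * v := h5.eq.symm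
  unfold serre at *
  split_ifs at * with c0 c1 c2
  · have : x * u * (y * v) - y * v * (x * u) = (x * y - y * x) * (u * v) := by
      simp only [sub_mul, mul_assoc, r1, r2, r3, r5, r5']
    rw [this, h, zero_mul]
  · rw [show y * v * (x * u) * (x * u) - (q + q⁻¹) • (x * u * (y * v) * (x * u)) +
      x * u * (x * u) * (y * v) = (y * x * x - (q + q⁻¹) • (x * y * x) + x * x * y) *
        (u * (u * v)) by
      simp only [sub_mul, add_mul, smul_mul_assoc, mul_assoc, r1, r2, r3, r5, r5'], h, zero_mul]
  · refine Eq.trans (b := (y * x * x * x - (q ^ 2 + 1 + q⁻¹ ^ 2) • (x * y * x * x)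
      + (q ^ 2 + 1 + q⁻¹ ^ 2) • (x * x * y * x) - x * x * x * y) * (u * (u * (u * v)))) ?_ ?_
    · simp only [sub_mul, add_mul, smul_mul_assoc, mul_assoc, r1, r2, r3, r5, r5']
    · rw [h, zero_mul]
  · rfl

/-- The coproduct formula on generators, for two commuting families `φ` (left tensor factor) and
`ψ` (right tensor factor):  `e_i ↦ e_i ⊗ k_i^+ + 1 ⊗ e_i`, `f_i ↦ f_i ⊗ 1 + k_i^- ⊗ f_i`,
`k_i^± ↦ k_i^± ⊗ k_i^±`. -/
def conv {m : ℕ} {A : Type*} [Ring A] (φ ψ : UqGen m → A) : UqGen m → A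
  | .e i => φ (.e i) * ψ (.k i) + ψ (.e i)
  | .f i => φ (.f i) + φ (.kInv i) * ψ (.f i)
  | .k i => φ (.k i) * ψ (.k i)
  | .kInv i => φ (.kInv i) * ψ (.kInv i)

lemma UqSystem.kInv_e {q : ℂˣ} {m : ℕ} {A : Type*} [Ring A] [Algebra ℂ A] {φ : UqGen m → A}
    (h : UqSystem q m φ) (i j : Fin m) :
    φ (.kInv i) * φ (.e j) = (q : ℂ) ^ (-cartan m i j) • (φ (.e j) * φ (.kInv i)) := by
  have h0 := h.k_e i j
  have : φ (.kInv i) * (φ (.k i) * φ (.e j)) * φ (.kInv i) =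
      (q : ℂ) ^ (cartan m i j) • (φ (.kInv i) * φ (.e j)) := by
    rw [h0, mul_smul_comm, smul_mul_assoc, mul_assoc, mul_assoc, h.k_kInv, mul_one]
  rw [← mul_assoc, h.kInv_k, one_mul] at this
  rw [this, smul_smul, ← zpow_add₀ q.ne_zero, neg_add_cancel, zpow_zero, one_smul]

lemma UqSystem.kInv_f {q : ℂˣ} {m : ℕ} {A : Type*} [Ring A] [Algebra ℂ A] {φ : UqGen m → A}
    (h : UqSystem q m φ) (i j : Fin m) :
    φ (.kInv i) * φ (.f j) = (q : ℂ) ^ (cartan m i j) • (φ (.f j) * φ (.kInv i)) := by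
  have h0 := h.k_f i j
  have : φ (.kInv i) * (φ (.k i) * φ (.f j)) * φ (.kInv i) =
      (q : ℂ) ^ (-cartan m i j) • (φ (.kInv i) * φ (.f j)) := by
    rw [h0, mul_smul_comm, smul_mul_assoc, mul_assoc, mul_assoc, h.k_kInv, mul_one]
  rw [← mul_assoc, h.kInv_k, one_mul] at this
  rw [this, smul_smul, ← zpow_add₀ q.ne_zero, add_neg_cancel, zpow_zero, one_smul]

lemma UqSystem.kInv_kInv {q : ℂˣ} {m : ℕ} {A : Type*} [Ring A] [Algebra ℂ A] {φ : UqGen m → A}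
    (h : UqSystem q m φ) (i j : Fin m) : Commute (φ (.kInv i)) (φ (.kInv j)) := by
  let u : Fin m → Aˣ := fun i => ⟨φ (.k i), φ (.kInv i), h.k_kInv i, h.kInv_k i⟩
  have hu : Commute (u i) (u j) := Units.ext (h.k_k i j)
  exact congrArg Units.val (hu.inv_inv).eq

lemma UqSystem.conv {q : ℂˣ} {m : ℕ} {A : Type*} [Ring A] [Algebra ℂ A] {φ ψ : UqGen m → A}
    (hφ : UqSystem q m φ) (hψ : UqSystem q m ψ) (hc : ∀ x y, Commute (φ x) (ψ y)) :
    UqSystem q m (SchurWeyl.conv φ ψ) := by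
  have c : ∀ x y, ψ y * φ x = φ x * ψ y := fun x y => (hc x y).eq.symm
  have c' : ∀ x y z, ψ y * (φ x * z) = φ x * (ψ y * z) := fun x y z => by
    rw [← mul_assoc, c, mul_assoc]
  have q0 := q.ne_zero
  refine ⟨fun i => ?_, fun i => ?_, fun i j => ?_, fun i j => ?_, fun i j => ?_,
    fun i j => ?_, fun i j h => ?_, fun i j h => ?_⟩
  · simp only [SchurWeyl.conv, mul_assoc, c', hψ.k_kInv, mul_one, hφ.k_kInv]
  · simp only [SchurWeyl.conv, mul_assoc, c', hψ.kInv_k, mul_one, hφ.kInv_k]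
  · simp only [SchurWeyl.conv, mul_assoc, c']
    rw [hψ.k_k i j, ← mul_assoc, hφ.k_k i j, mul_assoc]
  · simp only [SchurWeyl.conv, mul_assoc, c', mul_add, add_mul, c, smul_add]
    congr 1
    · rw [hψ.k_k i j, ← mul_assoc, hφ.k_e i j, smul_mul_assoc, mul_assoc]
    · rw [hψ.k_e i j, mul_smul_comm]
  · simp only [SchurWeyl.conv, mul_assoc, c', mul_add, add_mul, c, smul_add]
    congr 1
    · rw [← mul_assoc, hφ.k_f i j, smul_mul_assoc, mul_assoc]
    · have : φ (.k i) * φ (.kInv j) = φ (.kInv j) * φ (.k i) := by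
        let u : Fin m → Aˣ := fun i => ⟨φ (.k i), φ (.kInv i), hφ.k_kInv i, hφ.kInv_k i⟩
        have hu : Commute (u i) (u j) := Units.ext (hφ.k_k i j)
        exact congrArg Units.val (hu.inv_right).eq
      rw [hψ.k_f i j, mul_smul_comm, mul_smul_comm, ← mul_assoc, this, mul_assoc]
  · have e1 : SchurWeyl.conv φ ψ (.e i) * SchurWeyl.conv φ ψ (.f j)
        - SchurWeyl.conv φ ψ (.f j) * SchurWeyl.conv φ ψ (.e i) =
        (φ (.e i) * φ (.f j) - φ (.f j) * φ (.e i)) * ψ (.k i)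
        + φ (.kInv j) * (ψ (.e i) * ψ (.f j) - ψ (.f j) * ψ (.e i)) := by
      have h2 : φ (.e i) * (φ (.kInv j) * (ψ (.k i) * ψ (.f j)))
          = φ (.kInv j) * (φ (.e i) * (ψ (.f j) * ψ (.k i))) := by
        rw [hψ.k_f, ← mul_assoc (φ (.kInv j)), hφ.kInv_e, cartan_symm m j i]
        simp only [mul_smul_comm, smul_mul_assoc, mul_assoc]
      simp only [SchurWeyl.conv, mul_assoc, c', mul_add, add_mul, c, mul_sub, sub_mul, h2]
      abel
    rw [e1, smul_add, ← smul_mul_assoc, ← mul_smul_comm, hφ.e_f, hψ.e_f]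
    split_ifs with hij
    · subst hij
      simp only [SchurWeyl.conv, sub_mul, mul_sub]
      abel
    · simp
  · have h2 := cartan_self h
    refine serre_add (q : ℂ) q0 _ ?_ ?_ ?_ (serre_mul _ _ (hc _ _).symm (hc _ _).symm
      (hc _ _).symm (hψ.k_k i j) (hφ.serre_e i j h)) (hψ.serre_e i j h)
    · rw [mul_assoc, hψ.k_e, h2, c', mul_smul_comm]; norm_cast
    · rw [mul_assoc, hψ.k_e, c', mul_smul_comm]
    · rw [mul_assoc, hψ.k_e, c', mul_smul_comm, cartan_symm]
  · have h2 := cartan_self h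
    simp only [SchurWeyl.conv]
    rw [add_comm, add_comm (φ (.f j)), (hc (.kInv i) (.f i)).eq, (hc (.kInv j) (.f j)).eq]
    refine serre_add (q : ℂ) q0 _ ?_ ?_ ?_ (serre_mul _ _ (hc _ _) (hc _ _)
      (hc _ _) (hφ.kInv_kInv i j) (hψ.serre_f i j h)) (hφ.serre_f i j h)
    · rw [mul_assoc, hφ.kInv_f, h2, mul_smul_comm, c', c]; norm_cast
    · rw [mul_assoc, hφ.kInv_f, mul_smul_comm, c', c]
    · rw [mul_assoc, hφ.kInv_f, mul_smul_comm, c', c, cartan_symm]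

lemma Uq.comul_system (q : ℂˣ) (m : ℕ) : UqSystem q m (A := Uq q m ⊗[ℂ] Uq q m)
    (SchurWeyl.conv (fun x => Uq.gen q m x ⊗ₜ[ℂ] 1) (fun x => 1 ⊗ₜ[ℂ] Uq.gen q m x)) := by
  have h := Uq.gen_system q m
  refine (h.map (Algebra.TensorProduct.includeLeft (R := ℂ) (S := ℂ) (B := Uq q m))).conv
    (h.map (Algebra.TensorProduct.includeRight (R := ℂ) (A := Uq q m))) fun x y => ?_
  simp [Commute, SemiconjBy]

/-- The Drinfeld–Jimbo coproduct `Δ : U_q(ŝl_m) → U_q(ŝl_m) ⊗ U_q(ŝl_m)`. -/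
def Uq.comul (q : ℂˣ) (m : ℕ) : Uq q m →ₐ[ℂ] Uq q m ⊗[ℂ] Uq q m :=
  Uq.lift _ (Uq.comul_system q m)

lemma Uq.comul_gen (q : ℂˣ) (m : ℕ) (x : UqGen m) : Uq.comul q m (Uq.gen q m x) =
    conv (fun x => Uq.gen q m x ⊗ₜ[ℂ] 1) (fun x => 1 ⊗ₜ[ℂ] Uq.gen q m x) x :=
  Uq.lift_gen _ _ x

/-- The counit: `e_i, f_i ↦ 0`, `k_i^± ↦ 1`. -/
def Uq.counit (q : ℂˣ) (m : ℕ) : Uq q m →ₐ[ℂ] ℂ :=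
  Uq.lift (fun x => match x with
    | .e _ => 0
    | .f _ => 0
    | .k _ => 1
    | .kInv _ => 1) (by
    constructor <;> simp [serre])


/-! ### The affinization `V̂ = V ⊗ ℂ[x, x⁻¹]` and its tensor powers -/

/-- `V̂ = V ⊗ ℂ[x, x⁻¹]`, with its basis `v_j ⊗ x^k` indexed by the pairs `(j, k)`.  The vectors
`v_1, …, v_m` are numbered here by `0, …, m-1 : Fin m`. -/
abbrev Vhat (m : ℕ) : Type := Fin m × ℤ →₀ ℂ

/-- The basis vector `v_j ⊗ x^k` of `V̂`. -/
abbrev bv {m : ℕ} (p : Fin m × ℤ) : Vhat m := Finsupp.single p 1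

/-- The cyclic predecessor `i ↦ i - 1 (mod m)`. -/
def cpred {m : ℕ} (i : Fin m) : Fin m := (finRotate m).symm i

/-- `δ_{i,0}`. -/
def deltaZero {m : ℕ} (i : Fin m) : ℤ := if i.val = 0 then 1 else 0

/-- The exponent `δ_{j,i} - δ_{j,i+1}` (1-based cyclic indices of the `v_j`). -/
def wt {m : ℕ} (i j : Fin m) : ℤ := (if j = cpred i then 1 else 0) - (if j = i then 1 else 0)

/-- The action of the generators on `V̂`.  With 1-based cyclic numbering of the `v_j`, the operator
`e_i` is `v_{i+1} ⊗ x^k ↦ v_i ⊗ x^{k + δ_{i,0}}`, `f_i` is `v_i ⊗ x^k ↦ v_{i+1} ⊗ x^{k - δ_{i,0}}`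
and `k_i^±` is `v_j ⊗ x^k ↦ q^{±(δ_{j,i} - δ_{j,i+1})} v_j ⊗ x^k`, where `v_0 = v_m`. In the
0-based numbering of `Fin m` the vectors `v_i, v_{i+1}` have the numbers `cpred i`, `i`. -/
def vOp (q : ℂˣ) (m : ℕ) : UqGen m → Module.End ℂ (Vhat m)
  | .e i => Finsupp.linearCombination ℂ fun p =>
      if p.1 = i then bv (cpred i, p.2 + deltaZero i) else 0
  | .f i => Finsupp.linearCombination ℂ fun p =>
      if p.1 = cpred i then bv (i, p.2 - deltaZero i) else 0
  | .k i => Finsupp.linearCombination ℂ fun p => (q : ℂ) ^ (wt i p.1) • bv p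
  | .kInv i => Finsupp.linearCombination ℂ fun p => (q : ℂ) ^ (-wt i p.1) • bv p

section vOpLemmas
variable (q : ℂˣ) {m : ℕ} (i : Fin m) (p : Fin m × ℤ)

lemma vOp_e : vOp q m (.e i) (bv p) = if p.1 = i then bv (cpred i, p.2 + deltaZero i) else 0 := by
  simp [vOp, Finsupp.linearCombination_single]

lemma vOp_f : vOp q m (.f i) (bv p) =
    if p.1 = cpred i then bv (i, p.2 - deltaZero i) else 0 := by
  simp [vOp, Finsupp.linearCombination_single]

lemma vOp_k : vOp q m (.k i) (bv p) = (q : ℂ) ^ (wt i p.1) • bv p := by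
  rw [vOp, Finsupp.linearCombination_single, one_smul]

lemma vOp_kInv : vOp q m (.kInv i) (bv p) = (q : ℂ) ^ (-wt i p.1) • bv p := by
  rw [vOp, Finsupp.linearCombination_single, one_smul]

end vOpLemmas

lemma vhat_ext {m : ℕ} {M : Type*} [AddCommGroup M] [Module ℂ M] {f g : Vhat m →ₗ[ℂ] M}
    (h : ∀ p, f (bv p) = g (bv p)) : f = g :=
  (Finsupp.basisSingleOne (R := ℂ) (ι := Fin m × ℤ)).ext (by simpa using h)

lemma cpred_eq_iff {m : ℕ} (i j : Fin m) : cpred i = j ↔ i = finRotate m j := by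
  unfold cpred
  rw [Equiv.symm_apply_eq]

lemma cpred_inj {m : ℕ} {i j : Fin m} : cpred i = cpred j ↔ i = j := by
  unfold cpred
  exact (finRotate m).symm.injective.eq_iff

lemma wt_cpred {m : ℕ} (i j : Fin m) : wt i (cpred j) = cartan m i j + wt i j := by
  unfold wt cartan
  have h1 : cpred j = cpred i ↔ i = j := cpred_inj.trans eq_comm
  have h2 : cpred j = i ↔ j = finRotate m i := cpred_eq_iff j i
  have h3 : j = cpred i ↔ i = finRotate m j := eq_comm.trans (cpred_eq_iff i j)
  have h4 : j = i ↔ i = j := eq_comm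
  simp only [h1, h2, h3, h4]
  ring

lemma vOp_sq {q : ℂˣ} {m : ℕ} {i j : Fin m} (h : i ≠ j) :
    vOp q m (.e i) * vOp q m (.e i) = 0 ∧ vOp q m (.f i) * vOp q m (.f i) = 0 := by
  have hi : cpred i ≠ i := fun h' => ne_finRotate h i ((cpred_eq_iff _ _).1 h')
  constructor <;> refine vhat_ext fun p => ?_
  · simp only [Module.End.mul_apply, vOp_e]
    split_ifs <;> simp [vOp_e, hi]
  · simp only [Module.End.mul_apply, vOp_f]
    split_ifs <;> simp [vOp_f, hi.symm]

lemma cpred_cpred_of {m : ℕ} {i j : Fin m} (h : i ≠ j) (hc : cartan m i j = -1) :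
    ¬ (cpred i = j ∧ cpred j = i) := by
  rintro ⟨h1, h2⟩
  rw [cpred_eq_iff] at h1 h2
  unfold cartan at hc
  rw [if_neg h, if_pos h2, if_pos h1] at hc
  omega

lemma cpred_of_cartan_zero {m : ℕ} {i j : Fin m} (h : i ≠ j) (hc : cartan m i j = 0) :
    cpred i ≠ j ∧ cpred j ≠ i := by
  rw [Ne, Ne, cpred_eq_iff, cpred_eq_iff]
  unfold cartan at hc
  rw [if_neg h] at hc
  split_ifs at hc <;> omega

lemma serre_of_sq {A : Type*} [Ring A] [Algebra ℂ A] (q : ℂ) (a : ℤ) {x y : A}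
    (h2 : x * x = 0) (h1 : a = -1 → x * y * x = 0) (h0 : a = 0 → x * y = y * x) :
    serre q a x y = 0 := by
  unfold serre
  split_ifs with c0 c1 c2
  · rw [h0 c0, sub_self]
  · rw [mul_assoc, h2, h1 c1]; simp
  · rw [mul_assoc (y * x) x x, mul_assoc (x * y) x x, h2]; simp
  · rfl

lemma vOp_system (q : ℂˣ) (m : ℕ) : UqSystem q m (vOp q m) := by
  have q0 := q.ne_zero
  refine ⟨fun i => ?_, fun i => ?_, fun i j => ?_, fun i j => ?_, fun i j => ?_,
    fun i j => ?_, fun i j h => ?_, fun i j h => ?_⟩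
  · refine vhat_ext fun p => ?_
    rw [Module.End.mul_apply, vOp_kInv, map_smul, vOp_k, smul_smul, ← zpow_add₀ q0]
    simp
  · refine vhat_ext fun p => ?_
    rw [Module.End.mul_apply, vOp_k, map_smul, vOp_kInv, smul_smul, ← zpow_add₀ q0]
    simp
  · refine vhat_ext fun p => ?_
    simp only [Module.End.mul_apply, vOp_k, map_smul]
    rw [smul_comm]
  · refine vhat_ext fun p => ?_
    simp only [Module.End.mul_apply, vOp_k, vOp_e, map_smul, LinearMap.smul_apply]
    split_ifs with h
    · rw [vOp_k, smul_smul, ← zpow_add₀ q0, h]; simp only [wt_cpred]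
    · simp
  · refine vhat_ext fun p => ?_
    simp only [Module.End.mul_apply, vOp_k, vOp_f, map_smul, LinearMap.smul_apply]
    split_ifs with h
    · rw [vOp_k, smul_smul, ← zpow_add₀ q0, h, wt_cpred]; simp
    · simp
  · refine vhat_ext fun p => ?_
    simp only [Module.End.mul_apply, LinearMap.sub_apply, vOp_e, vOp_f, LinearMap.smul_apply]
    rw [apply_ite (vOp q m (.e i)), apply_ite (vOp q m (.f j)), vOp_e, vOp_f, map_zero, map_zero]
    dsimp only
    by_cases hij : i = j
    · subst hij
      simp only [if_true, LinearMap.sub_apply, vOp_k, vOp_kInv, add_sub_cancel_right,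
        sub_add_cancel, wt]
      obtain ⟨a, k⟩ := p
      dsimp only
      by_cases h1 : a = cpred i <;> by_cases h2 : a = i
      · rw [if_pos h1, if_pos h2, if_pos h1, if_pos h2, ← h1, ← h2]; simp
      · rw [if_pos h1, if_neg h2, if_pos h1, if_neg h2, ← h1]; simp [sub_smul]
      · rw [if_neg h1, if_pos h2, if_neg h1, if_pos h2, ← h2]; simp [sub_smul]
      · rw [if_neg h1, if_neg h2, if_neg h1, if_neg h2]; simp
    · simp [hij, Ne.symm hij, cpred_inj]
  · refine serre_of_sq _ _ (vOp_sq h).1 (fun ha => vhat_ext fun p => ?_)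
      (fun ha => vhat_ext fun p => ?_)
    · have := cpred_cpred_of h ha
      simp only [Module.End.mul_apply, vOp_e]
      split_ifs with h1
      · rw [vOp_e]
        split_ifs with h2
        · rw [vOp_e, if_neg (by intro h3; exact this ⟨h2, h3⟩)]; rfl
        · simp
      · simp
    · obtain ⟨h1, h2⟩ := cpred_of_cartan_zero h ha
      simp only [Module.End.mul_apply, vOp_e]
      split_ifs <;> simp [vOp_e, h1, h2]
  · refine serre_of_sq _ _ (vOp_sq h).2 (fun ha => vhat_ext fun p => ?_)
      (fun ha => vhat_ext fun p => ?_)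
    · have := cpred_cpred_of h ha
      simp only [Module.End.mul_apply, vOp_f]
      split_ifs with h1
      · rw [vOp_f]
        split_ifs with h2
        · rw [vOp_f, if_neg (by intro h3; exact this ⟨h3.symm, h2.symm⟩)]; rfl
        · simp
      · simp
    · obtain ⟨h1, h2⟩ := cpred_of_cartan_zero h ha
      simp only [Module.End.mul_apply, vOp_f]
      split_ifs <;> simp [vOp_f, h1.symm, h2.symm]

/-- `V̂` as a representation of `U_q(ŝl_m)`. -/
def vRep (q : ℂˣ) (m : ℕ) : Uq q m →ₐ[ℂ] Module.End ℂ (Vhat m) := Uq.lift _ (vOp_system q m)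

/-- The tensor space `V̂^{⊗n}`. -/
def TensV (n m : ℕ) : Type := PiTensorProduct ℂ fun _ : Fin n => Vhat m

instance (n m : ℕ) : AddCommGroup (TensV n m) :=
  Module.addCommMonoidToAddCommGroup ℂ (M := PiTensorProduct ℂ fun _ : Fin n => Vhat m)

instance (n m : ℕ) : Module ℂ (TensV n m) :=
  inferInstanceAs (Module ℂ (PiTensorProduct ℂ fun _ : Fin n => Vhat m))

/-- The canonical multilinear map into `V̂^{⊗n}`. -/
def tpure (n m : ℕ) : MultilinearMap ℂ (fun _ : Fin n => Vhat m) (TensV n m) :=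
  PiTensorProduct.tprod ℂ

/-- The basis vector `⊗_a (v_{j_a} ⊗ x^{k_a})` of `V̂^{⊗n}`, where `w a = (j_a, k_a)`. -/
def tv {n m : ℕ} (w : Fin n → Fin m × ℤ) : TensV n m := tpure n m fun a => bv (w a)

/-- The basis of `V̂^{⊗n}` formed by the vectors `tv w`. -/
def tBasis (n m : ℕ) : Module.Basis (Fin n → Fin m × ℤ) ℂ (TensV n m) :=
  Basis.piTensorProduct fun _ : Fin n => Finsupp.basisSingleOne (R := ℂ) (ι := Fin m × ℤ)

lemma tBasis_apply {n m : ℕ} (w : Fin n → Fin m × ℤ) : tBasis n m w = tv w := by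
  refine (Basis.piTensorProduct_apply
    (fun _ : Fin n => Finsupp.basisSingleOne (R := ℂ) (ι := Fin m × ℤ)) w).trans ?_
  simp only [Finsupp.coe_basisSingleOne]
  rfl

lemma tens_ext {n m : ℕ} {M : Type*} [AddCommGroup M] [Module ℂ M] {f g : TensV n m →ₗ[ℂ] M}
    (h : ∀ w, f (tv w) = g (tv w)) : f = g :=
  (tBasis n m).ext fun w => by simpa [tBasis_apply] using h w

/-- The operator `φ_1 ⊗ ⋯ ⊗ φ_n` of `V̂^{⊗n}`. -/
def tmap {n m : ℕ} (φ : Fin n → Module.End ℂ (Vhat m)) : Module.End ℂ (TensV n m) :=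
  PiTensorProduct.map φ

lemma tmap_tpure {n m : ℕ} (φ : Fin n → Module.End ℂ (Vhat m)) (x : Fin n → Vhat m) :
    tmap φ (tpure n m x) = tpure n m fun a => φ a (x a) :=
  PiTensorProduct.map_tprod φ x

lemma tmap_tv {n m : ℕ} (φ : Fin n → Module.End ℂ (Vhat m)) (w : Fin n → Fin m × ℤ) :
    tmap φ (tv w) = tpure n m fun a => φ a (bv (w a)) := tmap_tpure φ _

lemma tmap_one {n m : ℕ} : tmap (fun _ : Fin n => (1 : Module.End ℂ (Vhat m))) = 1 :=
  tens_ext fun w => tmap_tv _ w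

lemma tmap_mul {n m : ℕ} (φ ψ : Fin n → Module.End ℂ (Vhat m)) :
    tmap (fun a => φ a * ψ a) = tmap φ * tmap ψ :=
  tens_ext fun w => by
    rw [tmap_tv, Module.End.mul_apply, tmap_tv, tmap_tpure]
    rfl

lemma tmap_update_tv {n m : ℕ} (a : Fin n) (φ : Module.End ℂ (Vhat m))
    (w : Fin n → Fin m × ℤ) : tmap (Function.update (fun _ => 1) a φ) (tv w) =
      tpure n m (Function.update (fun b => (bv (w b) : Vhat m)) a (φ (bv (w a)))) := by
  rw [tmap_tv]
  congr 1
  funext b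
  by_cases hb : b = a
  · subst hb; simp
  · simp [hb]

/-- The operator `id ⊗ ⋯ ⊗ φ ⊗ ⋯ ⊗ id` of `V̂^{⊗n}` with `φ` at the `a`-th tensor factor. -/
def site {n m : ℕ} (a : Fin n) : Module.End ℂ (Vhat m) →ₐ[ℂ] Module.End ℂ (TensV n m) :=
  AlgHom.ofLinearMap
    { toFun := fun φ => tmap (Function.update (fun _ => 1) a φ)
      map_add' := fun φ ψ => tens_ext fun w => by
        simp only [LinearMap.add_apply, tmap_update_tv, MultilinearMap.map_update_add]
      map_smul' := fun c φ => tens_ext fun w => by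
        simp only [LinearMap.smul_apply, tmap_update_tv, MultilinearMap.map_update_smul,
          RingHom.id_apply] }
    (by
      change tmap (Function.update (fun _ => (1 : Module.End ℂ (Vhat m))) a 1) = 1
      rw [show Function.update (fun _ => (1 : Module.End ℂ (Vhat m))) a 1 = fun _ => 1 from
        Function.update_eq_self a _]
      exact tmap_one)
    (fun φ ψ => by
      change tmap _ = tmap _ * tmap _
      rw [← tmap_mul]
      congr 1
      funext b
      by_cases hb : b = a
      · subst hb; simp
      · simp [hb])

lemma site_comm {n m : ℕ} {a b : Fin n} (h : a ≠ b) (φ ψ : Module.End ℂ (Vhat m)) :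
    Commute (site a φ) (site b ψ) := by
  change tmap _ * tmap _ = tmap _ * tmap _
  simp only [← tmap_mul]
  congr 1
  funext c
  by_cases h1 : c = a
  · subst h1; simp [h]
  · simp [h1]

/-- Placing a vector of `V̂` at the `a`-th factor of a basis vector. -/
def put {n m : ℕ} (w : Fin n → Fin m × ℤ) (a : Fin n) : Vhat m →ₗ[ℂ] TensV n m :=
  (tpure n m).toLinearMap (fun b => (bv (w b) : Vhat m)) a

lemma site_tv {n m : ℕ} (a : Fin n) (φ : Module.End ℂ (Vhat m)) (w : Fin n → Fin m × ℤ) :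
    site a φ (tv w) = put w a (φ (bv (w a))) := tmap_update_tv a φ w

lemma put_bv {n m : ℕ} (w : Fin n → Fin m × ℤ) (a : Fin n) (p : Fin m × ℤ) :
    put w a (bv p) = tv (Function.update w a p) := by
  change tpure n m _ = tpure n m _
  congr 1
  funext b
  by_cases hb : b = a
  · subst hb; simp
  · simp [hb]

/-- If two representations `φ`, `ψ` on the same space commute, `(φ ⊗ ψ) ∘ Δ`. -/
def Uq.convHom {q : ℂˣ} {m : ℕ} {A : Type*} [Ring A] [Algebra ℂ A] (φ ψ : Uq q m →ₐ[ℂ] A)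
    (h : ∀ x y, Commute (φ x) (ψ y)) : Uq q m →ₐ[ℂ] A :=
  (Algebra.TensorProduct.lift φ ψ h).comp (Uq.comul q m)

lemma Uq.convHom_gen {q : ℂˣ} {m : ℕ} {A : Type*} [Ring A] [Algebra ℂ A] (φ ψ : Uq q m →ₐ[ℂ] A)
    (h : ∀ x y, Commute (φ x) (ψ y)) (x : UqGen m) :
    Uq.convHom φ ψ h (Uq.gen q m x) =
      conv (fun x => φ (Uq.gen q m x)) (fun x => ψ (Uq.gen q m x)) x := by
  change Algebra.TensorProduct.lift φ ψ h (Uq.comul q m (Uq.gen q m x)) = _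
  rw [Uq.comul_gen]
  cases x <;> simp [conv]

lemma Uq.convHom_commute {q : ℂˣ} {m : ℕ} {A : Type*} [Ring A] [Algebra ℂ A]
    (φ ψ : Uq q m →ₐ[ℂ] A) (h : ∀ x y, Commute (φ x) (ψ y)) (b : A)
    (h1 : ∀ x, Commute b (φ x)) (h2 : ∀ x, Commute b (ψ x)) (u : Uq q m) :
    Commute b (Uq.convHom φ ψ h u) := by
  refine Uq.commute_of_gen _ b (fun x => ?_) u
  rw [Uq.convHom_gen]
  cases x <;> simp only [conv]
  · exact ((h1 _).mul_right (h2 _)).add_right (h2 _)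
  · exact (h1 _).add_right ((h1 _).mul_right (h2 _))
  · exact (h1 _).mul_right (h2 _)
  · exact (h1 _).mul_right (h2 _)

/-- `U_q(ŝl_m)` acting on the `a`-th factor of `V̂^{⊗n}`. -/
def siteRep (q : ℂˣ) {n : ℕ} (m : ℕ) (a : Fin n) : Uq q m →ₐ[ℂ] Module.End ℂ (TensV n m) :=
  (site a).comp (vRep q m)

/-- The trivial representation on `V̂^{⊗n}`. -/
def trivRep (q : ℂˣ) (n m : ℕ) : Uq q m →ₐ[ℂ] Module.End ℂ (TensV n m) :=
  (Algebra.ofId ℂ (Module.End ℂ (TensV n m))).comp (Uq.counit q m)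

lemma trivRep_commute (q : ℂˣ) (n m : ℕ) (u : Uq q m) (b : Module.End ℂ (TensV n m)) :
    Commute b (trivRep q n m u) :=
  (Algebra.commutes (A := Module.End ℂ (TensV n m)) (Uq.counit q m u) b).symm

lemma siteRep_commute (q : ℂˣ) {n m : ℕ} {a b : Fin n} (h : a ≠ b) (u : Uq q m)
    (ψ : Module.End ℂ (Vhat m)) : Commute (site b ψ) (siteRep q m a u) :=
  site_comm h.symm ψ (vRep q m u)

/-- The action of `U_q(ŝl_m)` on the first `p` factors of `V̂^{⊗n}` by the iterated coproduct
(the trivial representation for `p = 0`), together with the fact that it commutes with operators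
on the other factors. -/
def tensRepAux (q : ℂˣ) (n m : ℕ) : (p : ℕ) →
    {φ : Uq q m →ₐ[ℂ] Module.End ℂ (TensV n m) //
      ∀ (u : Uq q m) (a : Fin n) (ψ : Module.End ℂ (Vhat m)), p ≤ a.val →
        Commute (site a ψ) (φ u)}
  | 0 => ⟨trivRep q n m, fun u a ψ _ => trivRep_commute q n m u (site a ψ)⟩
  | p + 1 =>
    if hp : p < n then
      ⟨Uq.convHom (tensRepAux q n m p).1 (siteRep q m ⟨p, hp⟩)
        (fun x y => ((tensRepAux q n m p).2 x ⟨p, hp⟩ (vRep q m y) le_rfl).symm), by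
        intro u a ψ ha
        refine Uq.convHom_commute _ _ _ _
          (fun x => (tensRepAux q n m p).2 x a ψ (Nat.le_of_succ_le ha))
          (fun x => siteRep_commute q ?_ x ψ) u
        rintro rfl
        exact absurd ha (Nat.not_succ_le_self p)⟩
    else ⟨(tensRepAux q n m p).1, fun u a ψ ha =>
      (tensRepAux q n m p).2 u a ψ (Nat.le_of_succ_le ha)⟩

/-- The action of `U_q(ŝl_m)` on `V̂^{⊗n}` through the iterated coproduct. -/
def tensRep (q : ℂˣ) (n m : ℕ) : Uq q m →ₐ[ℂ] Module.End ℂ (TensV n m) := (tensRepAux q n m n).1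

/-! ### Ariki–Koike algebras and affine Hecke algebras -/

/-- `∏_{0 ≤ l < k} (X - Q_l)`. -/
def cycPoly {r : ℕ} (Q : Fin r → ℂˣ) (k : ℕ) : Polynomial ℂ :=
  ∏ l : Fin r with l.val < k, (Polynomial.X - Polynomial.C (Q l : ℂ))

/-- The defining relations of the Ariki–Koike algebra; the generators `T_0, …, T_{n-1}` are indexed
by `Fin n`. -/
inductive AKRel (n r : ℕ) (q : ℂˣ) (Q : Fin r → ℂˣ) :
    FreeAlgebra ℂ (Fin n) → FreeAlgebra ℂ (Fin n) → Prop
  | cyc (h : 0 < n) :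
      AKRel n r q Q (Polynomial.aeval (FreeAlgebra.ι ℂ (⟨0, h⟩ : Fin n)) (cycPoly Q r)) 0
  | quad (i : Fin n) (hi : 0 < i.val) :
      AKRel n r q Q ((FreeAlgebra.ι ℂ i - algebraMap ℂ _ (q : ℂ)) *
        (FreeAlgebra.ι ℂ i + algebraMap ℂ _ (q : ℂ)⁻¹)) 0
  | braid_zero (h : 1 < n) :
      AKRel n r q Q
        (FreeAlgebra.ι ℂ (⟨0, by omega⟩ : Fin n) * FreeAlgebra.ι ℂ (⟨1, h⟩ : Fin n) *
          FreeAlgebra.ι ℂ (⟨0, by omega⟩ : Fin n) * FreeAlgebra.ι ℂ (⟨1, h⟩ : Fin n))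
        (FreeAlgebra.ι ℂ (⟨1, h⟩ : Fin n) * FreeAlgebra.ι ℂ (⟨0, by omega⟩ : Fin n) *
          FreeAlgebra.ι ℂ (⟨1, h⟩ : Fin n) * FreeAlgebra.ι ℂ (⟨0, by omega⟩ : Fin n))
  | braid (i j : Fin n) (hi : 0 < i.val) (hij : j.val = i.val + 1) :
      AKRel n r q Q (FreeAlgebra.ι ℂ i * FreeAlgebra.ι ℂ j * FreeAlgebra.ι ℂ i)
        (FreeAlgebra.ι ℂ j * FreeAlgebra.ι ℂ i * FreeAlgebra.ι ℂ j)
  | far (i j : Fin n) (hij : i.val + 1 < j.val) :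
      AKRel n r q Q (FreeAlgebra.ι ℂ i * FreeAlgebra.ι ℂ j)
        (FreeAlgebra.ι ℂ j * FreeAlgebra.ι ℂ i)

/-- The Ariki–Koike algebra `H_{n,r}(q, Q_0, …, Q_{r-1})` over `ℂ`. -/
def AK (n r : ℕ) (q : ℂˣ) (Q : Fin r → ℂˣ) : Type := RingQuot (AKRel n r q Q)

instance (n r : ℕ) (q : ℂˣ) (Q : Fin r → ℂˣ) : Ring (AK n r q Q) :=
  inferInstanceAs (Ring (RingQuot (AKRel n r q Q)))

instance (n r : ℕ) (q : ℂˣ) (Q : Fin r → ℂˣ) : Algebra ℂ (AK n r q Q) :=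
  inferInstanceAs (Algebra ℂ (RingQuot (AKRel n r q Q)))

/-- The projection from the free algebra. -/
def AK.mk (n r : ℕ) (q : ℂˣ) (Q : Fin r → ℂˣ) : FreeAlgebra ℂ (Fin n) →ₐ[ℂ] AK n r q Q :=
  RingQuot.mkAlgHom ℂ (AKRel n r q Q)

lemma AK.mk_rel {n r : ℕ} {q : ℂˣ} {Q : Fin r → ℂˣ} {x y : FreeAlgebra ℂ (Fin n)}
    (h : AKRel n r q Q x y) : AK.mk n r q Q x = AK.mk n r q Q y :=
  RingQuot.mkAlgHom_rel ℂ h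

section AKdefs
variable (n r : ℕ) (q : ℂˣ) (Q : Fin r → ℂˣ)

/-- The generator `T_i` (`0 ≤ i ≤ n-1`); the value for `i ≥ n` is never used. -/
def AK.T (i : ℕ) : AK n r q Q :=
  if h : i < n then AK.mk n r q Q (FreeAlgebra.ι ℂ ⟨i, h⟩) else 1

/-- `T_1 T_2 ⋯ T_j`. -/
def AK.asc : ℕ → AK n r q Q
  | 0 => 1
  | j + 1 => AK.asc j * AK.T n r q Q (j + 1)

/-- `T_j ⋯ T_2 T_1`. -/
def AK.desc : ℕ → AK n r q Q
  | 0 => 1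
  | j + 1 => AK.T n r q Q (j + 1) * AK.desc j

/-- `L_j = T_{j-1} ⋯ T_1 T_0 T_1 ⋯ T_{j-1}` for `1 ≤ j ≤ n`. -/
def AK.L (j : ℕ) : AK n r q Q :=
  AK.desc n r q Q (j - 1) * AK.T n r q Q 0 * AK.asc n r q Q (j - 1)

/-- `L_j^{⟨k⟩} = T_{j-1} ⋯ T_1 (T_0 - Q_0)(T_0 - Q_1) ⋯ (T_0 - Q_{k-1}) T_1 ⋯ T_{j-1}` for
`1 ≤ j ≤ n`, `1 ≤ k ≤ r`. -/
def AK.Lang (j k : ℕ) : AK n r q Q :=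
  AK.desc n r q Q (j - 1) * Polynomial.aeval (AK.T n r q Q 0) (cycPoly Q k) *
    AK.asc n r q Q (j - 1)

end AKdefs

/-- Generators of the affine Hecke algebra: `T i` stands for `T_{i+1}` (which exchanges the
positions `i` and `i + 1` of `Fin n`), `X j`, `XInv j` for `X_{j+1}^±`. -/
inductive AffGen (n : ℕ) : Type
  | T (i : ℕ) (h : i + 1 < n) : AffGen n
  | X (j : Fin n) : AffGen n
  | XInv (j : Fin n) : AffGen n

/-- The defining relations of the affine Hecke algebra of type `GL_n`. -/
inductive AffRel (n : ℕ) (q : ℂˣ) :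
    FreeAlgebra ℂ (AffGen n) → FreeAlgebra ℂ (AffGen n) → Prop
  | quad (i : ℕ) (h : i + 1 < n) :
      AffRel n q ((FreeAlgebra.ι ℂ (.T i h) - algebraMap ℂ _ (q : ℂ)) *
        (FreeAlgebra.ι ℂ (.T i h) + algebraMap ℂ _ (q : ℂ)⁻¹)) 0
  | braid (i : ℕ) (h : i + 1 < n) (h' : i + 1 + 1 < n) :
      AffRel n q
        (FreeAlgebra.ι ℂ (.T i h) * FreeAlgebra.ι ℂ (.T (i + 1) h') * FreeAlgebra.ι ℂ (.T i h))
        (FreeAlgebra.ι ℂ (.T (i + 1) h') * FreeAlgebra.ι ℂ (.T i h) *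
          FreeAlgebra.ι ℂ (.T (i + 1) h'))
  | far (i j : ℕ) (hi : i + 1 < n) (hj : j + 1 < n) (hij : i + 1 < j) :
      AffRel n q (FreeAlgebra.ι ℂ (.T i hi) * FreeAlgebra.ι ℂ (.T j hj))
        (FreeAlgebra.ι ℂ (.T j hj) * FreeAlgebra.ι ℂ (.T i hi))
  | X_XInv (j : Fin n) : AffRel n q (FreeAlgebra.ι ℂ (.X j) * FreeAlgebra.ι ℂ (.XInv j)) 1
  | XInv_X (j : Fin n) : AffRel n q (FreeAlgebra.ι ℂ (.XInv j) * FreeAlgebra.ι ℂ (.X j)) 1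
  | X_X (j k : Fin n) :
      AffRel n q (FreeAlgebra.ι ℂ (.X j) * FreeAlgebra.ι ℂ (.X k))
        (FreeAlgebra.ι ℂ (.X k) * FreeAlgebra.ι ℂ (.X j))
  | T_X_T (i : ℕ) (h : i + 1 < n) :
      AffRel n q
        (FreeAlgebra.ι ℂ (.T i h) * FreeAlgebra.ι ℂ (.X ⟨i, by omega⟩) * FreeAlgebra.ι ℂ (.T i h))
        (FreeAlgebra.ι ℂ (.X ⟨i + 1, h⟩))
  | T_X (i : ℕ) (h : i + 1 < n) (j : Fin n) (h1 : j.val ≠ i) (h2 : j.val ≠ i + 1) :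
      AffRel n q (FreeAlgebra.ι ℂ (.T i h) * FreeAlgebra.ι ℂ (.X j))
        (FreeAlgebra.ι ℂ (.X j) * FreeAlgebra.ι ℂ (.T i h))

/-- The affine Hecke algebra `Ĥ_n` of type `GL_n` over `ℂ`. -/
def AffHecke (n : ℕ) (q : ℂˣ) : Type := RingQuot (AffRel n q)

instance (n : ℕ) (q : ℂˣ) : Ring (AffHecke n q) := inferInstanceAs (Ring (RingQuot (AffRel n q)))

instance (n : ℕ) (q : ℂˣ) : Algebra ℂ (AffHecke n q) :=
  inferInstanceAs (Algebra ℂ (RingQuot (AffRel n q)))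

/-- The image of a generator in `Ĥ_n`. -/
def AffHecke.gen (n : ℕ) (q : ℂˣ) (x : AffGen n) : AffHecke n q :=
  RingQuot.mkAlgHom ℂ (AffRel n q) (FreeAlgebra.ι ℂ x)

/-- A family of elements of an algebra satisfies the defining relations of `Ĥ_n`. -/
structure AffSystem (n : ℕ) (q : ℂˣ) {A : Type*} [Ring A] [Algebra ℂ A] (φ : AffGen n → A) :
    Prop where
  quad : ∀ i h, φ (.T i h) * φ (.T i h) = ((q : ℂ) - (q : ℂ)⁻¹) • φ (.T i h) + 1
  braid : ∀ i h h', φ (.T i h) * φ (.T (i + 1) h') * φ (.T i h) =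
    φ (.T (i + 1) h') * φ (.T i h) * φ (.T (i + 1) h')
  far : ∀ i j hi hj, i + 1 < j → φ (.T i hi) * φ (.T j hj) = φ (.T j hj) * φ (.T i hi)
  X_XInv : ∀ j, φ (.X j) * φ (.XInv j) = 1
  XInv_X : ∀ j, φ (.XInv j) * φ (.X j) = 1
  X_X : ∀ j k, φ (.X j) * φ (.X k) = φ (.X k) * φ (.X j)
  T_X_T : ∀ i h, φ (.T i h) * φ (.X ⟨i, by omega⟩) * φ (.T i h) = φ (.X ⟨i + 1, h⟩)
  T_X : ∀ i h (j : Fin n), j.val ≠ i → j.val ≠ i + 1 →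
    φ (.T i h) * φ (.X j) = φ (.X j) * φ (.T i h)

lemma quad_expand {A : Type*} [Ring A] [Algebra ℂ A] (q : ℂˣ) (T : A) :
    (T - algebraMap ℂ A (q : ℂ)) * (T + algebraMap ℂ A (q : ℂ)⁻¹) =
      T * T - (((q : ℂ) - (q : ℂ)⁻¹) • T + 1) := by
  have h : algebraMap ℂ A (q : ℂ) * algebraMap ℂ A (q : ℂ)⁻¹ = 1 := by
    rw [← map_mul, mul_inv_cancel₀ q.ne_zero, map_one]
  rw [sub_mul, mul_add, mul_add, h, sub_smul, Algebra.smul_def, Algebra.smul_def,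
    Algebra.commutes (q : ℂ)⁻¹ T]
  abel

lemma AffSystem.lift_rel {n : ℕ} {q : ℂˣ} {A : Type*} [Ring A] [Algebra ℂ A] {φ : AffGen n → A}
    (h : AffSystem n q φ) ⦃x y : FreeAlgebra ℂ (AffGen n)⦄ (hxy : AffRel n q x y) :
    FreeAlgebra.lift ℂ φ x = FreeAlgebra.lift ℂ φ y := by
  induction hxy with
  | quad i hi =>
    rw [quad_expand]
    simp [h.quad]
  | braid i hi hi' => simpa using h.braid i hi hi'
  | far i j hi hj hij => simpa using h.far i j hi hj hij
  | X_XInv j => simpa using h.X_XInv j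
  | XInv_X j => simpa using h.XInv_X j
  | X_X j k => simpa using h.X_X j k
  | T_X_T i hi => simpa using h.T_X_T i hi
  | T_X i hi j h1 h2 => simpa using h.T_X i hi j h1 h2

/-- The algebra homomorphism from `Ĥ_n` given by a family satisfying the relations. -/
def AffHecke.lift {n : ℕ} {q : ℂˣ} {A : Type*} [Ring A] [Algebra ℂ A] (φ : AffGen n → A)
    (h : AffSystem n q φ) : AffHecke n q →ₐ[ℂ] A :=
  RingQuot.liftAlgHom ℂ ⟨FreeAlgebra.lift ℂ φ, h.lift_rel⟩

lemma AffHecke.lift_gen {n : ℕ} {q : ℂˣ} {A : Type*} [Ring A] [Algebra ℂ A] (φ : AffGen n → A)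
    (h : AffSystem n q φ) (x : AffGen n) :
    AffHecke.lift φ h (AffHecke.gen n q x) = φ x :=
  (RingQuot.liftAlgHom_mkAlgHom_apply (S := ℂ) (FreeAlgebra.lift ℂ φ)
    (s := AffRel n q) h.lift_rel (FreeAlgebra.ι ℂ x)).trans (FreeAlgebra.lift_ι_apply _ _)

lemma AffHecke.commute_of_gen {n : ℕ} {q : ℂˣ} {A : Type*} [Ring A] [Algebra ℂ A]
    (g : AffHecke n q →ₐ[ℂ] A) (b : A) (h : ∀ x, Commute b (g (AffHecke.gen n q x)))
    (u : AffHecke n q) : Commute b (g u) := by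
  obtain ⟨w, rfl⟩ := RingQuot.mkAlgHom_surjective ℂ (AffRel n q) u
  let G : FreeAlgebra ℂ (AffGen n) →ₐ[ℂ] A := AlgHom.comp g (RingQuot.mkAlgHom ℂ (AffRel n q))
  change Commute b (G w)
  induction w using FreeAlgebra.induction with
  | grade0 r =>
    rw [AlgHom.commutes]
    exact (Algebra.commutes r b).symm
  | grade1 x => exact h x
  | mul x y hx hy => rw [map_mul]; exact hx.mul_right hy
  | add x y hx hy => rw [map_add]; exact hx.add_right hy

section AKlemmas
variable {n r : ℕ} {q : ℂˣ} {Q : Fin r → ℂˣ}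

lemma AK.T_of_lt {i : ℕ} (h : i < n) :
    AK.T n r q Q i = AK.mk n r q Q (FreeAlgebra.ι ℂ ⟨i, h⟩) := dif_pos h

lemma AK.quad {i : ℕ} (h0 : 0 < i) (h : i < n) :
    AK.T n r q Q i * AK.T n r q Q i = ((q : ℂ) - (q : ℂ)⁻¹) • AK.T n r q Q i + 1 := by
  have := AK.mk_rel (AKRel.quad (r := r) (q := q) (Q := Q) ⟨i, h⟩ h0)
  rw [quad_expand, map_sub, map_zero, sub_eq_zero, map_mul, map_add, map_smul, map_one] at this
  rw [AK.T_of_lt h, this]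

lemma AK.braid {i : ℕ} (h0 : 0 < i) (h : i + 1 < n) :
    AK.T n r q Q i * AK.T n r q Q (i + 1) * AK.T n r q Q i =
      AK.T n r q Q (i + 1) * AK.T n r q Q i * AK.T n r q Q (i + 1) := by
  have := AK.mk_rel (AKRel.braid (r := r) (q := q) (Q := Q) ⟨i, by omega⟩ ⟨i + 1, h⟩ h0 rfl)
  simpa only [AK.T_of_lt h, AK.T_of_lt (show i < n by omega), map_mul] using this

lemma AK.braid_zero (h : 1 < n) :
    AK.T n r q Q 0 * AK.T n r q Q 1 * AK.T n r q Q 0 * AK.T n r q Q 1 =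
      AK.T n r q Q 1 * AK.T n r q Q 0 * AK.T n r q Q 1 * AK.T n r q Q 0 := by
  have := AK.mk_rel (AKRel.braid_zero (r := r) (q := q) (Q := Q) h)
  simpa only [AK.T_of_lt h, AK.T_of_lt (show 0 < n by omega), map_mul] using this

lemma AK.far {i j : ℕ} (hij : i + 1 < j) (h : j < n) :
    Commute (AK.T n r q Q i) (AK.T n r q Q j) := by
  have := AK.mk_rel (AKRel.far (r := r) (q := q) (Q := Q) ⟨i, by omega⟩ ⟨j, h⟩ hij)
  rw [map_mul, map_mul] at this
  rw [AK.T_of_lt h, AK.T_of_lt (show i < n by omega)]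
  exact this

lemma AK.cyc (h : 0 < n) : Polynomial.aeval (AK.T n r q Q 0) (cycPoly Q r) = 0 := by
  have := AK.mk_rel (AKRel.cyc (r := r) (q := q) (Q := Q) h)
  rwa [map_zero, ← Polynomial.aeval_algHom_apply, ← AK.T_of_lt h] at this

lemma AK.isUnit_T_zero (h : 0 < n) : IsUnit (AK.T n r q Q 0) := by
  set P := cycPoly Q r with hP
  set t := AK.T n r q Q 0
  have h0 : P.coeff 0 ≠ 0 := by
    rw [Polynomial.coeff_zero_eq_eval_zero, hP, cycPoly, Polynomial.eval_prod]
    exact Finset.prod_ne_zero_iff.2 fun l _ => by simp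
  have h1 : t * Polynomial.aeval t P.divX + algebraMap ℂ _ (P.coeff 0) = 0 := by
    have := congrArg (Polynomial.aeval t) (Polynomial.X_mul_divX_add P)
    rwa [AK.cyc h, map_add, map_mul, Polynomial.aeval_X, Polynomial.aeval_C] at this
  have h2 : Polynomial.aeval t P.divX * t = t * Polynomial.aeval t P.divX := by
    have := congrArg (Polynomial.aeval t) (mul_comm P.divX Polynomial.X)
    simpa using this
  have h3 : t * (-(P.coeff 0)⁻¹ • Polynomial.aeval t P.divX) = 1 := by
    rw [mul_smul_comm, eq_neg_of_add_eq_zero_left h1, smul_neg, neg_smul, neg_neg,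
      Algebra.smul_def, ← map_mul, inv_mul_cancel₀ h0, map_one]
  refine ⟨⟨t, _, h3, ?_⟩, rfl⟩
  rw [smul_mul_assoc, h2, ← mul_smul_comm, h3]

lemma AK.isUnit_T {i : ℕ} (h : i < n) : IsUnit (AK.T n r q Q i) := by
  rcases Nat.eq_zero_or_pos i with rfl | h0
  · exact AK.isUnit_T_zero h
  · have := AK.quad (r := r) (q := q) (Q := Q) h0 h
    refine ⟨⟨AK.T n r q Q i, AK.T n r q Q i - algebraMap ℂ _ ((q : ℂ) - (q : ℂ)⁻¹), ?_, ?_⟩, rfl⟩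
    · rw [mul_sub, this, ← Algebra.commutes, ← Algebra.smul_def]; abel
    · rw [sub_mul, this, ← Algebra.smul_def]; abel

lemma AK.L_one : AK.L n r q Q 1 = AK.T n r q Q 0 := by simp [AK.L, AK.asc, AK.desc]

lemma AK.L_succ (j : ℕ) : AK.L n r q Q (j + 2) =
    AK.T n r q Q (j + 1) * AK.L n r q Q (j + 1) * AK.T n r q Q (j + 1) := by
  simp [AK.L, AK.asc, AK.desc, mul_assoc]

lemma AK.isUnit_L {j : ℕ} (h : j < n) : IsUnit (AK.L n r q Q (j + 1)) := by
  induction j with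
  | zero => rw [AK.L_one]; exact AK.isUnit_T h
  | succ j ih => rw [AK.L_succ]; exact ((AK.isUnit_T h).mul (ih (by omega))).mul (AK.isUnit_T h)

lemma AK.T_L_of_gt {i j : ℕ} (hij : j + 1 < i) (h : i < n) :
    Commute (AK.T n r q Q i) (AK.L n r q Q (j + 1)) := by
  induction j with
  | zero => rw [AK.L_one]; exact (AK.far hij h).symm
  | succ j ih =>
    rw [AK.L_succ]
    exact (((AK.far hij h).symm).mul_right (ih (by omega))).mul_right (AK.far hij h).symm

lemma AK.T_L_of_lt {i j : ℕ} (hi : 0 < i) (hij : i < j) (h : j < n) :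
    Commute (AK.T n r q Q i) (AK.L n r q Q (j + 1)) := by
  induction j with
  | zero => omega
  | succ j ih =>
    rw [AK.L_succ]
    rcases Nat.lt_or_ge i j with h1 | h1
    · have := AK.far (r := r) (q := q) (Q := Q) (show i + 1 < j + 1 by omega) h
      exact (this.mul_right (ih h1 (by omega))).mul_right this
    · obtain rfl : i = j := by omega
      obtain ⟨k, rfl⟩ : ∃ k, i = k + 1 := ⟨i - 1, by omega⟩
      rw [AK.L_succ]
      have hb := AK.braid (r := r) (q := q) (Q := Q) hi h
      have hc := (AK.T_L_of_gt (r := r) (q := q) (Q := Q) (show k + 1 < k + 1 + 1 by omega) h).eq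
      set s := AK.T n r q Q (k + 1)
      set t := AK.T n r q Q (k + 1 + 1)
      set l := AK.L n r q Q (k + 1)
      change s * (t * (s * l * s) * t) = t * (s * l * s) * t * s
      calc s * (t * (s * l * s) * t) = (s * t * s) * l * s * t := by simp only [mul_assoc]
        _ = t * s * (t * l) * s * t := by rw [hb]; simp only [mul_assoc]
        _ = t * s * l * (t * s * t) := by rw [hc]; simp only [mul_assoc]
        _ = t * (s * l * s) * t * s := by rw [← hb]; simp only [mul_assoc]

lemma AK.L_comm {i j : ℕ} (hij : i < j) (h : j < n) :
    Commute (AK.L n r q Q (i + 1)) (AK.L n r q Q (j + 1)) := by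
  induction i with
  | zero =>
    rw [AK.L_one]
    induction j with
    | zero => omega
    | succ j ih =>
      rcases Nat.eq_zero_or_pos j with rfl | h0
      · rw [AK.L_succ, AK.L_one]
        have := AK.braid_zero (r := r) (q := q) (Q := Q) h
        change _ * _ = _ * _
        simp only [mul_assoc, zero_add] at this ⊢
        exact this
      · rw [AK.L_succ]
        have := AK.far (r := r) (q := q) (Q := Q) (show 0 + 1 < j + 1 by omega) h
        exact (this.mul_right (ih (by omega) h0)).mul_right this
  | succ i ih =>
    rw [AK.L_succ]
    have := AK.T_L_of_lt (r := r) (q := q) (Q := Q) (show 0 < i + 1 by omega) hij h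
    exact (this.mul_left (ih (by omega))).mul_left this

end AKlemmas

/-- The images of the generators of `Ĥ_n` in the Ariki–Koike algebra:
`T_i ↦ T_i`, `X_j^± ↦ L_j^{±1}`. -/
def toAKGen (n r : ℕ) (q : ℂˣ) (Q : Fin r → ℂˣ) : AffGen n → AK n r q Q
  | .T i _ => AK.T n r q Q (i + 1)
  | .X j => AK.L n r q Q (j.val + 1)
  | .XInv j => Ring.inverse (AK.L n r q Q (j.val + 1))

lemma toAKGen_system (n r : ℕ) (q : ℂˣ) (Q : Fin r → ℂˣ) : AffSystem n q (toAKGen n r q Q) where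
  quad i h := AK.quad (by omega) h
  braid i h h' := AK.braid (by omega) h'
  far i j hi hj hij := (AK.far (by omega) hj).eq
  X_XInv j := Ring.mul_inverse_cancel _ (AK.isUnit_L j.2)
  XInv_X j := Ring.inverse_mul_cancel _ (AK.isUnit_L j.2)
  X_X j k := by
    rcases lt_trichotomy j.val k.val with h | h | h
    · exact AK.L_comm h k.2
    · rw [Fin.ext h]
    · exact (AK.L_comm h j.2).symm
  T_X_T i h := (AK.L_succ i).symm
  T_X i h j h1 h2 := by
    rcases Nat.lt_or_ge j.val i with h3 | h3
    · exact AK.T_L_of_gt (by omega) h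
    · exact AK.T_L_of_lt (by omega) (by omega) j.2

/-- The surjection `Ĥ_n → H_{n,r}`. -/
def toAK (n r : ℕ) (q : ℂˣ) (Q : Fin r → ℂˣ) : AffHecke n q →ₐ[ℂ] AK n r q Q :=
  AffHecke.lift _ (toAKGen_system n r q Q)

/-! ### The right action of `Ĥ_n` on `V̂^{⊗n}` -/

/-- The operator `T̂` on two tensor factors: the image of
`B p₁ p₂ = (v_{j₁} ⊗ v_{j₂}) ⊗ x₁^{k₁} x₂^{k₂}`, where `p₁ = (j₁, k₁)`, `p₂ = (j₂, k₂)`, is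
`T(v_{j₁} ⊗ v_{j₂}) ⊗ x₁^{k₂} x₂^{k₁}
  + (q - q⁻¹) (v_{j₁} ⊗ v_{j₂}) ⊗ (x₁^{k₂} x₂^{k₁} - x₁^{k₁} x₂^{k₂}) / (x₁ x₂⁻¹ - 1)`.
The Laurent polynomial `(x₁^{k₂} x₂^{k₁} - x₁^{k₁} x₂^{k₂}) / (x₁ x₂⁻¹ - 1)` is the sum of the
monomials `x₁^t x₂^{k₁+k₂-t}` over `k₁ ≤ t < k₂` minus the sum of the same monomials over
`k₂ ≤ t < k₁`. -/
def twoSite {m : ℕ} {M : Type*} [AddCommGroup M] [Module ℂ M] (q : ℂˣ)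
    (B : Fin m × ℤ → Fin m × ℤ → M) (p₁ p₂ : Fin m × ℤ) : M :=
  (if p₁.1 = p₂.1 then (q : ℂ) • B (p₁.1, p₂.2) (p₂.1, p₁.2)
    else if p₁.1 < p₂.1 then B (p₂.1, p₂.2) (p₁.1, p₁.2)
    else B (p₂.1, p₂.2) (p₁.1, p₁.2)
      + ((q : ℂ) - (q : ℂ)⁻¹) • B (p₁.1, p₂.2) (p₂.1, p₁.2))
  + ((q : ℂ) - (q : ℂ)⁻¹) •
    (∑ t ∈ Finset.Ico p₁.2 p₂.2, B (p₁.1, t) (p₂.1, p₁.2 + p₂.2 - t)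
      - ∑ t ∈ Finset.Ico p₂.2 p₁.2, B (p₁.1, t) (p₂.1, p₁.2 + p₂.2 - t))

/-- The basis vector obtained from `tv w` by changing the factors at positions `a`, `b`. -/
def put2 {n m : ℕ} (w : Fin n → Fin m × ℤ) (a b : Fin n) (p₁ p₂ : Fin m × ℤ) : TensV n m :=
  tv (Function.update (Function.update w a p₁) b p₂)

/-- The operator `T̂` acting on the `i`-th and `(i+1)`-st tensor factors of `V̂^{⊗n}` (positions
counted from `0`). -/
def That (q : ℂˣ) {n m : ℕ} (i : ℕ) (h : i + 1 < n) : Module.End ℂ (TensV n m) :=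
  (tBasis n m).constr ℂ fun w =>
    twoSite q (put2 w ⟨i, by omega⟩ ⟨i + 1, h⟩) (w ⟨i, by omega⟩) (w ⟨i + 1, h⟩)

/-- Multiplication by `x^d` on `V̂`. -/
def shift (m : ℕ) (d : ℤ) : Module.End ℂ (Vhat m) :=
  Finsupp.linearCombination ℂ fun p => bv (p.1, p.2 + d)

/-- Multiplication by `x_a^d` on `V̂^{⊗n}`. -/
def Xop {n m : ℕ} (a : Fin n) (d : ℤ) : Module.End ℂ (TensV n m) := site a (shift m d)

lemma shift_bv {m : ℕ} (d : ℤ) (p : Fin m × ℤ) : shift m d (bv p) = bv (p.1, p.2 + d) := by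
  simp [shift, Finsupp.linearCombination_single]

lemma shift_mul (m : ℕ) (d e : ℤ) : shift m d * shift m e = shift m (d + e) :=
  vhat_ext fun p => by
    rw [Module.End.mul_apply, shift_bv, shift_bv, shift_bv, add_assoc, add_comm e d]

lemma shift_zero (m : ℕ) : shift m 0 = 1 := vhat_ext fun p => by
  rw [shift_bv, add_zero]; rfl

lemma Xop_tv {n m : ℕ} (a : Fin n) (d : ℤ) (w : Fin n → Fin m × ℤ) :
    Xop a d (tv w) = tv (Function.update w a ((w a).1, (w a).2 + d)) := by
  rw [Xop, site_tv, shift_bv, put_bv]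

lemma Xop_mul {n m : ℕ} (a : Fin n) (d e : ℤ) :
    (Xop a d * Xop a e : Module.End ℂ (TensV n m)) = Xop a (d + e) := by
  rw [Xop, Xop, ← map_mul, shift_mul, Xop]

lemma Xop_zero {n m : ℕ} (a : Fin n) : (Xop a 0 : Module.End ℂ (TensV n m)) = 1 := by
  rw [Xop, shift_zero, map_one]

lemma Xop_comm {n m : ℕ} (a b : Fin n) (d e : ℤ) :
    Commute (Xop a d : Module.End ℂ (TensV n m)) (Xop b e) := by
  by_cases h : a = b
  · subst h
    change _ * _ = _ * _
    rw [Xop_mul, Xop_mul, add_comm]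
  · exact site_comm h _ _

lemma That_tv (q : ℂˣ) {n m : ℕ} (i : ℕ) (h : i + 1 < n) (w : Fin n → Fin m × ℤ) :
    That q i h (tv w) =
      twoSite q (put2 w ⟨i, by omega⟩ ⟨i + 1, h⟩) (w ⟨i, by omega⟩) (w ⟨i + 1, h⟩) := by
  rw [That, ← tBasis_apply, Module.Basis.constr_basis]

lemma sig_left {M : Type*} [AddCommGroup M] (G : ℤ → M) (a b : ℤ) :
    ∑ t ∈ Finset.Ico (a + 1) b, G t - ∑ t ∈ Finset.Ico b (a + 1), G t =
      ∑ t ∈ Finset.Ico a b, G t - ∑ t ∈ Finset.Ico b a, G t - G a := by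
  rcases lt_or_ge a b with h | h
  · rw [← Finset.insert_Ico_add_one_left_eq_Ico h, Finset.sum_insert (by simp),
      Finset.Ico_eq_empty (a := b) (b := a + 1) (by omega),
      Finset.Ico_eq_empty (a := b) (b := a) (by omega)]
    simp
  · rw [← Finset.insert_Ico_right_eq_Ico_add_one h, Finset.sum_insert (by simp),
      Finset.Ico_eq_empty (a := a + 1) (b := b) (by omega),
      Finset.Ico_eq_empty (a := a) (b := b) (by omega)]
    simp; abel

lemma sum_Ico_succ {M : Type*} [AddCommGroup M] (G : ℤ → M) (a b : ℤ) :
    ∑ t ∈ Finset.Ico a b, G (t + 1) = ∑ t ∈ Finset.Ico (a + 1) (b + 1), G t := by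
  rw [← Finset.map_add_right_Ico a b 1, Finset.sum_map]
  rfl

section twoSiteLemmas
variable {m : ℕ} {M M' : Type*} [AddCommGroup M] [Module ℂ M] [AddCommGroup M'] [Module ℂ M']

lemma map_twoSite (q : ℂˣ) (g : M →ₗ[ℂ] M') (B : Fin m × ℤ → Fin m × ℤ → M)
    (p₁ p₂ : Fin m × ℤ) :
    g (twoSite q B p₁ p₂) = twoSite q (fun x y => g (B x y)) p₁ p₂ := by
  unfold twoSite
  rw [map_add, map_smul, map_sub, map_sum, map_sum]
  congr 1
  split_ifs <;> simp

lemma twoSite_left (q : ℂˣ) (B : Fin m × ℤ → Fin m × ℤ → M) (p₁ p₂ : Fin m × ℤ) :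
    twoSite q B (p₁.1, p₁.2 + 1) p₂ =
      twoSite q (fun x y => B x (y.1, y.2 + 1)) p₁ p₂
        - ((q : ℂ) - (q : ℂ)⁻¹) • B p₁ (p₂.1, p₂.2 + 1) := by
  unfold twoSite
  dsimp only
  have e : ∀ t, p₁.2 + 1 + p₂.2 - t = p₁.2 + p₂.2 - t + 1 := fun t => by ring
  simp only [e]
  rw [sig_left (fun t => B (p₁.1, t) (p₂.1, p₁.2 + p₂.2 - t + 1)) p₁.2 p₂.2, smul_sub,
    show p₁.2 + p₂.2 - p₁.2 + 1 = p₂.2 + 1 by ring]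
  exact (add_sub_assoc _ _ _).symm

lemma twoSite_right (q : ℂˣ) (B : Fin m × ℤ → Fin m × ℤ → M) (p₁ p₂ : Fin m × ℤ) :
    twoSite q B p₁ (p₂.1, p₂.2 + 1) =
      twoSite q (fun x y => B (x.1, x.2 + 1) y) p₁ p₂
        + ((q : ℂ) - (q : ℂ)⁻¹) • B p₁ (p₂.1, p₂.2 + 1) := by
  unfold twoSite
  dsimp only
  rw [add_assoc, ← smul_add]
  congr 2
  have := sig_left (fun t => B (p₁.1, t) (p₂.1, p₁.2 + (p₂.2 + 1) - t)) p₁.2 (p₂.2 + 1)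
  rw [← sum_Ico_succ (fun t => B (p₁.1, t) (p₂.1, p₁.2 + (p₂.2 + 1) - t)),
    ← sum_Ico_succ (fun t => B (p₁.1, t) (p₂.1, p₁.2 + (p₂.2 + 1) - t))] at this
  have e : ∀ t, p₁.2 + (p₂.2 + 1) - (t + 1) = p₁.2 + p₂.2 - t := fun t => by ring
  simp only [e] at this
  rw [this, show p₁.2 + (p₂.2 + 1) - p₁.2 = p₂.2 + 1 by ring]
  abel

end twoSiteLemmas

section Bernstein
variable {n m : ℕ} (q : ℂˣ) (i : ℕ) (h : i + 1 < n)

lemma put2_self (w : Fin n → Fin m × ℤ) (a b : Fin n) : put2 w a b (w a) (w b) = tv w := by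
  rw [put2, Function.update_eq_self, Function.update_eq_self]

lemma Xop_put2_left (w : Fin n → Fin m × ℤ) {a b : Fin n} (hab : a ≠ b) (d : ℤ)
    (p₁ p₂ : Fin m × ℤ) : Xop a d (put2 w a b p₁ p₂) = put2 w a b (p₁.1, p₁.2 + d) p₂ := by
  rw [put2, Xop_tv, put2, Function.update_comm hab.symm]
  simp [hab]

lemma Xop_put2_right (w : Fin n → Fin m × ℤ) (a b : Fin n) (d : ℤ)
    (p₁ p₂ : Fin m × ℤ) : Xop b d (put2 w a b p₁ p₂) = put2 w a b p₁ (p₂.1, p₂.2 + d) := by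
  rw [put2, Xop_tv, put2]
  simp

lemma That_put2 (w : Fin n → Fin m × ℤ) (p₁ p₂ : Fin m × ℤ) :
    That q i h (put2 w ⟨i, by omega⟩ ⟨i + 1, h⟩ p₁ p₂) =
      twoSite q (put2 w ⟨i, by omega⟩ ⟨i + 1, h⟩) p₁ p₂ := by
  have hne : (⟨i, by omega⟩ : Fin n) ≠ ⟨i + 1, h⟩ := by simp
  rw [put2, That_tv]
  congr 1
  · funext x y
    rw [put2, put2]
    congr 1
    rw [Function.update_comm hne.symm, Function.update_idem, Function.update_idem]
  · simp [hne]
  · simp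

lemma That_Xop_left :
    (That q i h * Xop ⟨i, by omega⟩ 1 : Module.End ℂ (TensV n m)) =
      Xop ⟨i + 1, h⟩ 1 * That q i h - ((q : ℂ) - (q : ℂ)⁻¹) • Xop ⟨i + 1, h⟩ 1 := by
  have hne : (⟨i, by omega⟩ : Fin n) ≠ ⟨i + 1, h⟩ := by simp
  refine tens_ext fun w => ?_
  rw [← put2_self w ⟨i, by omega⟩ ⟨i + 1, h⟩]
  simp only [Module.End.mul_apply, LinearMap.sub_apply, LinearMap.smul_apply,
    Xop_put2_left w hne, Xop_put2_right, That_put2, map_twoSite, twoSite_left]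

lemma That_Xop_right :
    (That q i h * Xop ⟨i + 1, h⟩ 1 : Module.End ℂ (TensV n m)) =
      Xop ⟨i, by omega⟩ 1 * That q i h + ((q : ℂ) - (q : ℂ)⁻¹) • Xop ⟨i + 1, h⟩ 1 := by
  have hne : (⟨i, by omega⟩ : Fin n) ≠ ⟨i + 1, h⟩ := by simp
  refine tens_ext fun w => ?_
  rw [← put2_self w ⟨i, by omega⟩ ⟨i + 1, h⟩]
  simp only [Module.End.mul_apply, LinearMap.add_apply, LinearMap.smul_apply,
    Xop_put2_left w hne, Xop_put2_right, That_put2, map_twoSite, twoSite_right]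

lemma That_put (w : Fin n → Fin m × ℤ) (b : Fin n) (h1 : b.val ≠ i) (h2 : b.val ≠ i + 1)
    (v : Vhat m) : That q i h (put w b v) =
      twoSite q (fun p₁ p₂ =>
        put (Function.update (Function.update w ⟨i, by omega⟩ p₁) ⟨i + 1, h⟩ p₂) b v)
        (w ⟨i, by omega⟩) (w ⟨i + 1, h⟩) := by
  have hb1 : (⟨i, by omega⟩ : Fin n) ≠ b := fun e => h1 (by rw [← e])
  have hb2 : (⟨i + 1, h⟩ : Fin n) ≠ b := fun e => h2 (by rw [← e])
  induction v using Finsupp.induction_linear with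
  | zero => simp [twoSite]
  | add v v' hv hv' =>
    simp only [map_add, hv, hv']
    unfold twoSite
    simp only [Finset.sum_add_distrib]
    split_ifs <;> module
  | single p c =>
    have : (Finsupp.single p c : Vhat m) = c • bv p := by simp
    rw [this]
    have key := map_twoSite q (c • LinearMap.id : TensV n m →ₗ[ℂ] TensV n m)
      (fun p₁ p₂ => tv (Function.update (Function.update (Function.update w
        ⟨i, by omega⟩ p₁) ⟨i + 1, h⟩ p₂) b p)) (w ⟨i, by omega⟩) (w ⟨i + 1, h⟩)
    simp only [LinearMap.smul_apply, LinearMap.id_apply] at key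
    simp only [map_smul, put_bv, That_tv]
    rw [← key, Function.update_of_ne hb1, Function.update_of_ne hb2]
    congr 2
    funext p₁ p₂
    rw [put2, Function.update_comm hb2, Function.update_comm hb1]

lemma That_site (b : Fin n) (h1 : b.val ≠ i) (h2 : b.val ≠ i + 1) (φ : Module.End ℂ (Vhat m)) :
    Commute (That q i h) (site b φ) := by
  have hb1 : b ≠ (⟨i, by omega⟩ : Fin n) := fun e => h1 (by rw [e])
  have hb2 : b ≠ (⟨i + 1, h⟩ : Fin n) := fun e => h2 (by rw [e])
  refine tens_ext fun w => ?_
  rw [Module.End.mul_apply, Module.End.mul_apply, site_tv, That_put q i h w b h1 h2, That_tv,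
    map_twoSite]
  congr 1
  funext p₁ p₂
  rw [put2, site_tv, Function.update_of_ne hb2, Function.update_of_ne hb1]

/-- The commutation of `T̂_i` with `X_b`, in a uniform shape. -/
lemma That_Xop (b : Fin n) : ∃ (b' : Fin n) (κ : ℂ),
    (That q i h * Xop b 1 : Module.End ℂ (TensV n m)) =
      Xop b' 1 * That q i h + κ • Xop ⟨i + 1, h⟩ 1 := by
  by_cases h1 : b.val = i
  · rw [show b = ⟨i, by omega⟩ from Fin.ext h1]
    exact ⟨_, -((q : ℂ) - (q : ℂ)⁻¹), by rw [That_Xop_left, neg_smul, sub_eq_add_neg]⟩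
  · by_cases h2 : b.val = i + 1
    · rw [show b = ⟨i + 1, h⟩ from Fin.ext h2]
      exact ⟨_, _, That_Xop_right q i h⟩
    · exact ⟨b, 0, by
        rw [zero_smul, add_zero]; exact That_site q i h b h1 h2 _⟩

end Bernstein

/-- An operator that commutes with the `X_b` up to a relabelling and kills all
`v_{j_1} ⊗ ⋯ ⊗ v_{j_n}` vanishes. -/
lemma eq_zero_of_intertwine {n m : ℕ} (P : Module.End ℂ (TensV n m))
    (hP : ∀ b : Fin n, ∃ b' : Fin n, P * Xop b 1 = Xop b' 1 * P)
    (h0 : ∀ w : Fin n → Fin m × ℤ, (∀ a, (w a).2 = 0) → P (tv w) = 0) : P = 0 := by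
  have up : ∀ (b : Fin n) (x : TensV n m), P x = 0 → P (Xop b 1 x) = 0 := fun b x hx => by
    obtain ⟨b', hb⟩ := hP b
    rw [← Module.End.mul_apply, hb, Module.End.mul_apply, hx, map_zero]
  have down : ∀ (b : Fin n) (x : TensV n m), P x = 0 → P (Xop b (-1) x) = 0 := fun b x hx => by
    obtain ⟨b', hb⟩ := hP b
    have : P * Xop b (-1) = Xop b' (-1) * P := by
      calc P * Xop b (-1) = Xop b' (-1) * (Xop b' 1 * P) * Xop b (-1) := by
            rw [← mul_assoc, Xop_mul, neg_add_cancel, Xop_zero, one_mul]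
        _ = Xop b' (-1) * P := by
            rw [← hb, mul_assoc, mul_assoc, Xop_mul, add_neg_cancel, Xop_zero, mul_one]
    rw [← Module.End.mul_apply, this, Module.End.mul_apply, hx, map_zero]
  have all : ∀ (b : Fin n) (k : ℤ) (x : TensV n m), P x = 0 → P (Xop b k x) = 0 := by
    intro b k x hx
    induction k using Int.induction_on with
    | zero => rw [Xop_zero]; exact hx
    | succ k ih =>
      rw [add_comm, ← Xop_mul, Module.End.mul_apply]; exact up b _ ih
    | pred k ih =>
      rw [sub_eq_add_neg, add_comm, ← Xop_mul, Module.End.mul_apply]; exact down b _ ih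
  have main : ∀ (s : Finset (Fin n)) (w : Fin n → Fin m × ℤ), (∀ a, a ∉ s → (w a).2 = 0) →
      P (tv w) = 0 := by
    intro s
    induction s using Finset.induction_on with
    | empty => intro w hw; exact h0 w fun a => hw a (by simp)
    | insert b s hb ih =>
      intro w hw
      have hw' : tv w = Xop b (w b).2 (tv (Function.update w b ((w b).1, 0))) := by
        rw [Xop_tv]; simp
      rw [hw']
      refine all _ _ _ (ih _ fun a ha => ?_)
      by_cases hab : a = b
      · subst hab; simp
      · rw [Function.update_of_ne hab]; exact hw a (by simp [hab, ha])
  exact tens_ext fun w => by rw [main Finset.univ w (by simp)]; rfl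

section TwoSiteSwap
variable {m : ℕ} {M : Type*} [AddCommGroup M] [Module ℂ M]

/-- `twoSite` as a linear function of the family `B`. -/
def twoSiteLin (q : ℂˣ) (p₁ p₂ : Fin m × ℤ) :
    (Fin m × ℤ → Fin m × ℤ → M) →ₗ[ℂ] M where
  toFun B := twoSite q B p₁ p₂
  map_add' B B' := by
    unfold twoSite
    simp only [Pi.add_apply, Finset.sum_add_distrib]
    split_ifs <;> module
  map_smul' c B := by
    unfold twoSite
    simp only [Pi.smul_apply, ← Finset.smul_sum, RingHom.id_apply]
    split_ifs <;> module

lemma twoSite_swap (q : ℂˣ) (B : Fin m × ℤ → Fin m × ℤ → Fin m × ℤ → Fin m × ℤ → M)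
    (p₁ p₂ p₃ p₄ : Fin m × ℤ) :
    twoSite q (fun x y => twoSite q (fun u v => B u v x y) p₁ p₂) p₃ p₄ =
      twoSite q (fun u v => twoSite q (fun x y => B u v x y) p₃ p₄) p₁ p₂ := by
  have h := map_twoSite q (twoSiteLin (M := M) q p₁ p₂) (fun x y u v => B u v x y) p₃ p₄
  refine h.symm.trans ?_
  change twoSite q _ p₁ p₂ = _
  congr 1
  funext u v
  exact map_twoSite q ((LinearMap.proj v).comp (LinearMap.proj (R := ℂ)
    (φ := fun _ : Fin m × ℤ => Fin m × ℤ → M) u)) (fun x y u v => B u v x y) p₃ p₄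

lemma twoSite_zero (q : ℂˣ) (B : Fin m × ℤ → Fin m × ℤ → M) (j₁ j₂ : Fin m) :
    twoSite q B (j₁, 0) (j₂, 0) =
      if j₁ = j₂ then (q : ℂ) • B (j₁, 0) (j₂, 0)
      else if j₁ < j₂ then B (j₂, 0) (j₁, 0)
      else B (j₂, 0) (j₁, 0) + ((q : ℂ) - (q : ℂ)⁻¹) • B (j₁, 0) (j₂, 0) := by
  simp [twoSite]

end TwoSiteSwap

section BraidAux
variable {A : Type*} [Ring A] [Algebra ℂ A] (c : ℂ) (t s X Y Z : A)

lemma braid_aux_X (tX : t * X = Y * t - c • Y) (tY : t * Y = X * t + c • Y)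
    (sY : s * Y = Z * s - c • Z) (sZ : s * Z = Y * s + c • Z) (tZ : t * Z = Z * t)
    (sX : s * X = X * s) (tt : t * t = c • t + 1) (ss : s * s = c • s + 1) :
    (t * s * t - s * t * s) * X = Z * (t * s * t - s * t * s) := by
  have tX2 : ∀ w, t * (X * w) = Y * (t * w) - c • (Y * w) := fun w => by
    rw [← mul_assoc, tX, sub_mul, smul_mul_assoc, mul_assoc]
  have tY2 : ∀ w, t * (Y * w) = X * (t * w) + c • (Y * w) := fun w => by
    rw [← mul_assoc, tY, add_mul, smul_mul_assoc, mul_assoc]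
  have sY2 : ∀ w, s * (Y * w) = Z * (s * w) - c • (Z * w) := fun w => by
    rw [← mul_assoc, sY, sub_mul, smul_mul_assoc, mul_assoc]
  have sZ2 : ∀ w, s * (Z * w) = Y * (s * w) + c • (Z * w) := fun w => by
    rw [← mul_assoc, sZ, add_mul, smul_mul_assoc, mul_assoc]
  have tZ2 : ∀ w, t * (Z * w) = Z * (t * w) := fun w => by
    rw [← mul_assoc, tZ, mul_assoc]
  have sX2 : ∀ w, s * (X * w) = X * (s * w) := fun w => by
    rw [← mul_assoc, sX, mul_assoc]
  simp only [sub_mul, mul_sub, mul_add, mul_assoc, tX, tY, sY, sZ, tZ, sX, tX2, tY2, sY2, sZ2,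
    tZ2, sX2, tt, ss, mul_smul_comm, smul_sub, smul_add, mul_one]
  module

lemma braid_aux_Y (tX : t * X = Y * t - c • Y) (tY : t * Y = X * t + c • Y)
    (sY : s * Y = Z * s - c • Z) (sZ : s * Z = Y * s + c • Z) (tZ : t * Z = Z * t)
    (sX : s * X = X * s) (tt : t * t = c • t + 1) (ss : s * s = c • s + 1) :
    (t * s * t - s * t * s) * Y = Y * (t * s * t - s * t * s) := by
  have tX2 : ∀ w, t * (X * w) = Y * (t * w) - c • (Y * w) := fun w => by
    rw [← mul_assoc, tX, sub_mul, smul_mul_assoc, mul_assoc]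
  have tY2 : ∀ w, t * (Y * w) = X * (t * w) + c • (Y * w) := fun w => by
    rw [← mul_assoc, tY, add_mul, smul_mul_assoc, mul_assoc]
  have sY2 : ∀ w, s * (Y * w) = Z * (s * w) - c • (Z * w) := fun w => by
    rw [← mul_assoc, sY, sub_mul, smul_mul_assoc, mul_assoc]
  have sZ2 : ∀ w, s * (Z * w) = Y * (s * w) + c • (Z * w) := fun w => by
    rw [← mul_assoc, sZ, add_mul, smul_mul_assoc, mul_assoc]
  have tZ2 : ∀ w, t * (Z * w) = Z * (t * w) := fun w => by
    rw [← mul_assoc, tZ, mul_assoc]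
  have sX2 : ∀ w, s * (X * w) = X * (s * w) := fun w => by
    rw [← mul_assoc, sX, mul_assoc]
  simp only [sub_mul, mul_sub, mul_add, mul_assoc, tX, tY, sY, sZ, tZ, sX, tX2, tY2, sY2, sZ2,
    tZ2, sX2, tt, ss, mul_smul_comm, smul_sub, smul_add, mul_one]
  module

lemma braid_aux_Z (tX : t * X = Y * t - c • Y) (tY : t * Y = X * t + c • Y)
    (sY : s * Y = Z * s - c • Z) (sZ : s * Z = Y * s + c • Z) (tZ : t * Z = Z * t)
    (sX : s * X = X * s) (tt : t * t = c • t + 1) (ss : s * s = c • s + 1) :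
    (t * s * t - s * t * s) * Z = X * (t * s * t - s * t * s) := by
  have tX2 : ∀ w, t * (X * w) = Y * (t * w) - c • (Y * w) := fun w => by
    rw [← mul_assoc, tX, sub_mul, smul_mul_assoc, mul_assoc]
  have tY2 : ∀ w, t * (Y * w) = X * (t * w) + c • (Y * w) := fun w => by
    rw [← mul_assoc, tY, add_mul, smul_mul_assoc, mul_assoc]
  have sY2 : ∀ w, s * (Y * w) = Z * (s * w) - c • (Z * w) := fun w => by
    rw [← mul_assoc, sY, sub_mul, smul_mul_assoc, mul_assoc]
  have sZ2 : ∀ w, s * (Z * w) = Y * (s * w) + c • (Z * w) := fun w => by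
    rw [← mul_assoc, sZ, add_mul, smul_mul_assoc, mul_assoc]
  have tZ2 : ∀ w, t * (Z * w) = Z * (t * w) := fun w => by
    rw [← mul_assoc, tZ, mul_assoc]
  have sX2 : ∀ w, s * (X * w) = X * (s * w) := fun w => by
    rw [← mul_assoc, sX, mul_assoc]
  simp only [sub_mul, mul_sub, mul_add, mul_assoc, tX, tY, sY, sZ, tZ, sX, tX2, tY2, sY2, sZ2,
    tZ2, sX2, tt, ss, mul_smul_comm, smul_sub, smul_add, mul_one]
  module

end BraidAux

section HeckeRelations
variable {n m : ℕ} (q : ℂˣ)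

lemma That_quad (i : ℕ) (h : i + 1 < n) :
    (That q i h * That q i h : Module.End ℂ (TensV n m)) =
      ((q : ℂ) - (q : ℂ)⁻¹) • That q i h + 1 := by
  rw [← sub_eq_zero]
  refine eq_zero_of_intertwine _ (fun b => ⟨b, ?_⟩) fun w hw => ?_
  · have hX := That_Xop_left (m := m) q i h
    have hY := That_Xop_right (m := m) q i h
    by_cases h1 : b.val = i
    · rw [show b = ⟨i, by omega⟩ from Fin.ext h1]
      simp only [sub_mul, add_mul, mul_sub, mul_add, mul_assoc, smul_mul_assoc, mul_smul_comm,
        hX, one_mul, mul_one]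
      simp only [← mul_assoc, hY]
      simp only [sub_mul, add_mul, mul_assoc, smul_mul_assoc]
      module
    · by_cases h2 : b.val = i + 1
      · rw [show b = ⟨i + 1, h⟩ from Fin.ext h2]
        simp only [sub_mul, add_mul, mul_sub, mul_add, mul_assoc, smul_mul_assoc, mul_smul_comm,
          hY, one_mul, mul_one]
        simp only [← mul_assoc, hX]
        simp only [sub_mul, add_mul, mul_assoc, smul_mul_assoc]
        module
      · have hc : Commute (That q i h : Module.End ℂ (TensV n m)) (Xop b 1) :=
          That_site q i h b h1 h2 _
        exact ((hc.mul_left hc).sub_left ((hc.smul_left _).add_left (Commute.one_left _))).eq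
  · obtain ⟨j₁, hj₁⟩ : ∃ j₁, w ⟨i, by omega⟩ = (j₁, 0) := ⟨_, Prod.ext rfl (hw _)⟩
    obtain ⟨j₂, hj₂⟩ : ∃ j₂, w ⟨i + 1, h⟩ = (j₂, 0) := ⟨_, Prod.ext rfl (hw _)⟩
    have hq := q.ne_zero
    rw [← put2_self w ⟨i, by omega⟩ ⟨i + 1, h⟩, hj₁, hj₂]
    simp only [LinearMap.sub_apply, LinearMap.add_apply, Module.End.mul_apply,
      LinearMap.smul_apply, Module.End.one_apply, That_put2, twoSite_zero]
    rcases lt_trichotomy j₁ j₂ with h1 | h1 | h1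
    · simp [h1.ne, h1.ne', h1, h1.not_gt, That_put2, twoSite_zero]
      abel
    · subst h1
      simp only [if_true, map_smul, That_put2, twoSite_zero]
      match_scalars
      field_simp
      ring
    · simp [h1.ne, h1.ne', h1, h1.not_gt, That_put2, twoSite_zero]
      abel

lemma That_far (i j : ℕ) (hi : i + 1 < n) (hj : j + 1 < n) (hij : i + 1 < j) :
    Commute (That q i hi : Module.End ℂ (TensV n m)) (That q j hj) := by
  refine tens_ext fun w => ?_
  have n1 : (⟨i, by omega⟩ : Fin n) ≠ ⟨j, by omega⟩ := by simp; omega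
  have n2 : (⟨i, by omega⟩ : Fin n) ≠ ⟨j + 1, hj⟩ := by simp; omega
  have n3 : (⟨i + 1, hi⟩ : Fin n) ≠ ⟨j, by omega⟩ := by simp; omega
  have n4 : (⟨i + 1, hi⟩ : Fin n) ≠ ⟨j + 1, hj⟩ := by simp; omega
  rw [Module.End.mul_apply, Module.End.mul_apply, That_tv q i, That_tv q j, map_twoSite,
    map_twoSite]
  simp only [put2, That_tv, Function.update_of_ne n1, Function.update_of_ne n2,
    Function.update_of_ne n3, Function.update_of_ne n4, Function.update_of_ne n1.symm,
    Function.update_of_ne n2.symm, Function.update_of_ne n3.symm, Function.update_of_ne n4.symm]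
  rw [twoSite_swap]
  congr 1
  funext u v
  congr 1
  funext x y
  rw [put2, put2]
  congr 1
  rw [Function.update_comm n2.symm, Function.update_comm n1.symm, Function.update_comm n4.symm,
    Function.update_comm n3.symm]

lemma That_braid (i : ℕ) (h : i + 1 < n) (h' : i + 1 + 1 < n) :
    (That q i h * That q (i + 1) h' * That q i h : Module.End ℂ (TensV n m)) =
      That q (i + 1) h' * That q i h * That q (i + 1) h' := by
  have tX := That_Xop_left (m := m) q i h
  have tY := That_Xop_right (m := m) q i h
  have sY := That_Xop_left (m := m) q (i + 1) h'
  have sZ := That_Xop_right (m := m) q (i + 1) h'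
  have tZ : (That q i h : Module.End ℂ (TensV n m)) * Xop ⟨i + 1 + 1, h'⟩ 1 =
    Xop ⟨i + 1 + 1, h'⟩ 1 * That q i h :=
    That_site q i h ⟨i + 1 + 1, h'⟩ (by simp; omega) (by simp) _
  have sX : (That q (i + 1) h' : Module.End ℂ (TensV n m)) * Xop ⟨i, by omega⟩ 1 =
    Xop ⟨i, by omega⟩ 1 * That q (i + 1) h' :=
    That_site q (i + 1) h' ⟨i, by omega⟩ (by simp) (by simp; omega) _
  have tt := That_quad (m := m) q i h
  have ss := That_quad (m := m) q (i + 1) h'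
  rw [← sub_eq_zero]
  refine eq_zero_of_intertwine _ (fun b => ?_) fun w hw => ?_
  · by_cases h1 : b.val = i
    · refine ⟨⟨i + 1 + 1, h'⟩, ?_⟩
      rw [show b = ⟨i, by omega⟩ from Fin.ext h1]
      exact braid_aux_X _ _ _ _ _ _ tX tY sY sZ tZ sX tt ss
    by_cases h2 : b.val = i + 1
    · refine ⟨⟨i + 1, h⟩, ?_⟩
      rw [show b = ⟨i + 1, h⟩ from Fin.ext h2]
      exact braid_aux_Y _ _ _ _ _ _ tX tY sY sZ tZ sX tt ss
    by_cases h3 : b.val = i + 1 + 1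
    · refine ⟨⟨i, Nat.lt_of_succ_lt h⟩, ?_⟩
      rw [show b = ⟨i + 1 + 1, h'⟩ from Fin.ext h3]
      exact braid_aux_Z _ _ _ _ _ _ tX tY sY sZ tZ sX tt ss
    · have ht : Commute (That q i h : Module.End ℂ (TensV n m)) (Xop b 1) :=
        That_site q i h b h1 h2 _
      have hs : Commute (That q (i + 1) h' : Module.End ℂ (TensV n m)) (Xop b 1) :=
        That_site q (i + 1) h' b h2 h3 _
      exact ⟨b, (((ht.mul_left hs).mul_left ht).sub_left ((hs.mul_left ht).mul_left hs)).eq⟩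
  · have n1 : (⟨i, by omega⟩ : Fin n) ≠ ⟨i + 1, h⟩ := by simp
    have n2 : (⟨i, by omega⟩ : Fin n) ≠ ⟨i + 1 + 1, h'⟩ := by simp; omega
    have n3 : (⟨i + 1, h⟩ : Fin n) ≠ ⟨i + 1 + 1, h'⟩ := by simp
    obtain ⟨j₁, hj₁⟩ : ∃ j₁, w ⟨i, by omega⟩ = (j₁, 0) := ⟨_, Prod.ext rfl (hw _)⟩
    obtain ⟨j₂, hj₂⟩ : ∃ j₂, w ⟨i + 1, h⟩ = (j₂, 0) := ⟨_, Prod.ext rfl (hw _)⟩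
    obtain ⟨j₃, hj₃⟩ : ∃ j₃, w ⟨i + 1 + 1, h'⟩ = (j₃, 0) := ⟨_, Prod.ext rfl (hw _)⟩
    let C : Fin m → Fin m → Fin m → TensV n m := fun a b c =>
      tv (Function.update (Function.update (Function.update w ⟨i, by omega⟩ (a, 0))
        ⟨i + 1, h⟩ (b, 0)) ⟨i + 1 + 1, h'⟩ (c, 0))
    have hC : tv w = C j₁ j₂ j₃ := by
      simp only [C]
      rw [← hj₁, ← hj₂, ← hj₃, Function.update_eq_self, Function.update_eq_self,
        Function.update_eq_self]
    have hT : ∀ a b c, That q i h (C a b c) =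
        if a = b then (q : ℂ) • C a b c
        else if a < b then C b a c
        else C b a c + ((q : ℂ) - (q : ℂ)⁻¹) • C a b c := by
      intro a b c
      have : ∀ a b, C a b c = put2 (Function.update w ⟨i + 1 + 1, h'⟩ (c, 0)) ⟨i, by omega⟩
          ⟨i + 1, h⟩ (a, 0) (b, 0) := by
        intro a b
        simp only [C, put2]
        rw [Function.update_comm n3, Function.update_comm n2]
      simp only [this, That_put2, twoSite_zero]
    have hS : ∀ a b c, That q (i + 1) h' (C a b c) =
        if b = c then (q : ℂ) • C a b c
        else if b < c then C a c b
        else C a c b + ((q : ℂ) - (q : ℂ)⁻¹) • C a b c := by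
      intro a b c
      have : ∀ b c, C a b c = put2 (Function.update w ⟨i, by omega⟩ (a, 0)) ⟨i + 1, by omega⟩
          ⟨i + 1 + 1, h'⟩ (b, 0) (c, 0) := fun b c => rfl
      simp only [this, That_put2, twoSite_zero]
    have hq := q.ne_zero
    rw [hC]
    clear_value C
    simp only [LinearMap.sub_apply, Module.End.mul_apply]
    rcases lt_trichotomy j₁ j₂ with h1 | h1 | h1 <;> rcases lt_trichotomy j₂ j₃ with h2 | h2 | h2 <;>
      rcases lt_trichotomy j₁ j₃ with h3 | h3 | h3 <;>
      first
      | (exfalso; omega)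
      | (subst h1; subst h2
         simp [hT, hS]
         done)
      | (subst h1
         simp [hT, hS, h2, h3, h2.ne, h2.ne', h2.not_gt, h3.ne, h3.ne', h3.not_gt]
         try (match_scalars <;> field_simp <;> ring)
         done)
      | (subst h2
         simp [hT, hS, h1, h3, h1.ne, h1.ne', h1.not_gt, h3.ne, h3.ne', h3.not_gt]
         try (match_scalars <;> field_simp <;> ring)
         done)
      | (subst h3
         simp [hT, hS, h2, h1, h2.ne, h2.ne', h2.not_gt, h1.ne, h1.ne', h1.not_gt]
         try (match_scalars <;> field_simp <;> ring)
         done)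
      | (simp [hT, hS, h1, h2, h3, h1.ne, h1.ne', h1.not_gt, h2.ne, h2.ne', h2.not_gt, h3.ne,
          h3.ne', h3.not_gt]
         try module
         done)

end HeckeRelations

section UqCommutation

/-- The matrix coefficient of a generator on the `j`-th basis vector of `V`. -/
def vCoeff (q : ℂˣ) {m : ℕ} : UqGen m → Fin m → ℂ
  | .e i, j => if j = i then 1 else 0
  | .f i, j => if j = cpred i then 1 else 0
  | .k i, j => (q : ℂ) ^ (wt i j)
  | .kInv i, j => (q : ℂ) ^ (-wt i j)

/-- The index of the image of the `j`-th basis vector of `V` under a generator. -/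
def vIdx {m : ℕ} : UqGen m → Fin m → Fin m
  | .e i, _ => cpred i
  | .f i, _ => i
  | .k _, j => j
  | .kInv _, j => j

/-- The degree of a generator. -/
def vDeg {m : ℕ} : UqGen m → ℤ
  | .e i => deltaZero i
  | .f i => -deltaZero i
  | .k _ => 0
  | .kInv _ => 0

lemma vOp_bv (q : ℂˣ) {m : ℕ} (x : UqGen m) (p : Fin m × ℤ) :
    vOp q m x (bv p) = vCoeff q x p.1 • bv (vIdx x p.1, p.2 + vDeg x) := by
  cases x with
  | e i => rw [vOp_e]; simp only [vCoeff, vIdx, vDeg]; split_ifs <;> simp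
  | f i => rw [vOp_f]; simp only [vCoeff, vIdx, vDeg]; split_ifs <;> simp [sub_eq_add_neg]
  | k i => rw [vOp_k]; simp [vCoeff, vIdx, vDeg]
  | kInv i => rw [vOp_kInv]; simp [vCoeff, vIdx, vDeg]

lemma vOp_shift (q : ℂˣ) {m : ℕ} (x : UqGen m) (d : ℤ) :
    Commute (vOp q m x) (shift m d) := vhat_ext fun p => by
  simp only [Module.End.mul_apply, shift_bv, vOp_bv, map_smul]
  rw [add_right_comm]

variable {n m : ℕ} (q : ℂˣ)

lemma site_Xop (a b : Fin n) (x : UqGen m) (d : ℤ) :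
    Commute (site a (vOp q m x)) (Xop b d) := by
  by_cases h : a = b
  · subst h
    exact (vOp_shift q x d).map (site a)
  · exact site_comm h _ _

lemma site_put2_left (w : Fin n → Fin m × ℤ) {a b : Fin n} (hab : a ≠ b) (x : UqGen m)
    (p₁ p₂ : Fin m × ℤ) : site a (vOp q m x) (put2 w a b p₁ p₂) =
      vCoeff q x p₁.1 • put2 w a b (vIdx x p₁.1, p₁.2 + vDeg x) p₂ := by
  rw [put2, site_tv, vOp_bv, map_smul, put_bv, put2, Function.update_comm hab.symm]
  simp [hab]

lemma site_put2_right (w : Fin n → Fin m × ℤ) (a b : Fin n) (x : UqGen m)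
    (p₁ p₂ : Fin m × ℤ) : site b (vOp q m x) (put2 w a b p₁ p₂) =
      vCoeff q x p₂.1 • put2 w a b p₁ (vIdx x p₂.1, p₂.2 + vDeg x) := by
  rw [put2, site_tv, vOp_bv, map_smul, put_bv, put2]
  simp

lemma That_commute_of_degree_zero (i : ℕ) (h : i + 1 < n) (G : Module.End ℂ (TensV n m))
    (hG : ∀ b, Commute G (Xop b 1))
    (h0 : ∀ (w : Fin n → Fin m × ℤ) (j₁ j₂ : Fin m),
      That q i h (G (put2 w ⟨i, by omega⟩ ⟨i + 1, h⟩ (j₁, 0) (j₂, 0))) =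
        G (That q i h (put2 w ⟨i, by omega⟩ ⟨i + 1, h⟩ (j₁, 0) (j₂, 0)))) :
    Commute (That q i h) G := by
  change _ * _ = _ * _
  rw [← sub_eq_zero]
  refine eq_zero_of_intertwine _ (fun b => ?_) fun w hw => ?_
  · obtain ⟨b', κ, hb⟩ := That_Xop (m := m) q i h b
    refine ⟨b', ?_⟩
    have e1 : That q i h * G * Xop b 1 = (That q i h * Xop b 1) * G := by
      rw [mul_assoc, (hG b).eq, mul_assoc]
    have e2 : G * That q i h * Xop b 1 = Xop b' 1 * (G * That q i h)
        + κ • (Xop ⟨i + 1, h⟩ 1 * G) := by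
      rw [mul_assoc, hb, mul_add, mul_smul_comm, (hG _).eq, ← mul_assoc, (hG _).eq, mul_assoc]
    rw [sub_mul, e1, e2, hb, add_mul, smul_mul_assoc, mul_sub, mul_assoc]
    abel
  · obtain ⟨j₁, hj₁⟩ : ∃ j₁, w ⟨i, by omega⟩ = (j₁, 0) := ⟨_, Prod.ext rfl (hw _)⟩
    obtain ⟨j₂, hj₂⟩ : ∃ j₂, w ⟨i + 1, h⟩ = (j₂, 0) := ⟨_, Prod.ext rfl (hw _)⟩
    rw [← put2_self w ⟨i, by omega⟩ ⟨i + 1, h⟩, hj₁, hj₂, LinearMap.sub_apply,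
      Module.End.mul_apply, Module.End.mul_apply, h0, sub_self]

lemma cpred_cases (i : Fin m) : (deltaZero i = 0 ∧ (cpred i).val + 1 = i.val) ∨
    (deltaZero i = 1 ∧ i.val = 0 ∧ (cpred i).val + 1 = m) := by
  have h : finRotate m (cpred i) = i := Equiv.apply_symm_apply _ _
  rcases m with _ | m
  · exact i.elim0
  · generalize cpred i = s at *
    by_cases hs : s = Fin.last m
    · subst hs
      rw [finRotate_last] at h
      subst h
      right
      simp [deltaZero]
    · have hv := coe_finRotate_of_ne_last hs
      rw [h] at hv
      left
      refine ⟨?_, hv.symm⟩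
      unfold deltaZero
      rw [if_neg (by omega)]

/-- The coproduct on two adjacent factors commutes with `T̂_i`. -/
lemma That_conv (i : ℕ) (h : i + 1 < n) (x : UqGen m) :
    Commute (That q i h) (conv (fun y => site (⟨i, by omega⟩ : Fin n) (vOp q m y))
      (fun y => site (⟨i + 1, h⟩ : Fin n) (vOp q m y)) x) := by
  have hab : (⟨i, by omega⟩ : Fin n) ≠ ⟨i + 1, h⟩ := by simp
  refine That_commute_of_degree_zero q i h _ (fun b => ?_) fun w j₁ j₂ => ?_
  · have hc := fun (a : Fin n) y => site_Xop (m := m) q a b y 1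
    cases x <;> simp only [conv]
    · exact ((hc _ _).mul_left (hc _ _)).add_left (hc _ _)
    · exact (hc _ _).add_left ((hc _ _).mul_left (hc _ _))
    · exact (hc _ _).mul_left (hc _ _)
    · exact (hc _ _).mul_left (hc _ _)
  · have hL := fun y p₁ p₂ => site_put2_left q w hab y p₁ p₂
    have hR := fun y p₁ p₂ => site_put2_right q w ⟨i, by omega⟩ ⟨i + 1, h⟩ y p₁ p₂
    have hT := fun p₁ p₂ => That_put2 (m := m) q i h w p₁ p₂
    have q0 := q.ne_zero
    have hI₁ : Finset.Ico (0 : ℤ) 1 = {0} := by decide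
    have hI₂ : Finset.Ico (1 : ℤ) 0 = ∅ := by decide
    have hI₃ : Finset.Ico (-1 : ℤ) 0 = {-1} := by decide
    have hI₄ : Finset.Ico (0 : ℤ) (-1) = ∅ := by decide
    generalize put2 w ⟨i, by omega⟩ ⟨i + 1, h⟩ = C at *
    cases x with
    | e a =>
      obtain ⟨s, hs⟩ : ∃ s, s = cpred a := ⟨_, rfl⟩
      have hcase := cpred_cases a
      simp only [conv, LinearMap.add_apply, Module.End.mul_apply, hL, hR, map_smul, map_add, vDeg,
        vIdx, vCoeff, hT, wt, zero_add, ← hs] at hcase ⊢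
      rcases hcase with ⟨hd, hsa⟩ | ⟨hd, ha, hsm⟩
      · have hne : s ≠ a := by rintro rfl; omega
        have hlt : s < a := by omega
        rw [hd]
        simp only [neg_zero, add_zero, twoSite_zero]
        have other : ∀ j : Fin m, j = a ∨ j = s ∨ (j < s ∧ j < a) ∨ (s < j ∧ a < j) := by
          intro j; omega
        rcases other j₁ with k1 | k1 | ⟨k1, k2⟩ | ⟨k1, k2⟩ <;>
          rcases other j₂ with k3 | k3 | ⟨k3, k4⟩ | ⟨k3, k4⟩
        · rw [k1]
          rw [k3]
          simp [hL, hR, vDeg, vIdx, vCoeff, wt, ← hs, hd, hne, hne.symm, hlt, hlt.not_gt]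
          match_scalars <;> (try simp) <;> (try field_simp) <;> (try ring)
        · rw [k1]
          rw [k3]
          simp [hL, hR, vDeg, vIdx, vCoeff, wt, ← hs, hd, hne, hne.symm, hlt, hlt.not_gt]
          match_scalars <;> (try simp) <;> (try field_simp) <;> (try ring)
        · rw [k1]
          simp [hL, hR, vDeg, vIdx, vCoeff, wt, ← hs, hd, hne, hne.symm, hlt, hlt.not_gt, k3, k3.ne, k3.ne', k3.not_gt, k4, k4.ne, k4.ne', k4.not_gt]
          match_scalars <;> (try simp) <;> (try field_simp) <;> (try ring)
        · rw [k1]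
          simp [hL, hR, vDeg, vIdx, vCoeff, wt, ← hs, hd, hne, hne.symm, hlt, hlt.not_gt, k3, k3.ne, k3.ne', k3.not_gt, k4, k4.ne, k4.ne', k4.not_gt]
        · rw [k1]
          rw [k3]
          simp [hL, hR, vDeg, vIdx, vCoeff, wt, ← hs, hd, hne, hne.symm, hlt, hlt.not_gt]
        · rw [k1]
          rw [k3]
          simp [hL, hR, vDeg, vIdx, vCoeff, wt, ← hs, hd, hne, hne.symm, hlt, hlt.not_gt]
        · rw [k1]
          simp [hL, hR, vDeg, vIdx, vCoeff, wt, ← hs, hd, hne, hne.symm, hlt, hlt.not_gt, k3, k3.ne, k3.ne', k3.not_gt, k4, k4.ne, k4.ne', k4.not_gt]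
        · rw [k1]
          simp [hL, hR, vDeg, vIdx, vCoeff, wt, ← hs, hd, hne, hne.symm, hlt, hlt.not_gt, k3, k3.ne, k3.ne', k3.not_gt, k4, k4.ne, k4.ne', k4.not_gt]
        · rw [k3]
          simp [hL, hR, vDeg, vIdx, vCoeff, wt, ← hs, hd, hne, hne.symm, hlt, hlt.not_gt, k1, k1.ne, k1.ne', k1.not_gt, k2, k2.ne, k2.ne', k2.not_gt]
        · rw [k3]
          simp [hL, hR, vDeg, vIdx, vCoeff, wt, ← hs, hd, hne, hne.symm, hlt, hlt.not_gt, k1, k1.ne, k1.ne', k1.not_gt, k2, k2.ne, k2.ne', k2.not_gt]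
        · rcases lt_trichotomy j₁ j₂ with k5 | k5 | k5
          · simp [hL, hR, vDeg, vIdx, vCoeff, wt, ← hs, hd, hne, hne.symm, hlt, hlt.not_gt, k1, k1.ne, k1.ne', k1.not_gt, k2, k2.ne, k2.ne', k2.not_gt, k3, k3.ne, k3.ne', k3.not_gt, k4, k4.ne, k4.ne', k4.not_gt, k5, k5.ne, k5.ne', k5.not_gt]
          · simp [hL, hR, vDeg, vIdx, vCoeff, wt, ← hs, hd, hne, hne.symm, hlt, hlt.not_gt, k1, k1.ne, k1.ne', k1.not_gt, k2, k2.ne, k2.ne', k2.not_gt, k3, k3.ne, k3.ne', k3.not_gt, k4, k4.ne, k4.ne', k4.not_gt, k5]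
          · simp [hL, hR, vDeg, vIdx, vCoeff, wt, ← hs, hd, hne, hne.symm, hlt, hlt.not_gt, k1, k1.ne, k1.ne', k1.not_gt, k2, k2.ne, k2.ne', k2.not_gt, k3, k3.ne, k3.ne', k3.not_gt, k4, k4.ne, k4.ne', k4.not_gt, k5, k5.ne, k5.ne', k5.not_gt]
        · rcases lt_trichotomy j₁ j₂ with k5 | k5 | k5
          · simp [hL, hR, vDeg, vIdx, vCoeff, wt, ← hs, hd, hne, hne.symm, hlt, hlt.not_gt, k1, k1.ne, k1.ne', k1.not_gt, k2, k2.ne, k2.ne', k2.not_gt, k3, k3.ne, k3.ne', k3.not_gt, k4, k4.ne, k4.ne', k4.not_gt, k5, k5.ne, k5.ne', k5.not_gt]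
          · simp [hL, hR, vDeg, vIdx, vCoeff, wt, ← hs, hd, hne, hne.symm, hlt, hlt.not_gt, k1, k1.ne, k1.ne', k1.not_gt, k2, k2.ne, k2.ne', k2.not_gt, k3, k3.ne, k3.ne', k3.not_gt, k4, k4.ne, k4.ne', k4.not_gt, k5]
          · simp [hL, hR, vDeg, vIdx, vCoeff, wt, ← hs, hd, hne, hne.symm, hlt, hlt.not_gt, k1, k1.ne, k1.ne', k1.not_gt, k2, k2.ne, k2.ne', k2.not_gt, k3, k3.ne, k3.ne', k3.not_gt, k4, k4.ne, k4.ne', k4.not_gt, k5, k5.ne, k5.ne', k5.not_gt]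
        · rw [k3]
          simp [hL, hR, vDeg, vIdx, vCoeff, wt, ← hs, hd, hne, hne.symm, hlt, hlt.not_gt, k1, k1.ne, k1.ne', k1.not_gt, k2, k2.ne, k2.ne', k2.not_gt]
        · rw [k3]
          simp [hL, hR, vDeg, vIdx, vCoeff, wt, ← hs, hd, hne, hne.symm, hlt, hlt.not_gt, k1, k1.ne, k1.ne', k1.not_gt, k2, k2.ne, k2.ne', k2.not_gt]
        · rcases lt_trichotomy j₁ j₂ with k5 | k5 | k5
          · simp [hL, hR, vDeg, vIdx, vCoeff, wt, ← hs, hd, hne, hne.symm, hlt, hlt.not_gt, k1, k1.ne, k1.ne', k1.not_gt, k2, k2.ne, k2.ne', k2.not_gt, k3, k3.ne, k3.ne', k3.not_gt, k4, k4.ne, k4.ne', k4.not_gt, k5, k5.ne, k5.ne', k5.not_gt]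
          · simp [hL, hR, vDeg, vIdx, vCoeff, wt, ← hs, hd, hne, hne.symm, hlt, hlt.not_gt, k1, k1.ne, k1.ne', k1.not_gt, k2, k2.ne, k2.ne', k2.not_gt, k3, k3.ne, k3.ne', k3.not_gt, k4, k4.ne, k4.ne', k4.not_gt, k5]
          · simp [hL, hR, vDeg, vIdx, vCoeff, wt, ← hs, hd, hne, hne.symm, hlt, hlt.not_gt, k1, k1.ne, k1.ne', k1.not_gt, k2, k2.ne, k2.ne', k2.not_gt, k3, k3.ne, k3.ne', k3.not_gt, k4, k4.ne, k4.ne', k4.not_gt, k5, k5.ne, k5.ne', k5.not_gt]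
        · rcases lt_trichotomy j₁ j₂ with k5 | k5 | k5
          · simp [hL, hR, vDeg, vIdx, vCoeff, wt, ← hs, hd, hne, hne.symm, hlt, hlt.not_gt, k1, k1.ne, k1.ne', k1.not_gt, k2, k2.ne, k2.ne', k2.not_gt, k3, k3.ne, k3.ne', k3.not_gt, k4, k4.ne, k4.ne', k4.not_gt, k5, k5.ne, k5.ne', k5.not_gt]
          · simp [hL, hR, vDeg, vIdx, vCoeff, wt, ← hs, hd, hne, hne.symm, hlt, hlt.not_gt, k1, k1.ne, k1.ne', k1.not_gt, k2, k2.ne, k2.ne', k2.not_gt, k3, k3.ne, k3.ne', k3.not_gt, k4, k4.ne, k4.ne', k4.not_gt, k5]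
          · simp [hL, hR, vDeg, vIdx, vCoeff, wt, ← hs, hd, hne, hne.symm, hlt, hlt.not_gt, k1, k1.ne, k1.ne', k1.not_gt, k2, k2.ne, k2.ne', k2.not_gt, k3, k3.ne, k3.ne', k3.not_gt, k4, k4.ne, k4.ne', k4.not_gt, k5, k5.ne, k5.ne', k5.not_gt]
      · rcases Nat.lt_or_ge 1 m with hm | hm
        · have hne : s ≠ a := by rintro rfl; omega
          have hlt : a < s := by omega
          rw [hd]
          simp only [twoSite_zero]
          have other : ∀ j : Fin m, j = a ∨ j = s ∨ (j < s ∧ a < j) := by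
            intro j; omega
          rcases other j₁ with k1 | k1 | ⟨k1, k2⟩ <;> rcases other j₂ with k3 | k3 | ⟨k3, k4⟩
          · rw [k1]
            rw [k3]
            simp [hL, hR, vDeg, vIdx, vCoeff, wt, ← hs, hd, twoSite, hI₁, hI₂, hI₃, hI₄, hne, hne.symm, hlt, hlt.not_gt]
            match_scalars <;> (try simp) <;> (try field_simp) <;> (try ring)
          · rw [k1]
            rw [k3]
            simp [hL, hR, vDeg, vIdx, vCoeff, wt, ← hs, hd, twoSite, hI₁, hI₂, hI₃, hI₄, hne, hne.symm, hlt, hlt.not_gt]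
            match_scalars <;> (try simp) <;> (try field_simp) <;> (try ring)
          · rw [k1]
            simp [hL, hR, vDeg, vIdx, vCoeff, wt, ← hs, hd, twoSite, hI₁, hI₂, hI₃, hI₄, hne, hne.symm, hlt, hlt.not_gt, k3, k3.ne, k3.ne', k3.not_gt, k4, k4.ne, k4.ne', k4.not_gt]
          · rw [k1]
            rw [k3]
            simp [hL, hR, vDeg, vIdx, vCoeff, wt, ← hs, hd, twoSite, hI₁, hI₂, hI₃, hI₄, hne, hne.symm, hlt, hlt.not_gt]
          · rw [k1]
            rw [k3]
            simp [hL, hR, vDeg, vIdx, vCoeff, wt, ← hs, hd, twoSite, hI₁, hI₂, hI₃, hI₄, hne, hne.symm, hlt, hlt.not_gt]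
          · rw [k1]
            simp [hL, hR, vDeg, vIdx, vCoeff, wt, ← hs, hd, twoSite, hI₁, hI₂, hI₃, hI₄, hne, hne.symm, hlt, hlt.not_gt, k3, k3.ne, k3.ne', k3.not_gt, k4, k4.ne, k4.ne', k4.not_gt]
          · rw [k3]
            simp [hL, hR, vDeg, vIdx, vCoeff, wt, ← hs, hd, twoSite, hI₁, hI₂, hI₃, hI₄, hne, hne.symm, hlt, hlt.not_gt, k1, k1.ne, k1.ne', k1.not_gt, k2, k2.ne, k2.ne', k2.not_gt]
          · rw [k3]
            simp [hL, hR, vDeg, vIdx, vCoeff, wt, ← hs, hd, twoSite, hI₁, hI₂, hI₃, hI₄, hne, hne.symm, hlt, hlt.not_gt, k1, k1.ne, k1.ne', k1.not_gt, k2, k2.ne, k2.ne', k2.not_gt]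
          · rcases lt_trichotomy j₁ j₂ with k5 | k5 | k5
            · simp [hL, hR, vDeg, vIdx, vCoeff, wt, ← hs, hd, twoSite, hI₁, hI₂, hI₃, hI₄, hne, hne.symm, hlt, hlt.not_gt, k1, k1.ne, k1.ne', k1.not_gt, k2, k2.ne, k2.ne', k2.not_gt, k3, k3.ne, k3.ne', k3.not_gt, k4, k4.ne, k4.ne', k4.not_gt, k5, k5.ne, k5.ne', k5.not_gt]
            · simp [hL, hR, vDeg, vIdx, vCoeff, wt, ← hs, hd, twoSite, hI₁, hI₂, hI₃, hI₄, hne, hne.symm, hlt, hlt.not_gt, k1, k1.ne, k1.ne', k1.not_gt, k2, k2.ne, k2.ne', k2.not_gt, k3, k3.ne, k3.ne', k3.not_gt, k4, k4.ne, k4.ne', k4.not_gt, k5]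
            · simp [hL, hR, vDeg, vIdx, vCoeff, wt, ← hs, hd, twoSite, hI₁, hI₂, hI₃, hI₄, hne, hne.symm, hlt, hlt.not_gt, k1, k1.ne, k1.ne', k1.not_gt, k2, k2.ne, k2.ne', k2.not_gt, k3, k3.ne, k3.ne', k3.not_gt, k4, k4.ne, k4.ne', k4.not_gt, k5, k5.ne, k5.ne', k5.not_gt]
        · obtain rfl : j₁ = a := by omega
          obtain rfl : j₂ = j₁ := by omega
          obtain rfl : s = j₂ := by omega
          rw [hd]
          simp [hL, hR, vDeg, vIdx, vCoeff, wt, ← hs, hd, twoSite, hI₁, hI₂, hI₃, hI₄]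
          match_scalars <;> (try simp) <;> (try field_simp) <;> (try ring)
    | f a =>
      obtain ⟨s, hs⟩ : ∃ s, s = cpred a := ⟨_, rfl⟩
      have hcase := cpred_cases a
      simp only [conv, LinearMap.add_apply, Module.End.mul_apply, hL, hR, map_smul, map_add, vDeg,
        vIdx, vCoeff, hT, wt, zero_add, ← hs] at hcase ⊢
      rcases hcase with ⟨hd, hsa⟩ | ⟨hd, ha, hsm⟩
      · have hne : s ≠ a := by rintro rfl; omega
        have hlt : s < a := by omega
        rw [hd]
        simp only [neg_zero, add_zero, twoSite_zero]
        have other : ∀ j : Fin m, j = s ∨ j = a ∨ (j < s ∧ j < a) ∨ (s < j ∧ a < j) := by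
          intro j; omega
        rcases other j₁ with k1 | k1 | ⟨k1, k2⟩ | ⟨k1, k2⟩ <;>
          rcases other j₂ with k3 | k3 | ⟨k3, k4⟩ | ⟨k3, k4⟩
        · rw [k1]
          rw [k3]
          simp [hL, hR, vDeg, vIdx, vCoeff, wt, ← hs, hd, hne, hne.symm, hlt, hlt.not_gt]
          match_scalars <;> (try simp) <;> (try field_simp) <;> (try ring)
        · rw [k1]
          rw [k3]
          simp [hL, hR, vDeg, vIdx, vCoeff, wt, ← hs, hd, hne, hne.symm, hlt, hlt.not_gt]
        · rw [k1]
          simp [hL, hR, vDeg, vIdx, vCoeff, wt, ← hs, hd, hne, hne.symm, hlt, hlt.not_gt, k3, k3.ne, k3.ne', k3.not_gt, k4, k4.ne, k4.ne', k4.not_gt]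
          match_scalars <;> (try simp) <;> (try field_simp) <;> (try ring)
        · rw [k1]
          simp [hL, hR, vDeg, vIdx, vCoeff, wt, ← hs, hd, hne, hne.symm, hlt, hlt.not_gt, k3, k3.ne, k3.ne', k3.not_gt, k4, k4.ne, k4.ne', k4.not_gt]
        · rw [k1]
          rw [k3]
          simp [hL, hR, vDeg, vIdx, vCoeff, wt, ← hs, hd, hne, hne.symm, hlt, hlt.not_gt]
          match_scalars <;> (try simp) <;> (try field_simp) <;> (try ring)
        · rw [k1]
          rw [k3]
          simp [hL, hR, vDeg, vIdx, vCoeff, wt, ← hs, hd, hne, hne.symm, hlt, hlt.not_gt]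
        · rw [k1]
          simp [hL, hR, vDeg, vIdx, vCoeff, wt, ← hs, hd, hne, hne.symm, hlt, hlt.not_gt, k3, k3.ne, k3.ne', k3.not_gt, k4, k4.ne, k4.ne', k4.not_gt]
        · rw [k1]
          simp [hL, hR, vDeg, vIdx, vCoeff, wt, ← hs, hd, hne, hne.symm, hlt, hlt.not_gt, k3, k3.ne, k3.ne', k3.not_gt, k4, k4.ne, k4.ne', k4.not_gt]
        · rw [k3]
          simp [hL, hR, vDeg, vIdx, vCoeff, wt, ← hs, hd, hne, hne.symm, hlt, hlt.not_gt, k1, k1.ne, k1.ne', k1.not_gt, k2, k2.ne, k2.ne', k2.not_gt]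
        · rw [k3]
          simp [hL, hR, vDeg, vIdx, vCoeff, wt, ← hs, hd, hne, hne.symm, hlt, hlt.not_gt, k1, k1.ne, k1.ne', k1.not_gt, k2, k2.ne, k2.ne', k2.not_gt]
        · rcases lt_trichotomy j₁ j₂ with k5 | k5 | k5
          · simp [hL, hR, vDeg, vIdx, vCoeff, wt, ← hs, hd, hne, hne.symm, hlt, hlt.not_gt, k1, k1.ne, k1.ne', k1.not_gt, k2, k2.ne, k2.ne', k2.not_gt, k3, k3.ne, k3.ne', k3.not_gt, k4, k4.ne, k4.ne', k4.not_gt, k5, k5.ne, k5.ne', k5.not_gt]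
          · simp [hL, hR, vDeg, vIdx, vCoeff, wt, ← hs, hd, hne, hne.symm, hlt, hlt.not_gt, k1, k1.ne, k1.ne', k1.not_gt, k2, k2.ne, k2.ne', k2.not_gt, k3, k3.ne, k3.ne', k3.not_gt, k4, k4.ne, k4.ne', k4.not_gt, k5]
          · simp [hL, hR, vDeg, vIdx, vCoeff, wt, ← hs, hd, hne, hne.symm, hlt, hlt.not_gt, k1, k1.ne, k1.ne', k1.not_gt, k2, k2.ne, k2.ne', k2.not_gt, k3, k3.ne, k3.ne', k3.not_gt, k4, k4.ne, k4.ne', k4.not_gt, k5, k5.ne, k5.ne', k5.not_gt]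
        · rcases lt_trichotomy j₁ j₂ with k5 | k5 | k5
          · simp [hL, hR, vDeg, vIdx, vCoeff, wt, ← hs, hd, hne, hne.symm, hlt, hlt.not_gt, k1, k1.ne, k1.ne', k1.not_gt, k2, k2.ne, k2.ne', k2.not_gt, k3, k3.ne, k3.ne', k3.not_gt, k4, k4.ne, k4.ne', k4.not_gt, k5, k5.ne, k5.ne', k5.not_gt]
          · simp [hL, hR, vDeg, vIdx, vCoeff, wt, ← hs, hd, hne, hne.symm, hlt, hlt.not_gt, k1, k1.ne, k1.ne', k1.not_gt, k2, k2.ne, k2.ne', k2.not_gt, k3, k3.ne, k3.ne', k3.not_gt, k4, k4.ne, k4.ne', k4.not_gt, k5]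
          · simp [hL, hR, vDeg, vIdx, vCoeff, wt, ← hs, hd, hne, hne.symm, hlt, hlt.not_gt, k1, k1.ne, k1.ne', k1.not_gt, k2, k2.ne, k2.ne', k2.not_gt, k3, k3.ne, k3.ne', k3.not_gt, k4, k4.ne, k4.ne', k4.not_gt, k5, k5.ne, k5.ne', k5.not_gt]
        · rw [k3]
          simp [hL, hR, vDeg, vIdx, vCoeff, wt, ← hs, hd, hne, hne.symm, hlt, hlt.not_gt, k1, k1.ne, k1.ne', k1.not_gt, k2, k2.ne, k2.ne', k2.not_gt]
        · rw [k3]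
          simp [hL, hR, vDeg, vIdx, vCoeff, wt, ← hs, hd, hne, hne.symm, hlt, hlt.not_gt, k1, k1.ne, k1.ne', k1.not_gt, k2, k2.ne, k2.ne', k2.not_gt]
        · rcases lt_trichotomy j₁ j₂ with k5 | k5 | k5
          · simp [hL, hR, vDeg, vIdx, vCoeff, wt, ← hs, hd, hne, hne.symm, hlt, hlt.not_gt, k1, k1.ne, k1.ne', k1.not_gt, k2, k2.ne, k2.ne', k2.not_gt, k3, k3.ne, k3.ne', k3.not_gt, k4, k4.ne, k4.ne', k4.not_gt, k5, k5.ne, k5.ne', k5.not_gt]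
          · simp [hL, hR, vDeg, vIdx, vCoeff, wt, ← hs, hd, hne, hne.symm, hlt, hlt.not_gt, k1, k1.ne, k1.ne', k1.not_gt, k2, k2.ne, k2.ne', k2.not_gt, k3, k3.ne, k3.ne', k3.not_gt, k4, k4.ne, k4.ne', k4.not_gt, k5]
          · simp [hL, hR, vDeg, vIdx, vCoeff, wt, ← hs, hd, hne, hne.symm, hlt, hlt.not_gt, k1, k1.ne, k1.ne', k1.not_gt, k2, k2.ne, k2.ne', k2.not_gt, k3, k3.ne, k3.ne', k3.not_gt, k4, k4.ne, k4.ne', k4.not_gt, k5, k5.ne, k5.ne', k5.not_gt]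
        · rcases lt_trichotomy j₁ j₂ with k5 | k5 | k5
          · simp [hL, hR, vDeg, vIdx, vCoeff, wt, ← hs, hd, hne, hne.symm, hlt, hlt.not_gt, k1, k1.ne, k1.ne', k1.not_gt, k2, k2.ne, k2.ne', k2.not_gt, k3, k3.ne, k3.ne', k3.not_gt, k4, k4.ne, k4.ne', k4.not_gt, k5, k5.ne, k5.ne', k5.not_gt]
          · simp [hL, hR, vDeg, vIdx, vCoeff, wt, ← hs, hd, hne, hne.symm, hlt, hlt.not_gt, k1, k1.ne, k1.ne', k1.not_gt, k2, k2.ne, k2.ne', k2.not_gt, k3, k3.ne, k3.ne', k3.not_gt, k4, k4.ne, k4.ne', k4.not_gt, k5]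
          · simp [hL, hR, vDeg, vIdx, vCoeff, wt, ← hs, hd, hne, hne.symm, hlt, hlt.not_gt, k1, k1.ne, k1.ne', k1.not_gt, k2, k2.ne, k2.ne', k2.not_gt, k3, k3.ne, k3.ne', k3.not_gt, k4, k4.ne, k4.ne', k4.not_gt, k5, k5.ne, k5.ne', k5.not_gt]
      · rcases Nat.lt_or_ge 1 m with hm | hm
        · have hne : s ≠ a := by rintro rfl; omega
          have hlt : a < s := by omega
          rw [hd]
          simp only [twoSite_zero]
          have other : ∀ j : Fin m, j = s ∨ j = a ∨ (j < s ∧ a < j) := by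
            intro j; omega
          rcases other j₁ with k1 | k1 | ⟨k1, k2⟩ <;> rcases other j₂ with k3 | k3 | ⟨k3, k4⟩
          · rw [k1]
            rw [k3]
            simp [hL, hR, vDeg, vIdx, vCoeff, wt, ← hs, hd, twoSite, hI₁, hI₂, hI₃, hI₄, hne, hne.symm, hlt, hlt.not_gt]
            match_scalars <;> (try simp) <;> (try field_simp) <;> (try ring)
          · rw [k1]
            rw [k3]
            simp [hL, hR, vDeg, vIdx, vCoeff, wt, ← hs, hd, twoSite, hI₁, hI₂, hI₃, hI₄, hne, hne.symm, hlt, hlt.not_gt]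
            match_scalars <;> (try simp) <;> (try field_simp) <;> (try ring)
          · rw [k1]
            simp [hL, hR, vDeg, vIdx, vCoeff, wt, ← hs, hd, twoSite, hI₁, hI₂, hI₃, hI₄, hne, hne.symm, hlt, hlt.not_gt, k3, k3.ne, k3.ne', k3.not_gt, k4, k4.ne, k4.ne', k4.not_gt]
            match_scalars <;> (try simp) <;> (try field_simp) <;> (try ring)
          · rw [k1]
            rw [k3]
            simp [hL, hR, vDeg, vIdx, vCoeff, wt, ← hs, hd, twoSite, hI₁, hI₂, hI₃, hI₄, hne, hne.symm, hlt, hlt.not_gt]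
            match_scalars <;> (try simp) <;> (try field_simp) <;> (try ring)
          · rw [k1]
            rw [k3]
            simp [hL, hR, vDeg, vIdx, vCoeff, wt, ← hs, hd, twoSite, hI₁, hI₂, hI₃, hI₄, hne, hne.symm, hlt, hlt.not_gt]
          · rw [k1]
            simp [hL, hR, vDeg, vIdx, vCoeff, wt, ← hs, hd, twoSite, hI₁, hI₂, hI₃, hI₄, hne, hne.symm, hlt, hlt.not_gt, k3, k3.ne, k3.ne', k3.not_gt, k4, k4.ne, k4.ne', k4.not_gt]
          · rw [k3]
            simp [hL, hR, vDeg, vIdx, vCoeff, wt, ← hs, hd, twoSite, hI₁, hI₂, hI₃, hI₄, hne, hne.symm, hlt, hlt.not_gt, k1, k1.ne, k1.ne', k1.not_gt, k2, k2.ne, k2.ne', k2.not_gt]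
          · rw [k3]
            simp [hL, hR, vDeg, vIdx, vCoeff, wt, ← hs, hd, twoSite, hI₁, hI₂, hI₃, hI₄, hne, hne.symm, hlt, hlt.not_gt, k1, k1.ne, k1.ne', k1.not_gt, k2, k2.ne, k2.ne', k2.not_gt]
          · rcases lt_trichotomy j₁ j₂ with k5 | k5 | k5
            · simp [hL, hR, vDeg, vIdx, vCoeff, wt, ← hs, hd, twoSite, hI₁, hI₂, hI₃, hI₄, hne, hne.symm, hlt, hlt.not_gt, k1, k1.ne, k1.ne', k1.not_gt, k2, k2.ne, k2.ne', k2.not_gt, k3, k3.ne, k3.ne', k3.not_gt, k4, k4.ne, k4.ne', k4.not_gt, k5, k5.ne, k5.ne', k5.not_gt]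
            · simp [hL, hR, vDeg, vIdx, vCoeff, wt, ← hs, hd, twoSite, hI₁, hI₂, hI₃, hI₄, hne, hne.symm, hlt, hlt.not_gt, k1, k1.ne, k1.ne', k1.not_gt, k2, k2.ne, k2.ne', k2.not_gt, k3, k3.ne, k3.ne', k3.not_gt, k4, k4.ne, k4.ne', k4.not_gt, k5]
            · simp [hL, hR, vDeg, vIdx, vCoeff, wt, ← hs, hd, twoSite, hI₁, hI₂, hI₃, hI₄, hne, hne.symm, hlt, hlt.not_gt, k1, k1.ne, k1.ne', k1.not_gt, k2, k2.ne, k2.ne', k2.not_gt, k3, k3.ne, k3.ne', k3.not_gt, k4, k4.ne, k4.ne', k4.not_gt, k5, k5.ne, k5.ne', k5.not_gt]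
        · obtain rfl : j₁ = a := by omega
          obtain rfl : j₂ = j₁ := by omega
          obtain rfl : s = j₂ := by omega
          rw [hd]
          simp [hL, hR, vDeg, vIdx, vCoeff, wt, ← hs, hd, twoSite, hI₁, hI₂, hI₃, hI₄]
          match_scalars <;> (try simp) <;> (try field_simp) <;> (try ring)
    | k a =>
      simp only [conv, Module.End.mul_apply, hL, hR, map_smul, vDeg, vIdx, vCoeff, hT,
        twoSite_zero, add_zero]
      rcases lt_trichotomy j₁ j₂ with h1 | h1 | h1 
      · simp [h1.ne, h1.ne', h1, h1.not_gt, hL, hR, vDeg, vIdx, vCoeff]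
        rw [smul_comm]
      · subst h1
        simp [hL, hR, vDeg, vIdx, vCoeff]
        module
      · simp [h1.ne, h1.ne', h1, h1.not_gt, hL, hR, vDeg, vIdx, vCoeff]
        module
    | kInv a =>
      simp only [conv, Module.End.mul_apply, hL, hR, map_smul, vDeg, vIdx, vCoeff, hT,
        twoSite_zero, add_zero]
      rcases lt_trichotomy j₁ j₂ with h1 | h1 | h1 
      · simp [h1.ne, h1.ne', h1, h1.not_gt, hL, hR, vDeg, vIdx, vCoeff]
        rw [smul_comm]
      · subst h1
        simp [hL, hR, vDeg, vIdx, vCoeff]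
        module
      · simp [h1.ne, h1.ne', h1, h1.not_gt, hL, hR, vDeg, vIdx, vCoeff]
        module

end UqCommutation

section Actions
variable {n m : ℕ} (q : ℂˣ)

lemma siteRep_gen (a : Fin n) (x : UqGen m) :
    siteRep q m a (Uq.gen q m x) = site a (vOp q m x) := by
  change site a (vRep q m (Uq.gen q m x)) = _
  rw [vRep, Uq.lift_gen]

lemma tensRepAux_succ (p : ℕ) (hp : p < n) (x : UqGen m) :
    (tensRepAux q n m (p + 1)).1 (Uq.gen q m x) =
      conv (fun y => (tensRepAux q n m p).1 (Uq.gen q m y))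
        (fun y => site ⟨p, hp⟩ (vOp q m y)) x := by
  rw [tensRepAux, dif_pos hp]
  refine (Uq.convHom_gen (tensRepAux q n m p).1 (siteRep q m ⟨p, hp⟩) _ x).trans ?_
  simp only [siteRep_gen]

lemma commute_conv {A : Type*} [Ring A] (b : A) (φ ψ : UqGen m → A) (h1 : ∀ x, Commute b (φ x))
    (h2 : ∀ x, Commute b (ψ x)) (x : UqGen m) : Commute b (conv φ ψ x) := by
  cases x <;> simp only [conv]
  · exact ((h1 _).mul_right (h2 _)).add_right (h2 _)
  · exact (h1 _).add_right ((h1 _).mul_right (h2 _))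
  · exact (h1 _).mul_right (h2 _)
  · exact (h1 _).mul_right (h2 _)

lemma conv_assoc {A : Type*} [Ring A] (φ ψ χ : UqGen m → A) (x : UqGen m) :
    conv (conv φ ψ) χ x = conv φ (conv ψ χ) x := by
  cases x <;> simp only [conv, add_mul, mul_add, mul_assoc, add_assoc]

lemma commute_conv_assoc {A : Type*} [Ring A] (b : A) (φ ψ χ θ : UqGen m → A)
    (hθ : ∀ x, θ x = conv φ ψ x) (h1 : ∀ x, Commute b (φ x))
    (h2 : ∀ x, Commute b (conv ψ χ x)) (x : UqGen m) : Commute b (conv θ χ x) := by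
  rw [show θ = conv φ ψ from funext hθ, conv_assoc]
  exact commute_conv b _ _ h1 h2 x

lemma Xop_tensRepAux (b : Fin n) (d : ℤ) (p : ℕ) (u : Uq q m) :
    Commute (Xop b d) ((tensRepAux q n m p).1 u) := by
  induction p generalizing u with
  | zero => exact trivRep_commute q n m u _
  | succ p ih =>
    by_cases hp : p < n
    · refine Uq.commute_of_gen _ _ (fun x => ?_) u
      rw [tensRepAux_succ q p hp]
      exact commute_conv _ _ _ (fun y => ih _) (fun y => (site_Xop q _ b y d).symm) x
    · rw [tensRepAux, dif_neg hp]
      exact ih u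

lemma That_tensRepAux (i : ℕ) (h : i + 1 < n) (p : ℕ) (hp : p ≤ i ∨ i + 2 ≤ p) (u : Uq q m) :
    Commute (That q i h) ((tensRepAux q n m p).1 u) := by
  have low : ∀ p, p ≤ i → ∀ u : Uq q m, Commute (That q i h) ((tensRepAux q n m p).1 u) := by
    intro p
    induction p with
    | zero => exact fun _ u => trivRep_commute q n m u _
    | succ p ih =>
      intro hp u
      refine Uq.commute_of_gen _ _ (fun x => ?_) u
      rw [tensRepAux_succ q p (by omega)]
      exact commute_conv _ _ _ (fun y => ih (by omega) _)
        (fun y => That_site q i h ⟨p, by omega⟩ (by simp; omega) (by simp; omega) _) x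
  rcases hp with hp | hp
  · exact low p hp u
  · induction p, hp using Nat.le_induction generalizing u with
    | base =>
      refine Uq.commute_of_gen _ _ (fun x => ?_) u
      rw [tensRepAux_succ q (i + 1) h]
      exact commute_conv_assoc (That q i h) (fun y => (tensRepAux q n m i).1 (Uq.gen q m y))
        (fun y => site ⟨i, by omega⟩ (vOp q m y)) (fun y => site ⟨i + 1, h⟩ (vOp q m y)) _
        (fun y => tensRepAux_succ q i (by omega) y) (fun y => low i le_rfl _)
        (fun y => That_conv q i h y) x
    | succ p hp ih =>
      by_cases hpn : p < n
      · refine Uq.commute_of_gen _ _ (fun x => ?_) u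
        rw [tensRepAux_succ q p hpn]
        exact commute_conv _ _ _ (fun y => ih _)
          (fun y => That_site q i h ⟨p, hpn⟩ (by simp; omega) (by simp; omega) _) x
      · rw [tensRepAux, dif_neg hpn]
        exact ih u

/-- The operators giving the right action of the generators of `Ĥ_n` on `V̂^{⊗n}`. -/
def affRightGen (n m : ℕ) (q : ℂˣ) : AffGen n → (Module.End ℂ (TensV n m))ᵐᵒᵖ
  | .T i h => MulOpposite.op (That q i h)
  | .X j => MulOpposite.op (Xop j 1)
  | .XInv j => MulOpposite.op (Xop j (-1))

lemma affRightGen_system (n m : ℕ) (q : ℂˣ) : AffSystem n q (affRightGen n m q) where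
  quad i h := MulOpposite.unop_injective (That_quad q i h)
  braid i h h' := MulOpposite.unop_injective (by
    change That q i h * (That q (i + 1) h' * That q i h) =
      That q (i + 1) h' * (That q i h * That q (i + 1) h')
    rw [← mul_assoc, ← mul_assoc]
    exact That_braid q i h h')
  far i j hi hj hij := MulOpposite.unop_injective (That_far q i j hi hj hij).eq.symm
  X_XInv j := MulOpposite.unop_injective (by
    change Xop j (-1) * Xop j 1 = 1
    rw [Xop_mul, neg_add_cancel, Xop_zero])
  XInv_X j := MulOpposite.unop_injective (by
    change Xop j 1 * Xop j (-1) = 1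
    rw [Xop_mul, add_neg_cancel, Xop_zero])
  X_X j k := MulOpposite.unop_injective (Xop_comm k j 1 1).eq
  T_X_T i h := MulOpposite.unop_injective (by
    change That q i h * (Xop _ 1 * That q i h) = Xop _ 1
    rw [← mul_assoc, That_Xop_left, sub_mul, mul_assoc, That_quad, mul_add, mul_smul_comm,
      smul_mul_assoc, mul_one]
    abel)
  T_X i h j h1 h2 := MulOpposite.unop_injective (That_site q i h j h1 h2 _).eq.symm

/-- The right action of `Ĥ_n` on `V̂^{⊗n}`: `T_i` acts by `T̂_i`, and `X_j^±` by multiplication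
by `x_j^±`. -/
def affRight (n m : ℕ) (q : ℂˣ) : AffHecke n q →ₐ[ℂ] (Module.End ℂ (TensV n m))ᵐᵒᵖ :=
  AffHecke.lift _ (affRightGen_system n m q)

/-- The left action of `U_q(ŝl_m)` and the right action of `Ĥ_n` on `V̂^{⊗n}` commute. -/
lemma tensRep_affRight (u : Uq q m) (a : AffHecke n q) :
    Commute (affRight n m q a) (MulOpposite.op (tensRep q n m u)) := by
  refine (AffHecke.commute_of_gen _ _ (fun x => ?_) a).symm
  rw [affRight, AffHecke.lift_gen]
  cases x with
  | T i h => exact (That_tensRepAux q i h n (Or.inr h) u).op.symm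
  | X j => exact (Xop_tensRepAux q j 1 n u).op.symm
  | XInv j => exact (Xop_tensRepAux q j (-1) n u).op.symm

end Actions

/-! ### The bimodule `Ṽ_{n,r} = V̂^{⊗n} ⊗_{Ĥ_n} H_{n,r}` -/

section Bimodule
variable (n m r : ℕ) (q : ℂˣ) (Q : Fin r → ℂˣ)

/-- The subspace of `V̂^{⊗n} ⊗_ℂ H_{n,r}` spanned by the elements `(v · a) ⊗ h - v ⊗ (a · h)` with
`a ∈ Ĥ_n`, where `Ĥ_n` acts on `H_{n,r}` through the homomorphism `Ĥ_n → H_{n,r}`. -/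
def balancing : Submodule ℂ (TensV n m ⊗[ℂ] AK n r q Q) :=
  Submodule.span ℂ {z | ∃ (v : TensV n m) (a : AffHecke n q) (h : AK n r q Q),
    z = (affRight n m q a).unop v ⊗ₜ[ℂ] h - v ⊗ₜ[ℂ] (toAK n r q Q a * h)}

/-- The space `Ṽ_{n,r} = V̂^{⊗n} ⊗_{Ĥ_n} H_{n,r}`. -/
def WtV : Type := (TensV n m ⊗[ℂ] AK n r q Q) ⧸ balancing n m r q Q

instance : AddCommGroup (WtV n m r q Q) :=
  inferInstanceAs (AddCommGroup ((TensV n m ⊗[ℂ] AK n r q Q) ⧸ balancing n m r q Q))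

instance : Module ℂ (WtV n m r q Q) :=
  inferInstanceAs (Module ℂ ((TensV n m ⊗[ℂ] AK n r q Q) ⧸ balancing n m r q Q))

/-- The projection `V̂^{⊗n} ⊗_ℂ H_{n,r} → Ṽ_{n,r}`. -/
def WtV.mk : TensV n m ⊗[ℂ] AK n r q Q →ₗ[ℂ] WtV n m r q Q := (balancing n m r q Q).mkQ

variable {n m r q Q}

/-- The element `v ⊗ h` of `Ṽ_{n,r}`. -/
def WtV.tmul (v : TensV n m) (h : AK n r q Q) : WtV n m r q Q := WtV.mk n m r q Q (v ⊗ₜ[ℂ] h)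

lemma WtV.add_tmul (v v' : TensV n m) (h : AK n r q Q) :
    WtV.tmul (v + v') h = WtV.tmul v h + WtV.tmul v' h := by
  rw [WtV.tmul, TensorProduct.add_tmul, map_add]; rfl

lemma WtV.smul_tmul (c : ℂ) (v : TensV n m) (h : AK n r q Q) :
    WtV.tmul (c • v) h = c • WtV.tmul v h := by
  rw [WtV.tmul, ← TensorProduct.smul_tmul', map_smul]; rfl

lemma WtV.tmul_add (v : TensV n m) (h h' : AK n r q Q) :
    WtV.tmul v (h + h') = WtV.tmul v h + WtV.tmul v h' := by
  rw [WtV.tmul, TensorProduct.tmul_add, map_add]; rfl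

lemma WtV.tmul_zero (v : TensV n m) : WtV.tmul v (0 : AK n r q Q) = 0 := by
  rw [WtV.tmul, TensorProduct.tmul_zero, map_zero]

lemma WtV.tmul_balanced (v : TensV n m) (a : AffHecke n q) (h : AK n r q Q) :
    WtV.tmul ((affRight n m q a).unop v) h = WtV.tmul v (toAK n r q Q a * h) := by
  refine sub_eq_zero.1 ?_
  rw [WtV.tmul, WtV.tmul, ← map_sub]
  exact (Submodule.Quotient.mk_eq_zero _).2 (Submodule.subset_span ⟨v, a, h, rfl⟩)

lemma WtV.hom_ext {M : Type*} [AddCommGroup M] [Module ℂ M] {f g : WtV n m r q Q →ₗ[ℂ] M}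
    (h : ∀ v x, f (WtV.tmul v x) = g (WtV.tmul v x)) : f = g :=
  Submodule.linearMap_qext _ (TensorProduct.ext' h)

/-- A pair of operators compatible with the balancing relations acts on `Ṽ_{n,r}`. -/
def WtV.map (f : Module.End ℂ (TensV n m)) (g : Module.End ℂ (AK n r q Q))
    (hf : ∀ a v, f ((affRight n m q a).unop v) = (affRight n m q a).unop (f v))
    (hg : ∀ a h, g (toAK n r q Q a * h) = toAK n r q Q a * g h) :
    Module.End ℂ (WtV n m r q Q) :=
  (balancing n m r q Q).mapQ (balancing n m r q Q) (TensorProduct.map f g) (by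
    rw [balancing, Submodule.span_le]
    rintro _ ⟨v, a, h, rfl⟩
    refine Submodule.subset_span ⟨f v, a, g h, ?_⟩
    rw [map_sub, TensorProduct.map_tmul, TensorProduct.map_tmul, hf, hg])

lemma WtV.map_tmul (f : Module.End ℂ (TensV n m)) (g : Module.End ℂ (AK n r q Q)) (hf) (hg)
    (v : TensV n m) (h : AK n r q Q) : WtV.map f g hf hg (WtV.tmul v h) = WtV.tmul (f v) (g h) :=
  rfl

variable (n m r q Q)

/-- The left action of `U_q(ŝl_m)` on `Ṽ_{n,r}`: `u · (v ⊗ h) = (u · v) ⊗ h`. -/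
def leftAction : Uq q m →ₐ[ℂ] Module.End ℂ (WtV n m r q Q) :=
  AlgHom.ofLinearMap
    { toFun := fun u => WtV.map (tensRep q n m u) 1
        (fun a v => (LinearMap.congr_fun
          (congrArg MulOpposite.unop (tensRep_affRight q u a).eq) v)) (fun a h => rfl)
      map_add' := fun u u' => WtV.hom_ext fun v h => by
        change WtV.tmul (tensRep q n m (u + u') v) h =
          WtV.tmul (tensRep q n m u v) h + WtV.tmul (tensRep q n m u' v) h
        rw [map_add]
        exact WtV.add_tmul _ _ _
      map_smul' := fun c u => WtV.hom_ext fun v h => by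
        change WtV.tmul (tensRep q n m (c • u) v) h = c • WtV.tmul (tensRep q n m u v) h
        rw [map_smul]
        exact WtV.smul_tmul _ _ _ }
    (WtV.hom_ext fun v h => by
      change WtV.tmul (tensRep q n m 1 v) h = WtV.tmul v h
      rw [map_one]; rfl)
    (fun u u' => WtV.hom_ext fun v h => by
      change WtV.tmul (tensRep q n m (u * u') v) h =
        WtV.tmul (tensRep q n m u (tensRep q n m u' v)) h
      rw [map_mul]; rfl)

/-- The right action of `H_{n,r}` on `Ṽ_{n,r}`: `(v ⊗ h) · h' = v ⊗ h h'`. -/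
def rightAction : (AK n r q Q)ᵐᵒᵖ →+* Module.End ℂ (WtV n m r q Q) where
  toFun h' := WtV.map 1 (LinearMap.mulRight ℂ h'.unop) (fun a v => rfl)
    (fun a h => mul_assoc _ _ _)
  map_one' := WtV.hom_ext fun v h => by
    change WtV.tmul v (h * 1) = WtV.tmul v h
    rw [mul_one]
  map_zero' := WtV.hom_ext fun v h => by
    change WtV.tmul v (h * 0) = 0
    rw [mul_zero, WtV.tmul_zero]
  map_add' x y := WtV.hom_ext fun v h => by
    change WtV.tmul v (h * (x.unop + y.unop)) = WtV.tmul v (h * x.unop) + WtV.tmul v (h * y.unop)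
    rw [mul_add, WtV.tmul_add]
  map_mul' x y := WtV.hom_ext fun v h => by
    change WtV.tmul v (h * (y.unop * x.unop)) = WtV.tmul v (h * y.unop * x.unop)
    rw [mul_assoc]

instance : Module (Uq q m) (WtV n m r q Q) :=
  Module.compHom (WtV n m r q Q) (leftAction n m r q Q).toRingHom

instance : Module (AK n r q Q)ᵐᵒᵖ (WtV n m r q Q) :=
  Module.compHom (WtV n m r q Q) (rightAction n m r q Q)

variable {n m r q Q}

lemma left_smul_tmul (u : Uq q m) (v : TensV n m) (h : AK n r q Q) :
    u • WtV.tmul v h = WtV.tmul (tensRep q n m u v) h := rfl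

lemma right_smul_tmul (h' : AK n r q Q) (v : TensV n m) (h : AK n r q Q) :
    MulOpposite.op h' • WtV.tmul v h = WtV.tmul v (h * h') := rfl

instance : SMulCommClass (Uq q m) (AK n r q Q)ᵐᵒᵖ (WtV n m r q Q) where
  smul_comm u h x := by
    have : leftAction n m r q Q u * rightAction n m r q Q h =
        rightAction n m r q Q h * leftAction n m r q Q u := WtV.hom_ext fun v x => rfl
    exact LinearMap.congr_fun this x

end Bimodule

/-! ### Compositions and the submodule `I` of `Ṽ_{n,r}` -/

/-- The compositions of `n` with `m` parts. -/
abbrev Comp (n m : ℕ) : Type := {μ : Fin m → ℕ // ∑ i, μ i = n}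

/-- The first `N` parts of `μ` added up: `μ_1 + ⋯ + μ_N`. -/
def Comp.partSum {n m : ℕ} (μ : Comp n m) (N : ℕ) : ℕ := ∑ l : Fin m with l.val < N, μ.1 l

/-- The bijection `ξ` from the pairs `(i, k)`, `i` an index in the `k`-th block, to the indices
`1, …, m` with `m = m_1 + ⋯ + m_r`, in lexicographic order of `(k, i)`; everything is counted
from `0` here. -/
def xi {r : ℕ} (bm : Fin r → ℕ) : (Σ k : Fin r, Fin (bm k)) ≃ Fin (∑ k, bm k) := finSigmaFinEquiv

/-- `a_k^μ`, the sum of the parts of `μ` in the first `k` blocks. -/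
def Comp.blockSum {n r : ℕ} {bm : Fin r → ℕ} (μ : Comp n (∑ k, bm k)) (k : ℕ) : ℕ :=
  ∑ x : (Σ k : Fin r, Fin (bm k)) with x.1.val < k, μ.1 (xi bm x)

/-- `c_j^μ`, for `1 ≤ j ≤ n` the unique `k ∈ {1, …, r}` with `a_{k-1}^μ < j ≤ a_k^μ`. -/
def Comp.colour {n r : ℕ} {bm : Fin r → ℕ} (μ : Comp n (∑ k, bm k)) (j : ℕ) : ℕ :=
  sInf {k | j ≤ μ.blockSum k}

lemma Comp.blockSum_zero {n r : ℕ} {bm : Fin r → ℕ} (μ : Comp n (∑ k, bm k)) :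
    μ.blockSum 0 = 0 := by
  simp [Comp.blockSum]

lemma Comp.blockSum_last {n r : ℕ} {bm : Fin r → ℕ} (μ : Comp n (∑ k, bm k)) :
    μ.blockSum r = n := by
  rw [Comp.blockSum, Finset.filter_true_of_mem fun x _ => x.1.isLt, Equiv.sum_comp, μ.2]

lemma Comp.colour_spec {n r : ℕ} {bm : Fin r → ℕ} (μ : Comp n (∑ k, bm k)) {j : ℕ} (h1 : 1 ≤ j)
    (hn : j ≤ n) : 1 ≤ μ.colour j ∧ μ.colour j ≤ r ∧ μ.blockSum (μ.colour j - 1) < j ∧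
      j ≤ μ.blockSum (μ.colour j) := by
  have hr : r ∈ {k | j ≤ μ.blockSum k} := by
    change j ≤ _
    rw [μ.blockSum_last]
    exact hn
  have h0 : j ≤ μ.blockSum (μ.colour j) := Nat.sInf_mem ⟨r, hr⟩
  have hpos : 1 ≤ μ.colour j := by
    by_contra h
    have : μ.colour j = 0 := by omega
    rw [this, μ.blockSum_zero] at h0
    omega
  refine ⟨hpos, Nat.sInf_le hr, ?_, h0⟩
  by_contra h
  have : μ.colour j ≤ μ.colour j - 1 := Nat.sInf_le (not_lt.1 h)
  omega

/-- The `p`-th letter of `1^{μ_1} 2^{μ_2} ⋯ m^{μ_m}`. -/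
def Comp.letter {n m : ℕ} (μ : Comp n m) (p : Fin n) : Fin m :=
  (finSigmaFinEquiv.symm (Fin.cast μ.2.symm p)).1

/-- `ṽ_μ = (v_1^{⊗μ_1} ⊗ ⋯ ⊗ v_m^{⊗μ_m}) ⊗ 1 ∈ Ṽ_{n,r}`. -/
def vTilde {n m r : ℕ} (q : ℂˣ) (Q : Fin r → ℂˣ) (μ : Comp n m) : WtV n m r q Q :=
  WtV.tmul (tv fun p => (μ.letter p, 0)) 1

/-- The `H_{n,r}`-submodule `I` of `Ṽ_{n,r}` generated by the elements `ṽ_μ · L_j^{⟨c_j^μ⟩}`. -/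
def subI (n r : ℕ) (q : ℂˣ) (Q : Fin r → ℂˣ) (bm : Fin r → ℕ) :
    Submodule (AK n r q Q)ᵐᵒᵖ (WtV n (∑ k, bm k) r q Q) :=
  Submodule.span _ {x | ∃ (μ : Comp n (∑ k, bm k)) (j : ℕ), 1 ≤ j ∧ j ≤ n ∧
    x = MulOpposite.op (AK.Lang n r q Q j (μ.colour j)) • vTilde q Q μ}

end SchurWeyl

end

namespace SchurWeyl

/-! ### Maps out of `Ṽ_{n,r}` into right modules of the Ariki–Koike algebra -/

/-! To show that a vector lies outside the submodule, it suffices to find a map of right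
`H_{n,r}`-modules out of `Ṽ_{n,r}` that kills every generator `ṽ_μ · L_j^{⟨c_j⟩}` and does not kill
the vector. Such maps are easy to produce: a map from words to a right `H_{n,r}`-module `M` that
respects `T_1, …, T_{n-1}` (`HeckeCompatible`) extends to `Ṽ_{n,r}`, by letting `x_j` act as `L_j`
(`extendTens_That`, `extendWtV`).

The target is a module with one particle on `n` sites, `M = P^n`, with `P` a commutative algebra
containing an element `x`. The generators `T_1, …, T_{n-1}` move the particle as in a one-particle
weight space. The generator `T_0` is `Q_0` plus an operator that reads only the component `u 0` at
the first site and returns `particleVec (u 0)`; on these vectors `T_0` acts as `x`. Hence `(T_0 -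
Q_0) g(T_0)` sends `u` to `particleVec (g(x) · u 0)` (`aeval_particleZero`), and the cyclotomic
relation is a condition on `x` alone.

Fix the block `k` (from `0`) whose last index is `i - 1` in the numbering of `Fin m`, so that the
letters `≥ i` are those of later blocks. A word goes to a `q`-weighted sum over the positions of its
letters `≥ i` (`particleOfWord_compatible`). With `f = ∏_{1 ≤ l ≤ k+1} (X - Q_l)`, the pair `(P, x)`
is chosen so that `f(x)` is annihilated by `particleVec` while `g(x)`, `g = ∏_{1 ≤ l ≤ k} (X -
Q_l)`, is not (`exists_particle_coefficients`).

A generator with `c_j ≥ k + 2` dies because its polynomial contains `f`. If `c_j ≤ k + 1`, the first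
`j` letters of `ṽ_μ` are all `< i`; no particle sits there, so `T_{j-1} ⋯ T_1` brings none to the
first site (`extendWtV_subI`). On the other hand, `f_i` raises one letter of the run of `i - 1`, and
so creates a particle at a position `≤ N`, while the colour `k + 1` of `N` supplies only `g`. The
first-site component after `T_{N-1} ⋯ T_1` is a nonzero scalar, and what remains is an invertible
element applied to `particleVec (g(x)) ≠ 0` (`lowering_notMem_subI`). -/

/-- The algebra homomorphism from `H_{n,r}` given by a family satisfying the relations. -/
noncomputable def AK.lift {n r : ℕ} {q : ℂˣ} {Q : Fin r → ℂˣ} {A : Type*} [Ring A] [Algebra ℂ A]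
    (t : Fin n → A)
    (h : ∀ ⦃x y⦄, AKRel n r q Q x y → FreeAlgebra.lift ℂ t x = FreeAlgebra.lift ℂ t y) :
    AK n r q Q →ₐ[ℂ] A :=
  RingQuot.liftAlgHom ℂ ⟨FreeAlgebra.lift ℂ t, h⟩

lemma AK.lift_T {n r : ℕ} {q : ℂˣ} {Q : Fin r → ℂˣ} {A : Type*} [Ring A] [Algebra ℂ A]
    (t : Fin n → A)
    (h : ∀ ⦃x y⦄, AKRel n r q Q x y → FreeAlgebra.lift ℂ t x = FreeAlgebra.lift ℂ t y)
    {i : ℕ} (hi : i < n) : AK.lift t h (AK.T n r q Q i) = t ⟨i, hi⟩ := by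
  rw [AK.T_of_lt hi]
  exact (RingQuot.liftAlgHom_mkAlgHom_apply (S := ℂ) (FreeAlgebra.lift ℂ t)
    (s := AKRel n r q Q) h (FreeAlgebra.ι ℂ ⟨i, hi⟩)).trans (FreeAlgebra.lift_ι_apply _ _)

/-- A linear map on `V̂^{⊗n}` whose kernel is stable under the `x_b^{±1}` and contains all
`v_{j_1} ⊗ ⋯ ⊗ v_{j_n}` vanishes. -/
lemma linearMap_eq_zero_of_Xop {n m : ℕ} {M : Type*} [AddCommGroup M] [Module ℂ M]
    (D : TensV n m →ₗ[ℂ] M) (hD : ∀ (b : Fin n) v, D (Xop b 1 v) = 0 ↔ D v = 0)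
    (h0 : ∀ w : Fin n → Fin m × ℤ, (∀ a, (w a).2 = 0) → D (tv w) = 0) : D = 0 := by
  have all : ∀ (b : Fin n) (k : ℤ) (x : TensV n m), D x = 0 → D (Xop b k x) = 0 := by
    intro b k x hx
    induction k using Int.induction_on with
    | zero => rw [Xop_zero]; exact hx
    | succ k ih =>
      rw [add_comm, ← Xop_mul, Module.End.mul_apply]; exact (hD b _).2 ih
    | pred k ih =>
      -- Negative powers need the direction of `hD` that cancels `x_b`.
      rw [← hD b, ← Module.End.mul_apply, Xop_mul, add_sub_cancel]; exact ih
  -- Induction on a set of positions containing all those with a nonzero exponent.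
  have main : ∀ (s : Finset (Fin n)) (w : Fin n → Fin m × ℤ), (∀ a, a ∉ s → (w a).2 = 0) →
      D (tv w) = 0 := by
    intro s
    induction s using Finset.induction_on with
    | empty => intro w hw; exact h0 w fun a => hw a (by simp)
    | insert b s hb ih =>
      intro w hw
      have hw' : tv w = Xop b (w b).2 (tv (Function.update w b ((w b).1, 0))) := by
        rw [Xop_tv]; simp
      rw [hw']
      refine all _ _ _ (ih _ fun a ha => ?_)
      by_cases hab : a = b
      · subst hab; simp
      · rw [Function.update_of_ne hab]; exact hw a (by simp [hab, ha])
  exact tens_ext fun w => by rw [main Finset.univ w (by simp)]; rfl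

section Extend
variable {n m r : ℕ} {q : ℂˣ} {Q : Fin r → ℂˣ}

/-- The invertible element `L_{j+1}` of the Ariki–Koike algebra. -/
noncomputable def AK.LUnit (n r : ℕ) (q : ℂˣ) (Q : Fin r → ℂˣ) (j : Fin n) : (AK n r q Q)ˣ :=
  (AK.isUnit_L (q := q) (Q := Q) j.2).unit

lemma AK.LUnit_val (j : Fin n) : (AK.LUnit n r q Q j : AK n r q Q) = AK.L n r q Q (j.val + 1) :=
  rfl

lemma AK.LUnit_commute (i j : Fin n) : Commute (AK.LUnit n r q Q i) (AK.LUnit n r q Q j) := by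
  refine Units.ext ?_
  rcases lt_trichotomy i.val j.val with h | h | h
  · exact AK.L_comm h j.2
  · rw [Fin.ext h]
  · exact (AK.L_comm h i.2).symm

/-- The commutation of the `L_j` in the shape required by `MonoidHom.noncommPiCoprod`. -/
lemma AK.pairwise_LUnit_commute (n r : ℕ) (q : ℂˣ) (Q : Fin r → ℂˣ) :
    Pairwise fun i j : Fin n => ∀ x y : Multiplicative ℤ,
      Commute (zpowersHom _ (AK.LUnit n r q Q i) x) (zpowersHom _ (AK.LUnit n r q Q j) y) :=
  fun i j _ x y => by
    simp only [zpowersHom_apply]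
    exact (AK.LUnit_commute i j).zpow_zpow _ _

/-- The element `L_1^{k_1} ⋯ L_n^{k_n}`, as a function of `k ∈ ℤ^n`. -/
noncomputable def AK.monomial (n r : ℕ) (q : ℂˣ) (Q : Fin r → ℂˣ) :
    (Fin n → Multiplicative ℤ) →* (AK n r q Q)ˣ :=
  MonoidHom.noncommPiCoprod (fun j => zpowersHom _ (AK.LUnit n r q Q j))
    (AK.pairwise_LUnit_commute n r q Q)

lemma AK.monomial_mulSingle (j : Fin n) (d : ℤ) :
    AK.monomial n r q Q (Pi.mulSingle j (Multiplicative.ofAdd d)) = AK.LUnit n r q Q j ^ d := by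
  rw [AK.monomial, MonoidHom.noncommPiCoprod_mulSingle, zpowersHom_apply, toAdd_ofAdd]

variable {M : Type*} [AddCommGroup M] [Module ℂ M] (ρ : AK n r q Q →ₐ[ℂ] (Module.End ℂ M)ᵐᵒᵖ)
  (φ : (Fin n → Fin m) → M)

/-- The extension of `φ` to `V̂^{⊗n}` for which `x_j` acts as `L_j`. -/
noncomputable def extendTens : TensV n m →ₗ[ℂ] M :=
  (tBasis n m).constr ℂ fun w =>
    (ρ (AK.monomial n r q Q fun a => Multiplicative.ofAdd (w a).2)).unop (φ fun a => (w a).1)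

lemma extendTens_tv (w : Fin n → Fin m × ℤ) : extendTens ρ φ (tv w) =
    (ρ (AK.monomial n r q Q fun a => Multiplicative.ofAdd (w a).2)).unop (φ fun a => (w a).1) := by
  rw [extendTens, ← tBasis_apply, Module.Basis.constr_basis]

lemma extendTens_tv_zero (w : Fin n → Fin m × ℤ) (hw : ∀ a, (w a).2 = 0) :
    extendTens ρ φ (tv w) = φ fun a => (w a).1 := by
  have : (fun a => Multiplicative.ofAdd (w a).2) = (1 : Fin n → Multiplicative ℤ) := by
    funext a; rw [hw]; rfl
  rw [extendTens_tv, this, map_one, Units.val_one, map_one]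
  rfl

/-- Multiplication by `x_b^d` changes the monomial by the factor `L_b^d`; as the action is a right
one, that factor is applied last. -/
lemma extendTens_Xop (b : Fin n) (d : ℤ) (v : TensV n m) : extendTens ρ φ (Xop b d v) =
    (ρ ((AK.LUnit n r q Q b ^ d : (AK n r q Q)ˣ) : AK n r q Q)).unop (extendTens ρ φ v) := by
  suffices h : extendTens ρ φ ∘ₗ Xop b d =
      (ρ ((AK.LUnit n r q Q b ^ d : (AK n r q Q)ˣ) : AK n r q Q)).unop ∘ₗ extendTens ρ φ from
    LinearMap.congr_fun h v
  refine tens_ext fun w => ?_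
  rw [LinearMap.comp_apply, LinearMap.comp_apply, Xop_tv, extendTens_tv, extendTens_tv]
  have h1 : (fun a => Multiplicative.ofAdd (Function.update w b ((w b).1, (w b).2 + d) a).2) =
      (fun a => Multiplicative.ofAdd (w a).2) * Pi.mulSingle b (Multiplicative.ofAdd d) := by
    funext a
    by_cases hab : a = b
    · subst hab; simp
    · simp [hab]
  have h2 : (fun a => (Function.update w b ((w b).1, (w b).2 + d) a).1) = fun a => (w a).1 := by
    funext a
    by_cases hab : a = b
    · subst hab; simp
    · simp [hab]
  rw [h1, h2, map_mul, AK.monomial_mulSingle, Units.val_mul, map_mul, MulOpposite.unop_mul]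
  rfl

/-- The compatibility of `φ` with the action of the finite Hecke algebra on `V^{⊗n}`. -/
structure HeckeCompatible : Prop where
  eq : ∀ (i : ℕ) (h : i + 1 < n) (j : Fin n → Fin m), j ⟨i, by omega⟩ = j ⟨i + 1, h⟩ →
    (ρ (AK.T n r q Q (i + 1))).unop (φ j) = (q : ℂ) • φ j
  lt : ∀ (i : ℕ) (h : i + 1 < n) (j : Fin n → Fin m), j ⟨i, by omega⟩ < j ⟨i + 1, h⟩ →
    (ρ (AK.T n r q Q (i + 1))).unop (φ j) =
      φ (j ∘ Equiv.swap (⟨i, by omega⟩ : Fin n) ⟨i + 1, h⟩)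

variable {ρ φ}

lemma extendTens_put2_zero (i : ℕ) (h : i + 1 < n) (w : Fin n → Fin m × ℤ)
    (hw : ∀ a, (w a).2 = 0) :
    extendTens ρ φ (put2 w ⟨i, by omega⟩ ⟨i + 1, h⟩ ((w ⟨i + 1, h⟩).1, 0)
      ((w ⟨i, by omega⟩).1, 0)) =
      φ ((fun a => (w a).1) ∘ Equiv.swap (⟨i, by omega⟩ : Fin n) ⟨i + 1, h⟩) := by
  rw [put2, extendTens_tv_zero]
  · congr 1
    funext a
    rw [Function.comp_apply, Equiv.swap_apply_def]
    by_cases h2 : a = ⟨i + 1, h⟩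
    · subst h2; simp
    · rw [Function.update_of_ne h2]
      by_cases h1 : a = ⟨i, by omega⟩
      · subst h1; simp
      · rw [Function.update_of_ne h1, if_neg h1, if_neg h2]
  · intro a
    by_cases h2 : a = ⟨i + 1, h⟩
    · subst h2; simp
    · rw [Function.update_of_ne h2]
      by_cases h1 : a = ⟨i, by omega⟩
      · subst h1; simp
      · rw [Function.update_of_ne h1, hw]

/-- In degree zero the two fields of `HeckeCompatible` are the cases `=` and `<` of the formula for
`T̂_i`. The case `>` follows from them: a word with a descent is the swap of one with an ascent, so
its image is already of the form `T φ(w')`, and the quadratic relation computes `T² φ(w')`. -/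
lemma extendTens_That_zero (hφ : HeckeCompatible ρ φ) (i : ℕ) (h : i + 1 < n)
    (w : Fin n → Fin m × ℤ) (hw : ∀ a, (w a).2 = 0) :
    extendTens ρ φ (That q i h (tv w)) =
      (ρ (AK.T n r q Q (i + 1))).unop (extendTens ρ φ (tv w)) := by
  have hself : put2 w ⟨i, by omega⟩ ⟨i + 1, h⟩ ((w ⟨i, by omega⟩).1, 0) ((w ⟨i + 1, h⟩).1, 0)
      = tv w := by
    rw [← put2_self w ⟨i, by omega⟩ ⟨i + 1, h⟩]
    congr 1 <;> exact Prod.ext rfl (hw _).symm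
  have hw0 : ∀ a, w a = ((w a).1, 0) := fun a => Prod.ext rfl (hw a)
  rw [That_tv, hw0 ⟨i, by omega⟩, hw0 ⟨i + 1, h⟩, twoSite_zero, extendTens_tv_zero ρ φ w hw]
  split_ifs with h1 h2
  · rw [hself, map_smul, extendTens_tv_zero ρ φ w hw, hφ.eq i h _ h1]
  · rw [extendTens_put2_zero i h w hw, hφ.lt i h _ h2]
  · have h3 : (w ⟨i + 1, h⟩).1 < (w ⟨i, by omega⟩).1 := lt_of_le_of_ne (not_lt.1 h2) (Ne.symm h1)
    rw [map_add, map_smul, hself, extendTens_put2_zero i h w hw, extendTens_tv_zero ρ φ w hw]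
    set σ := Equiv.swap (⟨i, by omega⟩ : Fin n) ⟨i + 1, h⟩ with hσ
    have h4 := hφ.lt i h ((fun a => (w a).1) ∘ σ) (by simpa [hσ] using h3)
    have h5 : ((fun a => (w a).1) ∘ σ) ∘ σ = fun a => (w a).1 := by
      funext a; simp [hσ]
    rw [← hσ, h5] at h4
    have h6 := congrArg (fun x => (ρ x).unop (φ ((fun a => (w a).1) ∘ σ)))
      (AK.quad (n := n) (r := r) (q := q) (Q := Q) (Nat.succ_pos i) h)
    simp only [map_mul, map_add, map_smul, map_one, MulOpposite.unop_mul, MulOpposite.unop_add,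
      MulOpposite.unop_smul, MulOpposite.unop_one, Module.End.mul_apply, LinearMap.add_apply,
      LinearMap.smul_apply, Module.End.one_apply, h4] at h6
    rw [h6, add_comm]

/-- Both sides satisfy the same Bernstein relations, so the defect `Φ T̂_i - T_i Φ` turns `x_b` into
some `L_{b'}`. As `L_{b'}` is invertible, the kernel of the defect is stable under all `x_b^{±1}`,
and only words of degree zero remain to be checked. -/
lemma extendTens_That (hφ : HeckeCompatible ρ φ) (i : ℕ) (h : i + 1 < n) (v : TensV n m) :
    extendTens ρ φ (That q i h v) = (ρ (AK.T n r q Q (i + 1))).unop (extendTens ρ φ v) := by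
  set τ := (ρ (AK.T n r q Q (i + 1))).unop with hτ
  set Φ := extendTens ρ φ with hΦ
  let l : Fin n → Module.End ℂ M := fun b => (ρ (AK.L n r q Q (b.val + 1))).unop
  have hX : ∀ b v, Φ (Xop b 1 v) = l b (Φ v) := fun b v => by
    rw [hΦ, extendTens_Xop, zpow_one, AK.LUnit_val]
  have hinj : ∀ b v, l b v = 0 ↔ v = 0 := fun b v => by
    refine ⟨fun hv => ?_, fun hv => by rw [hv, map_zero]⟩
    have h1 := congrArg (fun x => (ρ x).unop v) (AK.LUnit n r q Q b).mul_inv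
    simp only [map_mul, map_one, MulOpposite.unop_mul, MulOpposite.unop_one,
      Module.End.mul_apply, Module.End.one_apply] at h1
    rw [← h1]
    exact (congrArg _ hv).trans (map_zero _)
  have sys := toAKGen_system n r q Q
  have hq : ∀ u, τ (τ u) = ((q : ℂ) - (q : ℂ)⁻¹) • τ u + u := fun u => by
    have := congrArg (fun x => (ρ x).unop u) (sys.quad i h)
    simpa [toAKGen] using this
  have hl : ∀ u, τ (l ⟨i, by omega⟩ (τ u)) = l ⟨i + 1, h⟩ u := fun u => by
    have := congrArg (fun x => (ρ x).unop u) (sys.T_X_T i h)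
    simpa [toAKGen] using this
  -- The Bernstein relations in `M`, deduced from `T_i X_i T_i = X_{i+1}` and the quadratic
  -- relation.
  have hl1 : ∀ u, τ (l ⟨i, by omega⟩ u) =
      l ⟨i + 1, h⟩ (τ u) - ((q : ℂ) - (q : ℂ)⁻¹) • l ⟨i + 1, h⟩ u := fun u => by
    rw [← hl, ← hl, hq, map_add, map_add, map_smul, map_smul, add_sub_cancel_left]
  have hl2 : ∀ u, τ (l ⟨i + 1, h⟩ u) =
      l ⟨i, by omega⟩ (τ u) + ((q : ℂ) - (q : ℂ)⁻¹) • l ⟨i + 1, h⟩ u := fun u => by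
    rw [← hl, hq, add_comm]
  have hl3 : ∀ (b : Fin n), b.val ≠ i → b.val ≠ i + 1 → ∀ u, τ (l b u) = l b (τ u) :=
    fun b h1 h2 u => by
      have := congrArg (fun x => (ρ x).unop u) (sys.T_X i h b h1 h2)
      simpa [toAKGen] using this.symm
  suffices hD : Φ ∘ₗ That q i h - τ ∘ₗ Φ = 0 from sub_eq_zero.1 (LinearMap.congr_fun hD v)
  refine linearMap_eq_zero_of_Xop _ (fun b v => ?_) fun w hw => ?_
  · obtain ⟨b', hb⟩ : ∃ b', (Φ ∘ₗ That q i h - τ ∘ₗ Φ) (Xop b 1 v) =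
        l b' ((Φ ∘ₗ That q i h - τ ∘ₗ Φ) v) := by
      simp only [LinearMap.sub_apply, LinearMap.comp_apply, hX]
      by_cases h1 : b.val = i
      · rw [show b = ⟨i, by omega⟩ from Fin.ext h1]
        refine ⟨⟨i + 1, h⟩, ?_⟩
        have := LinearMap.congr_fun (That_Xop_left (m := m) q i h) v
        simp only [Module.End.mul_apply, LinearMap.sub_apply, LinearMap.smul_apply] at this
        rw [this, map_sub, map_smul, hX, hX, hl1, map_sub]
        abel
      · by_cases h2 : b.val = i + 1
        · rw [show b = ⟨i + 1, h⟩ from Fin.ext h2]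
          refine ⟨⟨i, by omega⟩, ?_⟩
          have := LinearMap.congr_fun (That_Xop_right (m := m) q i h) v
          simp only [Module.End.mul_apply, LinearMap.add_apply, LinearMap.smul_apply] at this
          rw [this, map_add, map_smul, hX, hX, hl2, map_sub]
          abel
        · refine ⟨b, ?_⟩
          have := LinearMap.congr_fun (That_site (m := m) q i h b h1 h2 (shift m 1)).eq v
          simp only [Module.End.mul_apply] at this
          change That q i h (Xop b 1 v) = Xop b 1 _ at this
          rw [this, hX, hl3 b h1 h2, map_sub]
    rw [hb, hinj]
  · rw [LinearMap.sub_apply, LinearMap.comp_apply, LinearMap.comp_apply, hΦ,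
      extendTens_That_zero hφ i h w hw, sub_self]

/-- Compatibility with the generators propagates to `Ĥ_n`; both actions reverse products, so the
multiplicative step composes in the same order on the two sides. -/
lemma extendTens_affRight (hφ : HeckeCompatible ρ φ) (a : AffHecke n q) (v : TensV n m) :
    extendTens ρ φ ((affRight n m q a).unop v) =
      (ρ (toAK n r q Q a)).unop (extendTens ρ φ v) := by
  obtain ⟨w, rfl⟩ := RingQuot.mkAlgHom_surjective ℂ (AffRel n q) a
  let F : FreeAlgebra ℂ (AffGen n) →ₐ[ℂ] (Module.End ℂ (TensV n m))ᵐᵒᵖ :=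
    (affRight n m q).comp (RingQuot.mkAlgHom ℂ (AffRel n q))
  let G : FreeAlgebra ℂ (AffGen n) →ₐ[ℂ] (Module.End ℂ M)ᵐᵒᵖ :=
    (ρ.comp (toAK n r q Q)).comp (RingQuot.mkAlgHom ℂ (AffRel n q))
  change extendTens ρ φ ((F w).unop v) = (G w).unop (extendTens ρ φ v)
  induction w using FreeAlgebra.induction generalizing v with
  | grade0 c =>
    rw [AlgHom.commutes, AlgHom.commutes]
    exact map_smul (extendTens ρ φ) c v
  | grade1 x =>
    have hF : F (FreeAlgebra.ι ℂ x) = affRightGen n m q x := AffHecke.lift_gen _ _ x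
    have hG : G (FreeAlgebra.ι ℂ x) = ρ (toAKGen n r q Q x) :=
      congrArg ρ (AffHecke.lift_gen _ (toAKGen_system n r q Q) x)
    rw [hF, hG]
    cases x with
    | T i h => exact extendTens_That hφ i h v
    | X j =>
      refine (extendTens_Xop ρ φ j 1 v).trans ?_
      rw [zpow_one]; rfl
    | XInv j =>
      refine (extendTens_Xop ρ φ j (-1) v).trans ?_
      rw [zpow_neg_one]
      change _ = (ρ (Ring.inverse (AK.L n r q Q (j.val + 1)))).unop _
      rw [← AK.LUnit_val, Ring.inverse_unit]
  | mul x y hx hy =>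
    rw [map_mul, map_mul, MulOpposite.unop_mul, MulOpposite.unop_mul, Module.End.mul_apply,
      Module.End.mul_apply, hy, hx]
  | add x y hx hy =>
    rw [map_add, map_add, MulOpposite.unop_add, MulOpposite.unop_add, LinearMap.add_apply,
      LinearMap.add_apply, map_add, hx, hy]

/-- The map of right `H_{n,r}`-modules from `Ṽ_{n,r}` extending `φ`. -/
noncomputable def extendWtV (hφ : HeckeCompatible ρ φ) : WtV n m r q Q →ₗ[ℂ] M :=
  (balancing n m r q Q).liftQ
    (TensorProduct.lift (LinearMap.mk₂ ℂ (fun v h => (ρ h).unop (extendTens ρ φ v))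
      (fun v v' h => by rw [map_add, map_add]) (fun c v h => by rw [map_smul, map_smul])
      (fun v h h' => by rw [map_add]; rfl) (fun c v h => by rw [map_smul]; rfl)))
    (by
      rw [balancing, Submodule.span_le]
      rintro _ ⟨v, a, h, rfl⟩
      simp only [SetLike.mem_coe, LinearMap.mem_ker, map_sub, TensorProduct.lift.tmul,
        LinearMap.mk₂_apply, extendTens_affRight hφ, map_mul, MulOpposite.unop_mul,
        Module.End.mul_apply, sub_self])

lemma extendWtV_tmul (hφ : HeckeCompatible ρ φ) (v : TensV n m) (h : AK n r q Q) :
    extendWtV hφ (WtV.tmul v h) = (ρ h).unop (extendTens ρ φ v) := rfl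

lemma extendWtV_op_smul (hφ : HeckeCompatible ρ φ) (h : AK n r q Q) (x : WtV n m r q Q) :
    extendWtV hφ (MulOpposite.op h • x) = (ρ h).unop (extendWtV hφ x) := by
  suffices H : extendWtV hφ ∘ₗ rightAction n m r q Q (MulOpposite.op h) =
      (ρ h).unop ∘ₗ extendWtV hφ from LinearMap.congr_fun H x
  refine WtV.hom_ext fun v h' => ?_
  change (ρ (h' * h)).unop _ = (ρ h).unop ((ρ h').unop _)
  rw [map_mul]
  rfl

end Extend

/-! ### The one-particle module of the Ariki–Koike algebra -/

section Particle
variable {n : ℕ} (q : ℂˣ) {P : Type*} [CommRing P] [Algebra ℂ P]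

/-- The generator of the finite Hecke algebra exchanging the positions `b`, `c`, on the module with
basis the positions of one particle, with coefficients in `P`. -/
noncomputable def particleT (b c : Fin n) : Module.End ℂ (Fin n → P) where
  toFun u a := if a = b then u c + ((q : ℂ) - (q : ℂ)⁻¹) • u b else if a = c then u b
    else (q : ℂ) • u a
  map_add' u u' := by
    funext a
    simp only [Pi.add_apply]
    split_ifs <;> module
  map_smul' z u := by
    funext a
    simp only [Pi.smul_apply, RingHom.id_apply]
    split_ifs <;> module

lemma particleT_apply (b c : Fin n) (u : Fin n → P) (a : Fin n) :
    particleT q b c u a = if a = b then u c + ((q : ℂ) - (q : ℂ)⁻¹) • u b else if a = c then u b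
    else (q : ℂ) • u a := rfl

lemma particleT_quad {b c : Fin n} (h : b ≠ c) (u : Fin n → P) :
    particleT q b c (particleT q b c u) =
      ((q : ℂ) - (q : ℂ)⁻¹) • particleT q b c u + u := by
  have hq := q.ne_zero
  funext a
  simp only [particleT_apply, Pi.add_apply, Pi.smul_apply, h.symm, if_true, if_false]
  split_ifs with h1 h2
  · subst h1; module
  · subst h2; module
  · match_scalars
    field_simp
    ring

lemma particleT_braid {b c d : Fin n} (h1 : b ≠ c) (h2 : c ≠ d) (h3 : b ≠ d) (u : Fin n → P) :
    particleT q b c (particleT q c d (particleT q b c u)) =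
      particleT q c d (particleT q b c (particleT q c d u)) := by
  have hq := q.ne_zero
  funext a
  simp only [particleT_apply, h1, h2, h3, h1.symm, h2.symm, h3.symm, if_true, if_false]
  by_cases e1 : a = b
  · subst e1
    simp only [h1, h3, if_true, if_false]
    match_scalars <;> field_simp <;> ring
  · by_cases e2 : a = c
    · subst e2
      simp only [e1, h2, if_true, if_false]
      module
    · by_cases e3 : a = d
      · subst e3
        simp only [e1, e2, if_true, if_false]
      · simp only [e1, e2, e3, if_false]

lemma particleT_far {b c d e : Fin n} (h1 : b ≠ d) (h2 : b ≠ e) (h3 : c ≠ d) (h4 : c ≠ e)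
    (u : Fin n → P) : particleT q b c (particleT q d e u) =
      particleT q d e (particleT q b c u) := by
  funext a
  simp only [particleT_apply, h1, h2, h3, h4, h1.symm, h2.symm, h3.symm, h4.symm, if_true,
    if_false]
  split_ifs <;> simp_all <;> module

variable (Q₀ : ℂ) (x : P)

/-- The vectors spanning the image of `T_0 - Q_0` in the one-particle module. -/
noncomputable def particleVec : P →ₗ[ℂ] Fin n → P where
  toFun p a := if a.val = 0 then x * p - Q₀ • p
    else -((((q : ℂ) - (q : ℂ)⁻¹) * (q : ℂ)⁻¹ ^ (a.val - 1)) • (x * p))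
  map_add' p p' := by
    funext a
    simp only [Pi.add_apply, mul_add]
    split_ifs <;> module
  map_smul' z p := by
    funext a
    simp only [Pi.smul_apply, RingHom.id_apply, mul_smul_comm]
    split_ifs <;> module

lemma particleVec_apply (p : P) (a : Fin n) : particleVec q Q₀ x p a =
    if a.val = 0 then x * p - Q₀ • p
    else -((((q : ℂ) - (q : ℂ)⁻¹) * (q : ℂ)⁻¹ ^ (a.val - 1)) • (x * p)) := rfl

/-- The generator `T_0` on the one-particle module. -/
noncomputable def particleZero (o : Fin n) : Module.End ℂ (Fin n → P) :=
  Q₀ • LinearMap.id + particleVec q Q₀ x ∘ₗ LinearMap.proj o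

lemma particleZero_apply (o : Fin n) (u : Fin n → P) :
    particleZero q Q₀ x o u = Q₀ • u + particleVec q Q₀ x (u o) := rfl

/-- The first component of `particleVec p` is `(x - Q_0) p`, which is exactly what replaces the
eigenvalue `Q_0` by `x`. -/
lemma particleZero_vec {o : Fin n} (ho : o.val = 0) (p : P) :
    particleZero q Q₀ x o (particleVec q Q₀ x p) = particleVec q Q₀ x (x * p) := by
  rw [particleZero_apply, particleVec_apply _ _ _ _ o, if_pos ho, map_sub, map_smul]
  abel

/-- The factor `-(q - q⁻¹) x` of `particleVec` at the second site is tuned to this relation. When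
`T_1 T_0 T_1` acts on a particle at the second site, it cancels the term `(q - q⁻¹) x` at the first
site that comes from the quadratic part of `T_1`. -/
lemma particleZero_braid {o b : Fin n} (ho : o.val = 0) (hb : b.val = 1) (u : Fin n → P) :
    particleT q o b (particleZero q Q₀ x o (particleT q o b (particleZero q Q₀ x o u))) =
      particleZero q Q₀ x o (particleT q o b (particleZero q Q₀ x o (particleT q o b u))) := by
  have hq := q.ne_zero
  have hob : o ≠ b := fun h => by rw [h, hb] at ho; omega
  funext a
  simp only [particleT_apply, particleZero_apply, particleVec_apply, Pi.add_apply, Pi.smul_apply,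
    ho, hb, hob, hob.symm, if_true, if_false, one_ne_zero, Nat.sub_self, pow_zero, mul_one]
  -- Three kinds of components: the two exchanged sites, and the sites beyond, where the weight
  -- `(q⁻¹)^(a-1)` stays a common factor.
  by_cases h1 : a = o
  · subst h1
    simp only [ho, if_true, mul_add, mul_sub, mul_smul_comm, mul_neg, ← Algebra.smul_def]
    match_scalars <;> field_simp <;> ring
  · by_cases h2 : a = b
    · subst h2
      simp only [h1, hb, if_true, if_false, one_ne_zero, Nat.sub_self, pow_zero, mul_one, mul_add,
        mul_sub, mul_smul_comm, mul_neg]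
      match_scalars <;> field_simp <;> ring
    · have h3 : a.val ≠ 0 := fun h => h1 (Fin.ext (h.trans ho.symm))
      simp only [h1, h2, h3, if_true, if_false, mul_add, mul_sub, mul_smul_comm, mul_neg]
      match_scalars <;> field_simp <;> ring

/-- The geometric decay of `particleVec` away from the first site makes it an eigenvector of
eigenvalue `q` for every exchange not touching that site. Such an exchange also multiplies the
component read by `T_0` by `q`, so the two operations commute. -/
lemma particleZero_far {o b c : Fin n} (ho : o.val = 0) (hb : 0 < b.val)
    (hc : c.val = b.val + 1) (u : Fin n → P) :
    particleT q b c (particleZero q Q₀ x o u) = particleZero q Q₀ x o (particleT q b c u) := by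
  have hq := q.ne_zero
  have hob : o ≠ b := fun h => by rw [← h] at hb; omega
  have hoc : o ≠ c := fun h => by rw [← h] at hc; omega
  have hbc : b ≠ c := fun h => by rw [← h] at hc; omega
  obtain ⟨t, ht⟩ : ∃ t, b.val = t + 1 := ⟨b.val - 1, by omega⟩
  funext a
  simp only [particleT_apply, particleZero_apply, particleVec_apply, Pi.add_apply, Pi.smul_apply,
    ho, hob, hoc, if_true, if_false]
  by_cases h1 : a = b
  · subst h1
    simp only [hc, ht, if_true, if_false, Nat.add_eq_zero_iff, one_ne_zero, and_false,
      Nat.add_sub_cancel, pow_succ, mul_smul_comm]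
    generalize (q : ℂ)⁻¹ ^ t = z
    match_scalars <;> field_simp <;> ring
  · by_cases h2 : a = c
    · subst h2
      simp only [h1, hc, ht, if_true, if_false, Nat.add_eq_zero_iff, one_ne_zero, and_false,
        Nat.add_sub_cancel, pow_succ, mul_smul_comm]
      generalize (q : ℂ)⁻¹ ^ t = z
      match_scalars <;> field_simp
    · by_cases h3 : a.val = 0
      · simp only [h1, h2, h3, if_true, if_false, mul_smul_comm]
        match_scalars <;> ring
      · simp only [h1, h2, h3, if_true, if_false, mul_smul_comm]
        match_scalars <;> ring

/-- The generators of the Ariki–Koike algebra on the one-particle module. -/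
noncomputable def particleGen (i : Fin n) : (Module.End ℂ (Fin n → P))ᵐᵒᵖ :=
  if i.val = 0 then MulOpposite.op (particleZero q Q₀ x i)
  else MulOpposite.op (particleT q ⟨i.val - 1, by omega⟩ i)

lemma aeval_particleZero_vec {o : Fin n} (ho : o.val = 0) (f : Polynomial ℂ) (p : P) :
    (Polynomial.aeval (MulOpposite.op (particleZero q Q₀ x o)) f).unop (particleVec q Q₀ x p) =
      particleVec q Q₀ x (Polynomial.aeval x f * p) := by
  induction f using Polynomial.induction_on generalizing p with
  | C c =>
    rw [Polynomial.aeval_C, Polynomial.aeval_C, ← Algebra.smul_def, map_smul]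
    rfl
  | add f g hf hg =>
    rw [map_add, MulOpposite.unop_add, LinearMap.add_apply, hf, hg, map_add, add_mul, map_add]
  | monomial k c h =>
    set g := Polynomial.C c * Polynomial.X ^ k
    rw [pow_succ, ← mul_assoc, mul_comm _ Polynomial.X,
      map_mul (Polynomial.aeval (MulOpposite.op (particleZero q Q₀ x o))),
      map_mul (Polynomial.aeval x),
      Polynomial.aeval_X, Polynomial.aeval_X, MulOpposite.unop_mul, MulOpposite.unop_op,
      Module.End.mul_apply, particleZero_vec q Q₀ x ho, h]
    congr 1
    ring

/-- `T_0 - Q_0` has its image among the vectors `particleVec p`, on which polynomials in `T_0`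
become polynomials in `x`. Everything divisible by `T_0 - Q_0` therefore depends only on the
component at the first site. -/
lemma aeval_particleZero {o : Fin n} (ho : o.val = 0) (f : Polynomial ℂ) (u : Fin n → P) :
    (Polynomial.aeval (MulOpposite.op (particleZero q Q₀ x o))
      ((Polynomial.X - Polynomial.C Q₀) * f)).unop u =
      particleVec q Q₀ x (Polynomial.aeval x f * u o) := by
  rw [map_mul, MulOpposite.unop_mul, Module.End.mul_apply, ← aeval_particleZero_vec q Q₀ x ho]
  congr 1
  rw [map_sub, Polynomial.aeval_X, Polynomial.aeval_C, MulOpposite.unop_sub]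
  change particleZero q Q₀ x o u - Q₀ • u = _
  rw [particleZero_apply, add_sub_cancel_left]

end Particle

/-! ### The Ariki–Koike relations on the one-particle module, and the action of `L_j^{⟨k⟩}`. -/

section ParticleRep
variable {n r : ℕ} {q : ℂˣ} {Q : Fin r → ℂˣ} {P : Type*} [CommRing P] [Algebra ℂ P]

lemma particleGen_zero (Q₀ : ℂ) (x : P) {i : Fin n} (hi : i.val = 0) :
    particleGen q Q₀ x i = MulOpposite.op (particleZero q Q₀ x i) := if_pos hi

lemma particleGen_succ (Q₀ : ℂ) (x : P) {i b : Fin n} (hi : i.val = b.val + 1) :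
    particleGen q Q₀ x i = MulOpposite.op (particleT q b i) := by
  rw [particleGen, if_neg (by omega)]
  congr 2
  exact Fin.ext (by simp [hi])

/-- Only the cyclotomic relation uses `hf` and `hv`: the divisor `(X - Q₀) f` of the cyclotomic
polynomial already acts by zero. The finite Hecke and braid relations hold for every `x`. -/
lemma particleGen_rel {Q₀ : ℂ} {x : P} {f : Polynomial ℂ}
    (hf : (Polynomial.X - Polynomial.C Q₀) * f ∣ cycPoly Q r)
    (hv : ∀ p, (particleVec q Q₀ x (Polynomial.aeval x f * p) : Fin n → P) = 0)
    ⦃y z : FreeAlgebra ℂ (Fin n)⦄ (hyz : AKRel n r q Q y z) :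
    FreeAlgebra.lift ℂ (particleGen (n := n) q Q₀ x) y =
      FreeAlgebra.lift ℂ (particleGen (n := n) q Q₀ x) z := by
  induction hyz with
  | cyc h =>
    obtain ⟨g, hg⟩ := hf
    rw [← Polynomial.aeval_algHom_apply, FreeAlgebra.lift_ι_apply, map_zero,
      particleGen_zero Q₀ x rfl, hg, map_mul]
    have : Polynomial.aeval (MulOpposite.op (particleZero q Q₀ x (⟨0, h⟩ : Fin n)))
        ((Polynomial.X - Polynomial.C Q₀) * f) = 0 :=
      MulOpposite.unop_injective (LinearMap.ext fun u => by
        rw [aeval_particleZero q Q₀ x rfl, hv]; rfl)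
    rw [this, zero_mul]
  | quad i hi =>
    rw [quad_expand, map_zero]
    simp only [map_sub, map_mul, map_add, map_smul, map_one, FreeAlgebra.lift_ι_apply]
    rw [particleGen_succ (b := ⟨i.val - 1, by omega⟩) Q₀ x (by simp; omega), sub_eq_zero]
    refine MulOpposite.unop_injective (LinearMap.ext fun u => ?_)
    exact particleT_quad q (fun h => by have := congrArg Fin.val h; simp at this; omega) u
  | braid_zero h =>
    simp only [map_mul, FreeAlgebra.lift_ι_apply]
    rw [particleGen_zero Q₀ x rfl, particleGen_succ (b := ⟨0, by omega⟩) Q₀ x rfl]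
    exact MulOpposite.unop_injective (LinearMap.ext fun u =>
      particleZero_braid q Q₀ x rfl rfl u)
  | braid i j hi hij =>
    simp only [map_mul, FreeAlgebra.lift_ι_apply]
    rw [particleGen_succ (b := ⟨i.val - 1, by omega⟩) (i := i) Q₀ x (by simp; omega),
      particleGen_succ Q₀ x hij]
    refine MulOpposite.unop_injective (LinearMap.ext fun u => ?_)
    exact particleT_braid q (fun h => by have := congrArg Fin.val h; simp at this; omega)
      (fun h => by have := congrArg Fin.val h; omega)
      (fun h => by have := congrArg Fin.val h; simp at this; omega) u
  | far i j hij =>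
    simp only [map_mul, FreeAlgebra.lift_ι_apply]
    rw [particleGen_succ (b := ⟨j.val - 1, by omega⟩) (i := j) Q₀ x (by simp; omega)]
    rcases Nat.eq_zero_or_pos i.val with hi | hi
    · rw [particleGen_zero Q₀ x hi]
      exact MulOpposite.unop_injective (LinearMap.ext fun u =>
        particleZero_far q Q₀ x hi (by simp; omega) (by simp; omega) u)
    · rw [particleGen_succ (b := ⟨i.val - 1, by omega⟩) (i := i) Q₀ x (by simp; omega)]
      refine MulOpposite.unop_injective (LinearMap.ext fun u => ?_)
      refine particleT_far q ?_ ?_ ?_ ?_ u <;>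
      · intro h
        simp only [Fin.ext_iff] at h
        omega

/-- The one-particle module as a right module of the Ariki–Koike algebra. -/
noncomputable def particleRep {Q₀ : ℂ} {x : P} {f : Polynomial ℂ}
    (hf : (Polynomial.X - Polynomial.C Q₀) * f ∣ cycPoly Q r)
    (hv : ∀ p, (particleVec q Q₀ x (Polynomial.aeval x f * p) : Fin n → P) = 0) :
    AK n r q Q →ₐ[ℂ] (Module.End ℂ (Fin n → P))ᵐᵒᵖ :=
  AK.lift (particleGen q Q₀ x) (particleGen_rel hf hv)

variable {Q₀ : ℂ} {x : P} {f : Polynomial ℂ}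
  (hf : (Polynomial.X - Polynomial.C Q₀) * f ∣ cycPoly Q r)
  (hv : ∀ p, (particleVec q Q₀ x (Polynomial.aeval x f * p) : Fin n → P) = 0)

lemma particleRep_zero (h : 0 < n) : particleRep hf hv (AK.T n r q Q 0) =
    MulOpposite.op (particleZero q Q₀ x ⟨0, h⟩) :=
  (AK.lift_T _ _ h).trans (particleGen_zero _ _ rfl)

lemma particleRep_succ (i : ℕ) (h : i + 1 < n) : particleRep hf hv (AK.T n r q Q (i + 1)) =
    MulOpposite.op (particleT q ⟨i, by omega⟩ ⟨i + 1, h⟩) :=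
  (AK.lift_T _ _ h).trans (particleGen_succ _ _ rfl)

/-- If the particle is at none of the first `j` positions, then `T_j ⋯ T_1` brings it from the
`j`-th position (counted from `0`) to the first one. -/
lemma particleRep_desc (j : ℕ) (h : j < n) (u : Fin n → P) (hu : ∀ a : Fin n, a.val < j → u a = 0) :
    (particleRep hf hv (AK.desc n r q Q j)).unop u ⟨0, by omega⟩ = u ⟨j, h⟩ := by
  induction j generalizing u with
  | zero => rw [AK.desc, map_one]; rfl
  | succ j ih =>
    rw [AK.desc, map_mul, MulOpposite.unop_mul, Module.End.mul_apply, particleRep_succ hf hv j h,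
      MulOpposite.unop_op, ih (by omega), particleT_apply, if_pos rfl, hu ⟨j, by omega⟩ (by simp),
      smul_zero, add_zero]
    intro a ha
    rw [particleT_apply, if_neg (fun e => by rw [e] at ha; simp at ha),
      if_neg (fun e => by rw [e] at ha; simp at ha), hu a (by omega), smul_zero]

lemma particleRep_aeval (h : 0 < n) (g : Polynomial ℂ) (u : Fin n → P) :
    (particleRep hf hv (Polynomial.aeval (AK.T n r q Q 0)
      ((Polynomial.X - Polynomial.C Q₀) * g))).unop u =
      particleVec q Q₀ x (Polynomial.aeval x g * u ⟨0, h⟩) := by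
  rw [← Polynomial.aeval_algHom_apply, particleRep_zero hf hv h, aeval_particleZero q Q₀ x rfl]

/-- Since the middle factor of `L_j^{⟨k⟩}` contains `T_0 - Q_0`, a vector enters only through the
first component of its image under `T_{j-1} ⋯ T_1`. Both the vanishing on generators and the
non-vanishing on the lowered vector are read off from this formula. -/
lemma particleRep_Lang (h : 0 < n) (j k : ℕ) (g : Polynomial ℂ)
    (hg : cycPoly Q k = (Polynomial.X - Polynomial.C Q₀) * g) (u : Fin n → P) :
    (particleRep hf hv (AK.Lang n r q Q j k)).unop u =
      (particleRep hf hv (AK.asc n r q Q (j - 1))).unop (particleVec q Q₀ x (Polynomial.aeval x g *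
        (particleRep hf hv (AK.desc n r q Q (j - 1))).unop u ⟨0, h⟩)) := by
  rw [AK.Lang, map_mul, map_mul, MulOpposite.unop_mul, MulOpposite.unop_mul,
    Module.End.mul_apply, Module.End.mul_apply, hg, particleRep_aeval hf hv h]

end ParticleRep

/-! ### From words to the one-particle module. -/

section Words
variable {n m : ℕ}

/-- The number of inversions of a word. -/
def invCount (w : Fin n → Fin m) : ℤ := ∑ b, ∑ c, if b < c ∧ w c < w b then 1 else 0

/-- The number of letters `≥ s` minus the number of letters `< s` to the right of position `a`. -/
def tailCount (s : ℕ) (w : Fin n → Fin m) (a : Fin n) : ℤ :=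
  ∑ b, if a < b then (if s ≤ (w b).val then 1 else -1) else 0

lemma swap_lt_swap_iff {i : ℕ} (h : i + 1 < n) {b c : Fin n}
    (h1 : ¬ (b = ⟨i, by omega⟩ ∧ c = ⟨i + 1, h⟩)) (h2 : ¬ (b = ⟨i + 1, h⟩ ∧ c = ⟨i, by omega⟩)) :
    Equiv.swap (⟨i, by omega⟩ : Fin n) ⟨i + 1, h⟩ b < Equiv.swap ⟨i, by omega⟩ ⟨i + 1, h⟩ c ↔
      b < c := by
  simp only [Fin.ext_iff] at h1 h2
  simp only [Equiv.swap_apply_def, Fin.ext_iff, Fin.lt_def]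
  split_ifs <;> simp_all <;> omega

/-- After reindexing both sums by the swap, the terms agree pair by pair, except at the exchanged
pair: its ascent has become an inversion. -/
lemma invCount_comp_swap {i : ℕ} (h : i + 1 < n) (w : Fin n → Fin m)
    (hw : w ⟨i, by omega⟩ < w ⟨i + 1, h⟩) :
    invCount (w ∘ Equiv.swap (⟨i, by omega⟩ : Fin n) ⟨i + 1, h⟩) = invCount w + 1 := by
  set σ := Equiv.swap (⟨i, by omega⟩ : Fin n) ⟨i + 1, h⟩ with hσ
  have h1 : invCount (w ∘ σ) = ∑ b, ∑ c, if σ b < σ c ∧ w c < w b then 1 else 0 := by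
    rw [invCount, ← Equiv.sum_comp σ]
    refine Finset.sum_congr rfl fun b _ => ?_
    rw [← Equiv.sum_comp σ]
    refine Finset.sum_congr rfl fun c _ => ?_
    simp [hσ]
  -- The surplus `1` is written as a double sum supported on the exchanged pair, so that the
  -- comparison becomes termwise.
  have h2 : ∑ b : Fin n, ∑ c : Fin n,
      (if b = ⟨i + 1, h⟩ ∧ c = ⟨i, by omega⟩ then 1 else 0 : ℤ) = 1 := by
    simp only [ite_and, Finset.sum_ite_eq', Finset.sum_ite_irrel, Finset.mem_univ, if_true,
      Finset.sum_const_zero]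
  refine Eq.trans ?_ (congrArg (invCount w + ·) h2)
  rw [h1, invCount, ← Finset.sum_add_distrib]
  refine Finset.sum_congr rfl fun b _ => ?_
  rw [← Finset.sum_add_distrib]
  refine Finset.sum_congr rfl fun c _ => ?_
  by_cases e1 : b = ⟨i, by omega⟩ ∧ c = ⟨i + 1, h⟩
  · obtain ⟨rfl, rfl⟩ := e1
    simp [hw.not_gt]
  · by_cases e2 : b = ⟨i + 1, h⟩ ∧ c = ⟨i, by omega⟩
    · obtain ⟨rfl, rfl⟩ := e2
      simp [hσ, hw, Fin.lt_def]
    · simp only [if_neg e2, add_zero, hσ, swap_lt_swap_iff h e1 e2]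

/-- The cut just after position `a` separates the two exchanged positions only for `a = i`;
otherwise the set of positions to the right of `a` is preserved. -/
lemma tailCount_comp_swap {i : ℕ} (h : i + 1 < n) (s : ℕ) (w : Fin n → Fin m) (a : Fin n)
    (h1 : a ≠ ⟨i, by omega⟩) :
    tailCount s (w ∘ Equiv.swap (⟨i, by omega⟩ : Fin n) ⟨i + 1, h⟩) a = tailCount s w a := by
  rw [tailCount, ← Equiv.sum_comp (Equiv.swap (⟨i, by omega⟩ : Fin n) ⟨i + 1, h⟩)]
  refine Finset.sum_congr rfl fun b _ => ?_
  have : a < Equiv.swap (⟨i, by omega⟩ : Fin n) ⟨i + 1, h⟩ b ↔ a < b := by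
    simp only [ne_eq, Fin.ext_iff] at h1
    simp only [Equiv.swap_apply_def, Fin.ext_iff, Fin.lt_def]
    split_ifs <;> simp_all <;> omega
  simp [this]

lemma tailCount_left {i : ℕ} (h : i + 1 < n) (s : ℕ) (w : Fin n → Fin m) :
    tailCount s w ⟨i, by omega⟩ =
      tailCount s w ⟨i + 1, h⟩ + if s ≤ (w ⟨i + 1, h⟩).val then 1 else -1 := by
  have : (if s ≤ (w ⟨i + 1, h⟩).val then 1 else -1 : ℤ) =
      ∑ b, if b = ⟨i + 1, h⟩ then (if s ≤ (w b).val then 1 else -1) else 0 := by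
    rw [Finset.sum_ite_eq']; simp
  rw [this, tailCount, tailCount, ← Finset.sum_add_distrib]
  refine Finset.sum_congr rfl fun b _ => ?_
  have e : (⟨i, by omega⟩ : Fin n) < b ↔ (⟨i + 1, h⟩ : Fin n) < b ∨ b = ⟨i + 1, h⟩ := by
    simp only [Fin.lt_def, Fin.ext_iff]; omega
  by_cases h1 : b = ⟨i + 1, h⟩
  · subst h1; simp
  · simp [e, h1]

variable {r : ℕ} {q : ℂˣ} {Q : Fin r → ℂˣ} {P : Type*} [CommRing P] [Algebra ℂ P]

/-- The sum over the positions of a letter `≥ s`, with powers of `q`: the image of a word in the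
one-particle module. -/
noncomputable def particleOfWord (q : ℂˣ) (P : Type*) [CommRing P] [Algebra ℂ P] (s : ℕ)
    (w : Fin n → Fin m) (a : Fin n) : P :=
  if s ≤ (w a).val then (q : ℂ) ^ (invCount w + tailCount s w a) • 1 else 0

/-- At sites away from the exchange, `T` multiplies by `q`, which matches the extra inversion when
an ascent is swapped. At the exchanged sites the weights come from `tailCount`: if both letters are
particles, the left weight is `q` times the right weight `z`, and the new left entry is `z + (q -
q⁻¹) q z = q² z`. If only the right letter is a particle, the letter `< s` that moves past it
contributes `-1` and cancels the new inversion. Equal letters reduce to the same computation. -/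
lemma particleOfWord_compatible {Q₀ : ℂ} {x : P} {f : Polynomial ℂ}
    (hf : (Polynomial.X - Polynomial.C Q₀) * f ∣ cycPoly Q r)
    (hv : ∀ p, (particleVec q Q₀ x (Polynomial.aeval x f * p) : Fin n → P) = 0) (s : ℕ) :
    HeckeCompatible (particleRep hf hv) (particleOfWord (n := n) (m := m) q P s) := by
  have q0 := q.ne_zero
  constructor
  · intro i h w hw
    rw [particleRep_succ hf hv i h, MulOpposite.unop_op]
    funext a
    rw [particleT_apply, Pi.smul_apply]
    split_ifs with h1 h2
    · subst h1
      rw [particleOfWord, particleOfWord, tailCount_left h, hw]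
      split_ifs with h3
      · rw [← add_assoc, zpow_add_one₀ q0]
        match_scalars
        field_simp
        ring
      · simp
    · subst h2
      rw [particleOfWord, particleOfWord, tailCount_left h, hw]
      split_ifs with h3
      · rw [← add_assoc, zpow_add_one₀ q0, mul_comm, mul_smul]
      · simp
    · rfl
  · intro i h w hw
    rw [particleRep_succ hf hv i h, MulOpposite.unop_op]
    set σ := Equiv.swap (⟨i, by omega⟩ : Fin n) ⟨i + 1, h⟩ with hσ
    have hne : (⟨i + 1, h⟩ : Fin n) ≠ ⟨i, by omega⟩ := by simp
    have hinv := invCount_comp_swap h w hw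
    have hw' : (w ⟨i, by omega⟩).val < (w ⟨i + 1, h⟩).val := hw
    funext a
    rw [particleT_apply]
    split_ifs with h1 h2
    · subst h1
      rw [particleOfWord, particleOfWord, particleOfWord, hinv, tailCount_left h s (w ∘ σ),
        tailCount_comp_swap h s w _ hne, tailCount_left h s w]
      simp only [Function.comp_apply, hσ, Equiv.swap_apply_left, Equiv.swap_apply_right]
      by_cases h3 : s ≤ (w ⟨i, by omega⟩).val
      -- As the pair is an ascent, a particle on the left forces one on the right.
      · have h4 : s ≤ (w ⟨i + 1, h⟩).val := by omega
        simp only [h3, h4, if_true]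
        rw [show invCount w + 1 + (tailCount s w ⟨i + 1, h⟩ + 1) =
          invCount w + tailCount s w ⟨i + 1, h⟩ + 1 + 1 by ring, ← add_assoc]
        simp only [zpow_add_one₀ q0]
        generalize (q : ℂ) ^ (invCount w + tailCount s w ⟨i + 1, h⟩) = z
        match_scalars
        field_simp
        ring
      -- The old left entry is zero, so the quadratic term drops out, and the exponents `+1` and
      -- `-1` cancel.
      · by_cases h4 : s ≤ (w ⟨i + 1, h⟩).val
        · simp only [h3, h4, if_true, if_false, smul_zero, add_zero]
          congr 2
          ring
        · simp [h3, h4]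
    · subst h2
      rw [particleOfWord, particleOfWord, hinv, tailCount_comp_swap h s w _ hne,
        tailCount_left h s w]
      simp only [Function.comp_apply, hσ, Equiv.swap_apply_right]
      by_cases h3 : s ≤ (w ⟨i, by omega⟩).val
      · have h4 : s ≤ (w ⟨i + 1, h⟩).val := by omega
        simp only [h3, h4, if_true]
        congr 2
        ring
      · simp [h3]
    · rw [particleOfWord, particleOfWord, hinv, tailCount_comp_swap h s w _ h1,
        Function.comp_apply, hσ, Equiv.swap_apply_of_ne_of_ne h1 h2]
      split_ifs with h3
      · rw [add_right_comm, zpow_add_one₀ q0, mul_comm, mul_smul]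
      · simp

end Words

/-! ### Positions of letters and colours -/

section Positions

lemma partialSum_mono {M : ℕ} (g : Fin M → ℕ) {a b : ℕ} (h : a ≤ b) :
    ∑ l : Fin M with l.val < a, g l ≤ ∑ l : Fin M with l.val < b, g l :=
  Finset.sum_le_sum_of_subset fun l hl => by
    simp only [Finset.mem_filter, Finset.mem_univ, true_and] at hl ⊢
    omega

lemma partialSum_succ {M : ℕ} {R : Type*} [AddCommMonoid R] (g : Fin M → R) (k : Fin M) :
    ∑ l : Fin M with l.val < k.val + 1, g l = g k + ∑ l : Fin M with l.val < k.val, g l := by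
  have : (Finset.univ.filter fun l : Fin M => l.val < k.val + 1) =
      insert k (Finset.univ.filter fun l : Fin M => l.val < k.val) := by
    ext l
    simp only [Finset.mem_filter, Finset.mem_univ, true_and, Finset.mem_insert, Fin.ext_iff]
    omega
  rw [this, Finset.sum_insert (by simp)]

/-- The library formula sums over `Fin y.1`; the filtered sum over all of `Fin M` is the form in
which `partSum` and `blockSum` are written. -/
lemma finSigmaFinEquiv_val {M : ℕ} (g : Fin M → ℕ) (y : Σ k, Fin (g k)) :
    (finSigmaFinEquiv y).val = ∑ l : Fin M with l.val < y.1.val, g l + y.2.val := by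
  rw [finSigmaFinEquiv_apply]
  congr 1
  refine Finset.sum_bij (fun i _ => Fin.castLE y.1.2.le i) (fun i _ =>
    Finset.mem_filter.2 ⟨Finset.mem_univ _, i.2⟩) (fun i _ j _ h => ?_)
    (fun l hl => ?_) (fun i _ => rfl)
  · simpa [Fin.ext_iff] using h
  · simp only [Finset.mem_filter, Finset.mem_univ, true_and] at hl
    exact ⟨⟨l.val, hl⟩, Finset.mem_univ _, rfl⟩

/-- In a concatenation of blocks, an entry belongs to the first `N` blocks exactly when it precedes
the end of the `N`-th one. This is used for the runs of equal letters in `1^{μ_1} ⋯ m^{μ_m}` and for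
the blocks of indices given by `bm`. -/
lemma finSigmaFinEquiv_lt_iff {M : ℕ} (g : Fin M → ℕ) (y : Σ k, Fin (g k)) (N : ℕ) :
    y.1.val < N ↔ (finSigmaFinEquiv y).val < ∑ l : Fin M with l.val < N, g l := by
  rw [finSigmaFinEquiv_val]
  constructor
  · intro h
    have h1 := partialSum_mono g (show y.1.val + 1 ≤ N from h)
    rw [partialSum_succ] at h1
    have := y.2.2
    omega
  · intro h
    by_contra h1
    have h1 := partialSum_mono g (not_lt.1 h1)
    omega

lemma Comp.letter_lt_iff {n m : ℕ} (μ : Comp n m) (p : Fin n) (N : ℕ) :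
    (μ.letter p).val < N ↔ p.val < μ.partSum N := by
  rw [Comp.letter, finSigmaFinEquiv_lt_iff μ.1 _ N, Equiv.apply_symm_apply]
  rfl

variable {n r : ℕ} {bm : Fin r → ℕ} (μ : Comp n (∑ k, bm k))

/-- The indices of the first `K` blocks form an initial segment of `Fin m`, so colours can be
compared with partial sums of `μ`. -/
lemma Comp.blockSum_eq_partSum (K : ℕ) :
    μ.blockSum K = μ.partSum (∑ k : Fin r with k.val < K, bm k) := by
  rw [Comp.blockSum, Comp.partSum, Finset.sum_filter, Finset.sum_filter, ← Equiv.sum_comp (xi bm)]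
  refine Finset.sum_congr rfl fun x _ => ?_
  have := finSigmaFinEquiv_lt_iff bm x K
  rw [xi]
  simp only [this]

lemma Comp.blockSum_mono {a b : ℕ} (h : a ≤ b) : μ.blockSum a ≤ μ.blockSum b := by
  rw [μ.blockSum_eq_partSum, μ.blockSum_eq_partSum]
  exact partialSum_mono _ (partialSum_mono _ h)

variable {k : Fin r} {t : Fin (bm k)} {s : ℕ}

/-- With `t` the last index of its block, `s` is the total length of the blocks up to and including
`k`. -/
lemma Comp.blockSum_succ (ht : t.val + 1 = bm k) (hs : s = (xi bm ⟨k, t⟩).val + 1) :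
    μ.blockSum (k.val + 1) = μ.partSum s := by
  rw [μ.blockSum_eq_partSum, partialSum_succ, hs, xi, finSigmaFinEquiv_val]
  congr 1
  dsimp only
  omega

lemma Comp.partSum_succ {m : ℕ} (μ : Comp n m) (l : Fin m) :
    μ.partSum (l.val + 1) = μ.1 l + μ.partSum l.val := partialSum_succ _ _

lemma Comp.partSum_le {m : ℕ} (μ : Comp n m) (N : ℕ) : μ.partSum N ≤ n := by
  refine le_of_le_of_eq ?_ μ.2
  exact Finset.sum_le_sum_of_subset (Finset.filter_subset _ _)

/-- The run of the last letter of block `k` is nonempty, hence its final position lies strictly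
beyond the end of block `k - 1`. Without `hμ` the colour could be smaller. -/
lemma Comp.colour_partSum (ht : t.val + 1 = bm k) (hs : s = (xi bm ⟨k, t⟩).val + 1)
    (hμ : μ.1 (xi bm ⟨k, t⟩) ≠ 0) : μ.colour (μ.partSum s) = k.val + 1 := by
  have h1 := μ.blockSum_succ ht hs
  refine le_antisymm (Nat.sInf_le h1.ge) (le_csInf ⟨_, h1.ge⟩ fun K hK => ?_)
  by_contra h2
  have h3 := μ.blockSum_mono (show K ≤ k.val by omega)
  have h4 : μ.blockSum k.val ≤ μ.partSum (xi bm ⟨k, t⟩).val := by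
    rw [μ.blockSum_eq_partSum]
    refine partialSum_mono _ ?_
    rw [xi, finSigmaFinEquiv_val]
    exact Nat.le_add_right _ _
  have h5 := μ.partSum_succ (xi bm ⟨k, t⟩)
  rw [← hs] at h5
  have h6 : μ.partSum s ≤ μ.blockSum K := hK
  omega

/-- Colours increase along the word, so every letter up to position `j` belongs to one of the blocks
`0, …, k`, whose indices are all `< s`. -/
lemma Comp.letter_lt_of_colour (ht : t.val + 1 = bm k) (hs : s = (xi bm ⟨k, t⟩).val + 1)
    {j : ℕ} (h1 : 1 ≤ j) (hn : j ≤ n) (hc : μ.colour j ≤ k.val + 1) (p : Fin n)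
    (hp : p.val < j) : (μ.letter p).val < s := by
  rw [μ.letter_lt_iff, ← μ.blockSum_succ ht hs]
  exact lt_of_lt_of_le hp ((μ.colour_spec h1 hn).2.2.2.trans (μ.blockSum_mono hc))

end Positions

/-! ### The action of `f_i` on basis vectors -/

section LoweringOperators
variable {n m : ℕ} (q : ℂˣ) (i : Fin m)

lemma trivRep_f : trivRep q n m (Uq.gen q m (.f i)) = 0 := by
  have : Uq.counit q m (Uq.gen q m (.f i)) = 0 := Uq.lift_gen _ _ _
  rw [trivRep, AlgHom.comp_apply, this, map_zero]

lemma trivRep_kInv : trivRep q n m (Uq.gen q m (.kInv i)) = 1 := by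
  have : Uq.counit q m (Uq.gen q m (.kInv i)) = 1 := Uq.lift_gen _ _ _
  rw [trivRep, AlgHom.comp_apply, this, map_one]

lemma filter_val_lt_succ {p : ℕ} (hp : p < n) :
    (Finset.univ.filter fun a : Fin n => a.val < p + 1) =
      insert ⟨p, hp⟩ (Finset.univ.filter fun a : Fin n => a.val < p) := by
  ext l
  simp only [Finset.mem_filter, Finset.mem_univ, true_and, Finset.mem_insert, Fin.ext_iff]
  omega

lemma tensRepAux_kInv_tv (p : ℕ) (hp : p ≤ n) (w : Fin n → Fin m × ℤ) :
    (tensRepAux q n m p).1 (Uq.gen q m (.kInv i)) (tv w) =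
      (∏ b : Fin n with b.val < p, (q : ℂ) ^ (-wt i (w b).1)) • tv w := by
  induction p with
  | zero =>
    change trivRep q n m (Uq.gen q m (.kInv i)) (tv w) = _
    rw [trivRep_kInv]
    simp
  | succ p ih =>
    rw [tensRepAux_succ q p hp, conv, Module.End.mul_apply, site_tv, vOp_kInv, map_smul, put_bv,
      Function.update_eq_self, map_smul, ih (by omega), smul_smul, filter_val_lt_succ hp,
      Finset.prod_insert (by simp)]

/-- Iterating `Δ(f_i) = f_i ⊗ 1 + k_i^- ⊗ f_i` puts `f_i` at one site `a` and `k_i^-` at every site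
to the left of it. -/
lemma tensRepAux_f_tv (p : ℕ) (hp : p ≤ n) (w : Fin n → Fin m × ℤ) :
    (tensRepAux q n m p).1 (Uq.gen q m (.f i)) (tv w) =
      ∑ a : Fin n with a.val < p, if (w a).1 = cpred i then
        (∏ b : Fin n with b.val < a.val, (q : ℂ) ^ (-wt i (w b).1)) •
          tv (Function.update w a (i, (w a).2 - deltaZero i)) else 0 := by
  induction p with
  | zero =>
    change trivRep q n m (Uq.gen q m (.f i)) (tv w) = _
    rw [trivRep_f]
    simp
  | succ p ih =>
    -- Letting `k_i^-` act first keeps it on the original basis vector, where it is a scalar.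
    have hc : Commute (site ⟨p, hp⟩ (vOp q m (.f i)))
        ((tensRepAux q n m p).1 (Uq.gen q m (.kInv i))) :=
      (tensRepAux q n m p).2 _ ⟨p, hp⟩ _ le_rfl
    rw [tensRepAux_succ q p hp, conv, LinearMap.add_apply, ← hc.eq, Module.End.mul_apply,
      tensRepAux_kInv_tv q i p (by omega), map_smul, site_tv, vOp_f, ih (by omega),
      filter_val_lt_succ hp, Finset.sum_insert (by simp), add_comm, apply_ite (put w _), put_bv,
      map_zero, smul_ite, smul_zero]

lemma tensRep_f_tv (w : Fin n → Fin m × ℤ) :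
    tensRep q n m (Uq.gen q m (.f i)) (tv w) =
      ∑ a : Fin n, if (w a).1 = cpred i then
        (∏ b : Fin n with b.val < a.val, (q : ℂ) ^ (-wt i (w b).1)) •
          tv (Function.update w a (i, (w a).2 - deltaZero i)) else 0 := by
  rw [tensRep, tensRepAux_f_tv q i n le_rfl, Finset.filter_true_of_mem fun a _ => a.2]

/-- Equality includes the exponents, so the divided-difference sums in `twoSite` are empty. -/
lemma That_tv_of_eq (j : ℕ) (h : j + 1 < n) (w : Fin n → Fin m × ℤ)
    (hw : w ⟨j, by omega⟩ = w ⟨j + 1, h⟩) : That q j h (tv w) = (q : ℂ) • tv w := by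
  rw [That_tv, twoSite, hw]
  simp only [if_true, Finset.Ico_self, Finset.sum_empty, sub_self, smul_zero, add_zero]
  conv_lhs => arg 2; arg 4; rw [← hw]
  rw [put2_self]

end LoweringOperators

/-! ### Factors of the cyclotomic polynomial -/

section CycTail
variable {r : ℕ} (Q : Fin r → ℂˣ)

/-- `∏_{1 ≤ l < k} (X - Q_l)`. -/
noncomputable def cycTail (k : ℕ) : Polynomial ℂ :=
  ∏ l : Fin r with 0 < l.val ∧ l.val < k, (Polynomial.X - Polynomial.C (Q l : ℂ))

lemma cycPoly_eq_mul_cycTail (h : 0 < r) {k : ℕ} (hk : 1 ≤ k) :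
    cycPoly Q k = (Polynomial.X - Polynomial.C (Q ⟨0, h⟩ : ℂ)) * cycTail Q k := by
  have : (Finset.univ.filter fun l : Fin r => l.val < k) =
      insert ⟨0, h⟩ (Finset.univ.filter fun l : Fin r => 0 < l.val ∧ l.val < k) := by
    ext l
    simp only [Finset.mem_filter, Finset.mem_univ, true_and, Finset.mem_insert, Fin.ext_iff]
    omega
  rw [cycPoly, cycTail, this, Finset.prod_insert (by simp)]

/-- Makes a generator of colour at least `k + 2` vanish once `cycTail Q (k + 2)` does. -/
lemma cycTail_dvd {k k' : ℕ} (h : k ≤ k') : cycTail Q k ∣ cycTail Q k' :=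
  Finset.prod_dvd_prod_of_subset _ _ _ fun l hl => by
    simp only [Finset.mem_filter, Finset.mem_univ, true_and] at hl ⊢
    omega

lemma cycTail_succ (l : Fin r) (h : 0 < l.val) :
    cycTail Q (l.val + 1) = (Polynomial.X - Polynomial.C (Q l : ℂ)) * cycTail Q l.val := by
  have : (Finset.univ.filter fun l' : Fin r => 0 < l'.val ∧ l'.val < l.val + 1) =
      insert l (Finset.univ.filter fun l' : Fin r => 0 < l'.val ∧ l'.val < l.val) := by
    ext l'
    simp only [Finset.mem_filter, Finset.mem_univ, true_and, Finset.mem_insert, Fin.ext_iff]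
    omega
  rw [cycTail, cycTail, this, Finset.prod_insert (by simp)]

lemma cycTail_ne_zero (k : ℕ) : cycTail Q k ≠ 0 :=
  Finset.prod_ne_zero_iff.2 fun l _ => Polynomial.X_sub_C_ne_zero _

end CycTail

lemma AK.isUnit_asc {n r : ℕ} {q : ℂˣ} {Q : Fin r → ℂˣ} (j : ℕ) (h : j < n) :
    IsUnit (AK.asc n r q Q j) := by
  induction j with
  | zero => exact isUnit_one
  | succ j ih => exact (ih (by omega)).mul (AK.isUnit_T h)

/-! ### The submodule `I` is not stable -/

section Main
variable {n r : ℕ} {q : ℂˣ} {Q : Fin r → ℂˣ} {bm : Fin r → ℕ} {P : Type} [CommRing P]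
  [Algebra ℂ P] {x : P} (hr : 0 < r) {k : Fin r} {t : Fin (bm k)} {i : Fin (∑ k, bm k)}
  (hf : (Polynomial.X - Polynomial.C (Q ⟨0, hr⟩ : ℂ)) * cycTail Q (k.val + 2) ∣ cycPoly Q r)
  (hv : ∀ p, (particleVec q (Q ⟨0, hr⟩ : ℂ) x
    (Polynomial.aeval x (cycTail Q (k.val + 2)) * p) : Fin n → P) = 0)

lemma extendWtV_vTilde (μ : Comp n (∑ k, bm k)) (s : ℕ) :
    extendWtV (particleOfWord_compatible hf hv s) (vTilde q Q μ) =
      particleOfWord q P s μ.letter := by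
  rw [vTilde, extendWtV_tmul, map_one, MulOpposite.unop_one, Module.End.one_apply,
    extendTens_tv_zero _ _ _ fun a => rfl]

/-- The map to the one-particle module kills the submodule `I`. -/
lemma extendWtV_subI (hn : 0 < n) (ht : t.val + 1 = bm k)
    (hi : i.val = (xi bm ⟨k, t⟩).val + 1) (y : WtV n (∑ k, bm k) r q Q)
    (hy : y ∈ subI n r q Q bm) :
    extendWtV (particleOfWord_compatible hf hv i.val) y = 0 := by
  induction hy using Submodule.span_induction with
  | zero => exact map_zero _
  | add y z _ _ hy hz => rw [map_add, hy, hz, add_zero]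
  | smul a y _ hy =>
    rw [← MulOpposite.op_unop a, extendWtV_op_smul, hy, map_zero]
  | mem y hy =>
    obtain ⟨μ, j, h1, hj, rfl⟩ := hy
    obtain ⟨hc, -⟩ := μ.colour_spec h1 hj
    rw [extendWtV_op_smul, extendWtV_vTilde hr hf hv,
      particleRep_Lang hf hv hn _ _ _ (cycPoly_eq_mul_cycTail Q hr hc)]
    convert map_zero (particleRep hf hv (AK.asc n r q Q (j - 1))).unop
    -- Colour at least `k + 2`: the polynomial annihilates. Colour at most `k + 1`: there is no
    -- particle among the first `j` positions.
    rcases Nat.lt_or_ge (k.val + 1) (μ.colour j) with h | h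
    · obtain ⟨g, hg⟩ := cycTail_dvd Q (show k.val + 2 ≤ μ.colour j from h)
      rw [hg, map_mul (Polynomial.aeval x), mul_assoc, hv]
    · have hz : ∀ a : Fin n, a.val < j → particleOfWord q P i.val μ.letter a = 0 := fun a ha =>
        if_neg (not_le.2 (μ.letter_lt_of_colour ht hi h1 hj h a ha))
      rw [particleRep_desc hf hv (j - 1) (by omega) _ fun a ha => hz a (by omega),
        hz _ (show j - 1 < j by omega), mul_zero, map_zero]

/-- In a right module the leftmost factors `T_{a+j}, …, T_{a+1}` of `T_{a+j} ⋯ T_1` act first, each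
as `q`. -/
lemma particleRep_desc_of_eigen (a j : ℕ) (h : a + j < n) (u : Fin n → P)
    (hu : ∀ l (hl : l + 1 < n), a ≤ l → l < a + j →
      (particleRep hf hv (AK.T n r q Q (l + 1))).unop u = (q : ℂ) • u) :
    (particleRep hf hv (AK.desc n r q Q (a + j))).unop u =
      (q : ℂ) ^ j • (particleRep hf hv (AK.desc n r q Q a)).unop u := by
  induction j with
  | zero => simp
  | succ j ih =>
    rw [← add_assoc, AK.desc, map_mul, MulOpposite.unop_mul, Module.End.mul_apply,
      hu (a + j) (by omega) (by omega) (by omega), map_smul,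
      ih (by omega) (fun l hl h1 h2 => hu l hl h1 (by omega)), smul_smul, pow_succ']

/-- The image of the lowered vector in the one-particle module is a nonzero scalar times
`particleVec (g(x))`, acted on by the invertible element `T_1 ⋯ T_{N-1}`; here `g = cycTail Q (k +
1)`, and `hg` says that this is nonzero. -/
lemma lowering_notMem_subI
    (hf : (Polynomial.X - Polynomial.C (Q ⟨0, hr⟩ : ℂ)) * cycTail Q (k.val + 2) ∣ cycPoly Q r)
    (hv : ∀ p, (particleVec q (Q ⟨0, hr⟩ : ℂ) x
      (Polynomial.aeval x (cycTail Q (k.val + 2)) * p) : Fin n → P) = 0)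
    (hn : 0 < n) (ht : t.val + 1 = bm k)
    (hi : i.val = (xi bm ⟨k, t⟩).val + 1)
    (hg : (particleVec q (Q ⟨0, hr⟩ : ℂ) x
      (Polynomial.aeval x (cycTail Q (k.val + 1))) : Fin n → P) ≠ 0)
    (μ : Comp n (∑ k, bm k)) (hμ : μ.1 (xi bm ⟨k, t⟩) ≠ 0) :
    Uq.gen q (∑ k, bm k) (.f i) • (MulOpposite.op
      (AK.Lang n r q Q (μ.partSum i.val) (μ.colour (μ.partSum i.val))) • vTilde q Q μ) ∉
        subI n r q Q bm := by
  intro hmem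
  have h0 := extendWtV_subI hr hf hv hn ht hi _ hmem
  have q0 := q.ne_zero
  set w : Fin n → Fin (∑ k, bm k) × ℤ := fun p => (μ.letter p, 0) with hw
  set Φ := extendTens (particleRep hf hv) (particleOfWord (n := n) (m := ∑ k, bm k) q P i.val)
  set u : Fin n → P := Φ (tensRep q n _ (Uq.gen q _ (.f i)) (tv w)) with hu
  -- As `i.val` is positive, the affine node with its wrap-around and shift of degree is excluded.
  have hxi : cpred i = xi bm ⟨k, t⟩ ∧ deltaZero i = 0 := by
    rcases cpred_cases i with ⟨h1, h2⟩ | ⟨-, h2, -⟩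
    · exact ⟨Fin.ext (by omega), h1⟩
    · omega
  -- The two actions commute, so `f_i` can be applied to `ṽ_μ` before `L_N^{⟨c⟩}`.
  rw [smul_comm, extendWtV_op_smul] at h0
  have h1 : extendWtV (particleOfWord_compatible hf hv i.val)
      (Uq.gen q (∑ k, bm k) (.f i) • vTilde q Q μ) = u := by
    rw [vTilde, left_smul_tmul, extendWtV_tmul, map_one]
    rfl
  -- The letter lowered by `f_i` occupies the positions from `a₀` up to, but not including,
  -- `μ.partSum i.val`.
  set a₀ := μ.partSum (xi bm ⟨k, t⟩).val with ha₀
  have hN : μ.partSum i.val = μ.1 (xi bm ⟨k, t⟩) + a₀ := by rw [hi, μ.partSum_succ]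
  have hNn := μ.partSum_le i.val
  rw [h1, μ.colour_partSum ht hi hμ, particleRep_Lang hf hv hn _ _ _
    (cycPoly_eq_mul_cycTail Q hr (by omega))] at h0
  have hletter : ∀ p : Fin n, a₀ ≤ p.val → p.val < μ.partSum i.val →
      μ.letter p = cpred i := fun p hp1 hp2 => by
    have e1 := (μ.letter_lt_iff p (xi bm ⟨k, t⟩).val).not.2 (not_lt.2 hp1)
    have e2 := (μ.letter_lt_iff p i.val).2 hp2
    rw [hxi.1]
    exact Fin.ext (by omega)
  -- Inside a run of equal letters `T̂` acts on the basis vector by `q`; since `f_i` commutes with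
  -- `T̂`, the eigenvalue is inherited by `u`.
  have heigen : ∀ l (hl : l + 1 < n), a₀ ≤ l → l < a₀ + (μ.1 (xi bm ⟨k, t⟩) - 1) →
      (particleRep hf hv (AK.T n r q Q (l + 1))).unop u = (q : ℂ) • u := fun l hl h2 h3 => by
    have hc : Commute (That q l hl) (tensRep q n _ (Uq.gen q _ (.f i))) :=
      That_tensRepAux q l hl n (Or.inr hl) _
    have hc' := LinearMap.congr_fun hc.eq (tv w)
    rw [Module.End.mul_apply, Module.End.mul_apply, That_tv_of_eq q l hl w, map_smul] at hc'
    · rw [hu, ← extendTens_That (particleOfWord_compatible hf hv i.val) l hl, hc', map_smul]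
    · simp only [hw]
      rw [hletter _ h2 (show l < _ by omega), hletter _ (show a₀ ≤ l + 1 by omega)
        (show l + 1 < _ by omega)]
  -- Before the end of the run all letters of `ṽ_μ` are `< i`. Thus only the term of `f_i` that
  -- changes position `a` itself contributes to `u a`, and its coefficient is a product of powers of
  -- `q`.
  have hlow : ∀ a : Fin n, a.val < μ.partSum i.val → ∃ c : ℂ, c ≠ 0 ∧
      u a = if μ.letter a = cpred i then c • 1 else 0 := fun a ha => by
    rw [hu, tensRep_f_tv, map_sum, Finset.sum_apply, Finset.sum_eq_single a]
    · refine ⟨(∏ b : Fin n with b.val < a.val, (q : ℂ) ^ (-wt i (w b).1)) *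
        (q : ℂ) ^ (invCount (fun b => (Function.update w a (i, (w a).2 - deltaZero i) b).1) +
          tailCount i.val (fun b => (Function.update w a (i, (w a).2 - deltaZero i) b).1) a),
        mul_ne_zero (Finset.prod_ne_zero_iff.2 fun b _ => zpow_ne_zero _ q0)
          (zpow_ne_zero _ q0), ?_⟩
      simp only [hw]
      split_ifs with h2
      · rw [map_smul, extendTens_tv_zero, Pi.smul_apply, particleOfWord, if_pos (by simp),
          smul_smul]
        intro b
        by_cases hb : b = a
        · subst hb; simp [hxi.2]
        · simp [hb]
      · simp
    · intro b _ hb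
      split_ifs with h2
      · rw [map_smul, extendTens_tv_zero, Pi.smul_apply, particleOfWord, if_neg, smul_zero]
        · rw [Function.update_of_ne hb.symm, not_le]
          exact (μ.letter_lt_iff a i.val).2 ha
        · intro c
          by_cases hc : c = b
          · subst hc; simp [hw, hxi.2]
          · simp [hc, hw]
      · simp
    · simp
  have hzero : ∀ a : Fin n, a.val < a₀ → u a = 0 := fun a ha => by
    obtain ⟨c, -, hc⟩ := hlow a (by omega)
    rw [hc, if_neg]
    intro h2
    have := (μ.letter_lt_iff a (xi bm ⟨k, t⟩).val).2 ha
    rw [h2, hxi.1] at this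
    exact lt_irrefl _ this
  have hlt : a₀ < μ.partSum i.val := by omega
  obtain ⟨c, hc0, hc⟩ := hlow ⟨a₀, by omega⟩ hlt
  rw [if_pos (hletter _ le_rfl hlt)] at hc
  -- The factors `T` inside the run give a power of `q`. To the left of the run `u` vanishes, so the
  -- remaining factors carry the entry `u a₀ = c` to the first site unchanged.
  rw [show μ.partSum i.val - 1 = a₀ + (μ.1 (xi bm ⟨k, t⟩) - 1) by omega,
    particleRep_desc_of_eigen hr hf hv a₀ _ (by omega) u heigen, Pi.smul_apply,
    particleRep_desc hf hv a₀ (by omega) u hzero, hc, mul_smul_comm, mul_smul_comm, mul_one,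
    map_smul, map_smul, map_smul, map_smul] at h0
  have h2 := (smul_eq_zero.1 ((smul_eq_zero.1 h0).resolve_left (pow_ne_zero _ q0))).resolve_left hc0
  -- Cancelling the invertible `T_1 ⋯ T_{N-1}` leaves `particleVec (g(x)) = 0`, against `hg`.
  obtain ⟨U, hU⟩ := AK.isUnit_asc (r := r) (q := q) (Q := Q) (a₀ + (μ.1 (xi bm ⟨k, t⟩) - 1))
    (show _ < n by omega)
  have h3 := congrArg (fun z => (particleRep hf hv z).unop (particleVec q (Q ⟨0, hr⟩ : ℂ) x
    (Polynomial.aeval x (cycTail Q (k.val + 1))))) U.mul_inv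
  simp only [map_mul, map_one, MulOpposite.unop_mul, MulOpposite.unop_one,
    Module.End.mul_apply, Module.End.one_apply] at h3
  rw [hU, h2, map_zero] at h3
  exact hg h3.symm

end Main

/-- Coefficients for the one-particle module. -/
lemma exists_particle_coefficients {n r : ℕ} (hn : 0 < n) {q : ℂˣ} (hq : (q : ℂ) ^ 2 ≠ 1)
    (Q : Fin r → ℂˣ) (hr : 0 < r) (k : ℕ) (hk : k + 1 < r) :
    ∃ (P : Type) (_ : CommRing P) (_ : Algebra ℂ P) (x : P),
      (∀ p, (particleVec q (Q ⟨0, hr⟩ : ℂ) x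
        (Polynomial.aeval x (cycTail Q (k + 2)) * p) : Fin n → P) = 0) ∧
      (particleVec q (Q ⟨0, hr⟩ : ℂ) x (Polynomial.aeval x (cycTail Q (k + 1))) :
        Fin n → P) ≠ 0 := by
  have hsucc : cycTail Q (k + 2) =
      (Polynomial.X - Polynomial.C (Q ⟨k + 1, hk⟩ : ℂ)) * cycTail Q (k + 1) :=
    cycTail_succ Q ⟨k + 1, hk⟩ (Nat.succ_pos k)
  have hg0 := cycTail_ne_zero Q (k + 1)
  have q0 := q.ne_zero
  have hκ : (q : ℂ) - (q : ℂ)⁻¹ ≠ 0 := by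
    intro h
    apply hq
    rw [sub_eq_zero] at h
    rw [sq]
    nth_rw 2 [h]
    exact mul_inv_cancel₀ q0
  -- With a second site, non-vanishing is detected there, by `x g(x)`, whatever the coincidences
  -- among the `Q_l`. With a single site only `(x - Q_0) g(x)` is available; it could vanish modulo
  -- `cycTail Q (k + 2)` when `Q_{k+1} = Q_0`, so a larger quotient is taken.
  rcases Nat.lt_or_ge 1 n with h1 | h1
  · refine ⟨AdjoinRoot (cycTail Q (k + 2)), inferInstance, inferInstance, AdjoinRoot.root _,
      fun p => ?_, fun h => ?_⟩
    · rw [AdjoinRoot.aeval_eq, AdjoinRoot.mk_self, zero_mul, map_zero]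
    · have h2 := congrFun h ⟨1, h1⟩
      rw [particleVec_apply, if_neg (by simp), Pi.zero_apply, neg_eq_zero, smul_eq_zero,
        AdjoinRoot.aeval_eq, ← AdjoinRoot.mk_X, ← map_mul, AdjoinRoot.mk_eq_zero, hsucc] at h2
      have h3 := h2.resolve_left (by simpa using hκ)
      -- Cancelling `g` leaves `X - Q_{k+1} ∣ X`, which contradicts `Q_{k+1} ≠ 0`.
      have h4 := Polynomial.eval_dvd (x := (Q ⟨k + 1, hk⟩ : ℂ)) ((mul_dvd_mul_iff_right hg0).1 h3)
      simp at h4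
  · obtain rfl : n = 1 := by omega
    set f := (Polynomial.X - Polynomial.C (Q ⟨0, hr⟩ : ℂ)) * cycTail Q (k + 2) with hf
    have hvec : ∀ g : Polynomial ℂ, (AdjoinRoot.root f) * AdjoinRoot.mk f g -
        (Q ⟨0, hr⟩ : ℂ) • AdjoinRoot.mk f g =
          AdjoinRoot.mk f ((Polynomial.X - Polynomial.C (Q ⟨0, hr⟩ : ℂ)) * g) := fun g => by
      rw [map_mul, map_sub, AdjoinRoot.mk_X, sub_mul, Algebra.smul_def]
      rfl
    refine ⟨AdjoinRoot f, inferInstance, inferInstance, AdjoinRoot.root _,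
      fun p => ?_, fun h => ?_⟩
    · obtain ⟨p, rfl⟩ := AdjoinRoot.mk_surjective p
      funext a
      rw [particleVec_apply, if_pos (by omega), AdjoinRoot.aeval_eq, ← map_mul, hvec, ← mul_assoc,
        ← hf, map_mul, AdjoinRoot.mk_self, zero_mul]
      rfl
    · have h2 := congrFun h ⟨0, hn⟩
      rw [particleVec_apply, if_pos rfl, AdjoinRoot.aeval_eq, hvec, Pi.zero_apply,
        AdjoinRoot.mk_eq_zero, hf] at h2
      have h3 := (mul_dvd_mul_iff_left (Polynomial.X_sub_C_ne_zero _)).1 h2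
      rw [hsucc] at h3
      -- The factors `X - Q_0` and `g` cancel, so a polynomial of degree one would divide `1`.
      have h4 : (Polynomial.X - Polynomial.C (Q ⟨k + 1, hk⟩ : ℂ)) ∣ 1 :=
        (mul_dvd_mul_iff_right hg0).1 (by rwa [one_mul])
      have h5 := Polynomial.eval_dvd (x := (Q ⟨k + 1, hk⟩ : ℂ)) h4
      simp at h5

end SchurWeyl

/-! ### The two claims. -/

theorem mainTheorem6 (n r : ℕ) (q : ℂˣ) (hq : (q : ℂ) ^ 2 ≠ 1) (Q : Fin r → ℂˣ) (bm : Fin r → ℕ)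
    (hbm : ∀ k, 0 < bm k) :
    (∀ (μ : SchurWeyl.Comp n (∑ k, bm k)) (k : Fin r) (t : Fin (bm k)) (i : Fin (∑ k, bm k)),
      t.val + 1 = bm k → i.val = (SchurWeyl.xi bm ⟨k, t⟩).val + 1 →
      μ.1 (SchurWeyl.xi bm ⟨k, t⟩) ≠ 0 →
      SchurWeyl.Uq.gen q (∑ k, bm k) (.f i) •
          (MulOpposite.op
              (SchurWeyl.AK.Lang n r q Q (μ.partSum i.val) (μ.colour (μ.partSum i.val))) •
            SchurWeyl.vTilde q Q μ) ∉
        SchurWeyl.subI n r q Q bm) ∧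
    (1 ≤ n → 2 ≤ r →
      ¬ ∀ (u : SchurWeyl.Uq q (∑ k, bm k)) (x : SchurWeyl.WtV n (∑ k, bm k) r q Q),
        x ∈ SchurWeyl.subI n r q Q bm → u • x ∈ SchurWeyl.subI n r q Q bm) := by
  have key : ∀ (μ : SchurWeyl.Comp n (∑ k, bm k)) (k : Fin r) (t : Fin (bm k))
      (i : Fin (∑ k, bm k)), t.val + 1 = bm k → i.val = (SchurWeyl.xi bm ⟨k, t⟩).val + 1 →
      μ.1 (SchurWeyl.xi bm ⟨k, t⟩) ≠ 0 →
      SchurWeyl.Uq.gen q (∑ k, bm k) (.f i) •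
          (MulOpposite.op
              (SchurWeyl.AK.Lang n r q Q (μ.partSum i.val) (μ.colour (μ.partSum i.val))) •
            SchurWeyl.vTilde q Q μ) ∉ SchurWeyl.subI n r q Q bm := by
    intro μ k t i ht hi hμ
    have hr : 0 < r := k.pos
    have hn : 0 < n := by
      have := μ.partSum_succ (SchurWeyl.xi bm ⟨k, t⟩)
      have := μ.partSum_le ((SchurWeyl.xi bm ⟨k, t⟩).val + 1)
      omega
    -- Since `i` is an index just past block `k`, that block is not the last one, and `Q_{k+1}`
    -- exists.
    have hk : k.val + 1 < r := by
      by_contra h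
      have h1 := i.2
      have h2 := SchurWeyl.partialSum_succ bm k
      rw [Finset.filter_true_of_mem fun l _ => by have := l.2; omega] at h2
      rw [hi, SchurWeyl.xi, SchurWeyl.finSigmaFinEquiv_val] at h1
      dsimp only at h1
      omega
    obtain ⟨P, _, _, x, hv, hg⟩ :=
      SchurWeyl.exists_particle_coefficients hn hq Q hr k.val hk
    refine SchurWeyl.lowering_notMem_subI hr ?_ hv hn ht hi hg μ hμ
    rw [SchurWeyl.cycPoly_eq_mul_cycTail Q hr hr]
    exact mul_dvd_mul_left _ (SchurWeyl.cycTail_dvd Q hk)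
  refine ⟨key, fun hn hr h => ?_⟩
  -- A witness for instability: all of `n` is placed on the last index of the first block. As `r ≥
  -- 2` and blocks are nonempty, the next index exists.
  let k : Fin r := ⟨0, by omega⟩
  let t : Fin (bm k) := ⟨bm k - 1, by have := hbm k; omega⟩
  have ht : t.val + 1 = bm k := by have := hbm k; simp only [t]; omega
  let a := SchurWeyl.xi bm ⟨k, t⟩
  have ha : a.val + 1 < ∑ k, bm k := by
    have h1 : a.val + 1 = ∑ l : Fin r with l.val < k.val + 1, bm l := by
      rw [SchurWeyl.partialSum_succ]
      simp only [a, SchurWeyl.xi, SchurWeyl.finSigmaFinEquiv_val]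
      omega
    have h2 := SchurWeyl.partialSum_succ bm (⟨1, by omega⟩ : Fin r)
    have h3 : ∑ l : Fin r with l.val < 1 + 1, bm l ≤ ∑ k, bm k :=
      Finset.sum_le_sum_of_subset (Finset.filter_subset _ _)
    have h4 := hbm ⟨1, by omega⟩
    simp only [k, zero_add] at h1
    dsimp only at h2
    omega
  let μ : SchurWeyl.Comp n (∑ k, bm k) := ⟨Pi.single a n, by simp⟩
  have hμ : μ.1 a ≠ 0 := by simp [μ]; omega
  -- The vector being lowered is itself one of the generators, with `j = μ.partSum (a.val + 1)`; the
  -- inequality left over, `1 ≤ j`, follows from `n ≥ 1`.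
  refine key μ k t ⟨a.val + 1, ha⟩ ht rfl hμ (h _ _ (Submodule.subset_span
    ⟨μ, μ.partSum (a.val + 1), ?_, μ.partSum_le _, rfl⟩))
  have := μ.partSum_succ a
  omega
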